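/- **Theorem 1.** Let $A,\Sigma_{x_0},\Sigma_w\in\mathbb{R}^{p\times p}$ with $\Sigma_{x_0}\succ 0$ and $\Sigma_w\succ 0$, and let $x_{t+1}=Ax_t+w_t$, $t=0,1,\dots$, be a time-invariant $\mathbb{R}^p$-valued Gauss–Markov source, where $x_0\sim\mathcal N(0,\Sigma_{x_0})$ and $(w_t)_{t\ge 0}$ is a white noise sequence (independent $\mathcal N(0,\Sigma_w)$ vectors) independent of $x_0$. A causal policy is a sequence of conditional distributions $P(dy_t\mid y^{t-1},x^t)$ on $\mathbb{R}^p$, $t=0,1,\dots$, where $x^t=(x_0,\dots,x_t)$ and $y^{t-1}=(y_0,\dots,y_{t-1})$; together with the source it determines the joint law $P(dx^n)\otimes\prod_{t=0}^nP(dy_t\mid y^{t-1},x^t)$ of $(x^n,y^n)$ and hence the mutual information $I(x^n;y^n)\in[0,\infty]$ (in nats). Let $D>0$. Define the finite-time sequential rate-distortion function $$R^{\mathrm{SRD}}_{0,n}(D)=\inf\Big\{\tfrac1{n+1}I(x^n;y^n)\;:\;\mathbb{E}\|x_t-y_t\|^2\le D,\ t=0,\dots,n\Big\},$$ the infimum being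 over causal policies, and $$\widehat R^{\mathrm{SRD}}(D)=\inf\Big\{\lim_{n\to\infty}\tfrac1{n+1}I(x^n;y^n)\;:\;\mathbb{E}\|x_t-y_t\|^2\le D\ \text{ for all } t\ge 0\Big\},$$ the infimum being over causal policies for which the limit exists in $[0,\infty]$. Then the limit $R^{\mathrm{SRD}}(D)=\lim_{n\to\infty}R^{\mathrm{SRD}}_{0,n}(D)$ exists, is finite, and $$R^{\mathrm{SRD}}(D)=\widehat R^{\mathrm{SRD}}(D)=\min_{P\succ 0,\,Q\succ 0}\; -\tfrac12\log\det Q+\tfrac12\log\det\Sigma_w$$ $$\text{subject to}\quad P\preceq APA^{\mathsf T}+\Sigma_w,\qquad \operatorname{tr}P\le D,\qquad \begin{bmatrix}P-Q & PA^{\mathsf T}\\ AP & APA^{\mathsf T}+\Sigma_w\end{bmatrix}\succeq 0,$$ where the minimum is attained. -/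

import Mathlib

open MeasureTheory ProbabilityTheory Filter Topology
open scoped NNReal ENNReal Matrix

noncomputable section

namespace SRD

/-- `𝐱₀ ∼ N(0, Σ₀)`, and `𝐱ₜ₊₁ = A 𝐱ₜ + 𝐰ₜ` where `𝐰` is a white noise process (independent
`N(0, Σw)` vectors) that is independent of `𝐱₀`. -/
structure IsGaussMarkovSource {p : ℕ} (A Sigma0 SigmaW : Matrix (Fin p) (Fin p) ℝ)
    {Ω : Type*} [MeasurableSpace Ω] (μ : Measure Ω)
    (x w : ℕ → Ω → EuclideanSpace ℝ (Fin p)) : Prop where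
  measurable_init : Measurable (x 0)
  measurable_noise : ∀ t, Measurable (w t)
  law_init : HasLaw (x 0) (multivariateGaussian 0 Sigma0) μ
  law_noise : ∀ t, HasLaw (w t) (multivariateGaussian 0 SigmaW) μ
  white : iIndepFun w μ
  indep_init : IndepFun (x 0) (fun ω t => w t ω) μ
  step : ∀ t ω, x (t + 1) ω = Matrix.toEuclideanCLM (𝕜 := ℝ) A (x t ω) + w t ω

/-- The law of `𝐱ⁿ = (𝐱₀, …, 𝐱ₙ)`. -/
def sourceLaw {E Ω : Type*} [MeasurableSpace E] [MeasurableSpace Ω] (μ : Measure Ω)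
    (x : ℕ → Ω → E) (n : ℕ) : Measure (Fin (n + 1) → E) :=
  μ.map (fun ω (i : Fin (n + 1)) => x i ω)

/-- A sequence of conditional distributions `P(dyₜ | yᵗ⁻¹, xᵗ)`, `t = 0, 1, …`, where
`xᵗ = (x₀, …, xₜ)` and `yᵗ⁻¹ = (y₀, …, yₜ₋₁)`. -/
structure CausalPolicy (E : Type*) [MeasurableSpace E] where
  kernel : (t : ℕ) → Kernel ((Fin (t + 1) → E) × (Fin t → E)) E
  isMarkov : ∀ t, IsMarkovKernel (kernel t)

theorem measurable_finInit {E : Type*} [MeasurableSpace E] (n : ℕ) :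
    Measurable (fun x : Fin (n + 1) → E => (Fin.init x : Fin n → E)) :=
  measurable_pi_lambda _ fun i => measurable_pi_apply i.castSucc

theorem measurable_finSnoc {E : Type*} [MeasurableSpace E] (n : ℕ) :
    Measurable (fun yz : (Fin n → E) × E => (Fin.snoc yz.1 yz.2 : Fin (n + 1) → E)) := by
  refine measurable_pi_lambda _ fun i => ?_
  refine Fin.lastCases ?_ (fun j => ?_) i
  · simpa using measurable_snd
  · simpa [Function.comp_def] using (measurable_pi_apply j).comp measurable_fst

namespace CausalPolicy

variable {E : Type*} [MeasurableSpace E]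

/-- The causally conditioned distribution `∏_{t < n} P(dyₜ | yᵗ⁻¹, xᵗ)` of `(y₀, …, yₙ₋₁)`
given `(x₀, …, xₙ₋₁)`. -/
def causalKernel (π : CausalPolicy E) : (n : ℕ) → Kernel (Fin n → E) (Fin n → E)
  | 0 => Kernel.id
  | n + 1 =>
    ((((causalKernel π n).comap (fun x => Fin.init x) (measurable_finInit n)) ⊗ₖ
      (π.kernel n)).map (fun yz => Fin.snoc yz.1 yz.2))

instance isMarkovKernel_causalKernel (π : CausalPolicy E) (n : ℕ) :
    IsMarkovKernel (π.causalKernel n) := by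
  induction n with
  | zero => unfold causalKernel; infer_instance
  | succ n ih =>
    have := π.isMarkov n
    unfold causalKernel
    exact Kernel.IsMarkovKernel.map _ (measurable_finSnoc n)

variable {Ω : Type*} [MeasurableSpace Ω]

/-- The joint law `P(dxⁿ) ⊗ P(dyⁿ || xⁿ)` of `(𝐱ⁿ, 𝐲ⁿ)`. -/
def jointLaw (π : CausalPolicy E) (μ : Measure Ω) (x : ℕ → Ω → E) (n : ℕ) :
    Measure ((Fin (n + 1) → E) × (Fin (n + 1) → E)) :=
  sourceLaw μ x n ⊗ₘ π.causalKernel (n + 1)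

/-- The mutual information `I(𝐱ⁿ; 𝐲ⁿ)` in nats: the Kullback–Leibler divergence of the joint law
from the product of its marginals. -/
def mutualInfo (π : CausalPolicy E) (μ : Measure Ω) (x : ℕ → Ω → E) (n : ℕ) : ℝ≥0∞ :=
  InformationTheory.klDiv (π.jointLaw μ x n)
    ((π.jointLaw μ x n).fst.prod (π.jointLaw μ x n).snd)

/-- The rate `I(𝐱ⁿ; 𝐲ⁿ) / (n + 1)`. -/
def rate (π : CausalPolicy E) (μ : Measure Ω) (x : ℕ → Ω → E) (n : ℕ) : ℝ≥0∞ :=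
  π.mutualInfo μ x n / ((n : ℝ≥0∞) + 1)

/-- The per-letter mean-squared error constraint `𝔼 ‖𝐱ₜ - 𝐲ₜ‖² ≤ D` for `t = 0, …, n`. -/
def MeetsDistortion {p : ℕ} (π : CausalPolicy (EuclideanSpace ℝ (Fin p))) (μ : Measure Ω)
    (x : ℕ → Ω → EuclideanSpace ℝ (Fin p)) (n : ℕ) (D : ℝ) : Prop :=
  ∀ t : Fin (n + 1), ∫⁻ z, ‖z.1 t - z.2 t‖ₑ ^ 2 ∂(π.jointLaw μ x n) ≤ ENNReal.ofReal D

end CausalPolicy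

/-- The finite-time sequential rate-distortion function `R_{0,n}(D)`. The rate and the constraint
at horizon `n` depend on the kernels `P(dyₜ | yᵗ⁻¹, xᵗ)` with `t ≤ n` only. -/
def finiteSRD {p : ℕ} {Ω : Type*} [MeasurableSpace Ω] (μ : Measure Ω)
    (x : ℕ → Ω → EuclideanSpace ℝ (Fin p)) (D : ℝ) (n : ℕ) : ℝ≥0∞ :=
  ⨅ (π : CausalPolicy (EuclideanSpace ℝ (Fin p))) (_ : π.MeetsDistortion μ x n D),
    π.rate μ x n

/-- The sequential rate-distortion function with limit and infimum interchanged: the infimum of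
`lim_n I(𝐱ⁿ; 𝐲ⁿ) / (n + 1)` over the infinite-horizon policies that meet the distortion constraint
at all times and for which this limit exists in `[0, ∞]`. -/
def interchangedSRD {p : ℕ} {Ω : Type*} [MeasurableSpace Ω] (μ : Measure Ω)
    (x : ℕ → Ω → EuclideanSpace ℝ (Fin p)) (D : ℝ) : ℝ≥0∞ :=
  ⨅ (π : CausalPolicy (EuclideanSpace ℝ (Fin p))) (_ : ∀ n, π.MeetsDistortion μ x n D)
    (r : ℝ≥0∞) (_ : Tendsto (fun n => π.rate μ x n) atTop (𝓝 r)), r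

/-- The constraints of the log-determinant program in the variables `P`, `Q`. -/
structure SDPFeasible {p : ℕ} (A SigmaW : Matrix (Fin p) (Fin p) ℝ) (D : ℝ)
    (P Q : Matrix (Fin p) (Fin p) ℝ) : Prop where
  posDef_P : P.PosDef
  posDef_Q : Q.PosDef
  le_prediction : (A * P * Aᵀ + SigmaW - P).PosSemidef
  trace_le : P.trace ≤ D
  lmi : (Matrix.fromBlocks (P - Q) (P * Aᵀ) (A * P) (A * P * Aᵀ + SigmaW)).PosSemidef

/-- The set of objective values `-½ log det Q + ½ log det Σw` over the feasible pairs `(P, Q)`. -/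
def sdpValues {p : ℕ} (A SigmaW : Matrix (Fin p) (Fin p) ℝ) (D : ℝ) : Set ℝ :=
  {v | ∃ P Q : Matrix (Fin p) (Fin p) ℝ, SDPFeasible A SigmaW D P Q ∧
    v = -(1 / 2) * Real.log Q.det + 1 / 2 * Real.log SigmaW.det}

end SRD

end

/-!
The value of the program is `R = ½ (log det (A P Aᵀ + Σw) - log det P)` for an optimal `P`, because
the best `Q` for a given `P` is the Schur complement `smoothCov A SigmaW P`, and
`det (smoothCov) · det (A P Aᵀ + Σw) = det P · det Σw`. The program has a maximizer of `det Q`, and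
the maximal determinant changes little when the constraints are relaxed a little, since the relaxed
feasible sets are compact and nested (`exists_maximizer`).

*Converse* (`CausalPolicy.exists_relaxedFeasible_le_mutualInfo`). For a policy that meets the
distortion constraint, let `mₜ` be the linear least-squares estimate of `𝐱ₜ` by `y₀, …, yₜ`, with
error covariance `Mₜ`. By causality the noise is independent of the past outputs, so that
`Mₜ₊₁ ≼ A Mₜ Aᵀ + Σw`, and `tr Mₜ ≤ D` because `yₜ` itself is an admissible estimate. The average `P`
of `M₀, …, Mₙ₋₁` is therefore feasible up to `O(1/n)`. The Donsker–Varadhan inequality, applied to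
the density of a Gaussian model in which `𝐱ₜ` given `𝐱ₜ₊₁` and the output is predicted from `mₜ` with
the smoothing gain of `P` and covariance `Q = smoothCov A SigmaW P`, gives
`I(𝐱ⁿ; 𝐲ⁿ) ≥ n (½ log det Σw - ½ log det Q) + O(1)`. The bound holds for all joint laws, Gaussian or
not, as it sees only second moments; and using one `Q` for all times replaces concavity of
`log det`.

*Achievability* (`exists_policy_rate_le`). The output `yₜ = A yₜ₋₁ + Kₜ (xₜ - A yₜ₋₁) + uₜ` with
independent Gaussian `uₜ` can be designed to have any error covariances `Pₜ ≻ 0` with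
`Pₜ ≺ Nₜ`, where `N₀ = Σ₀` and `Nₜ₊₁ = A Pₜ Aᵀ + Σw`. Comparing the joint law with the product of the
source law and the output law of the same policy without gain (and with the covariance `Nₜ - Pₜ`)
bounds the mutual information by `∑ ½ (log det Nₜ - log det Pₜ)`. With `Pₜ = (1 - (1 - s)ᵗ⁺¹) P` and
a small `s > 0` the covariances are admissible from the start, although `Σ₀` is arbitrary, they
satisfy `tr Pₜ ≤ D`, and the average of the bound tends to `R`.

So the finite-horizon infima are eventually above every number less than `R`, and below the rates of
a single policy, which tend to `R`; hence both orders of limit and infimum give `R`.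
-/

namespace SRD

open scoped MatrixOrder

/-! ### Positive semidefinite matrices -/

variable {ι κ : Type*} [Fintype ι] [DecidableEq ι] [Fintype κ] [DecidableEq κ]

theorem exists_eq_conjTranspose_mul_self {M : Matrix ι ι ℝ} (h : M.PosSemidef) :
    ∃ B : Matrix ι ι ℝ, M = Bᴴ * B :=
  CStarAlgebra.nonneg_iff_eq_star_mul_self.1 h.nonneg

omit [DecidableEq ι] in
theorem posSemidef_real_iff {M : Matrix ι ι ℝ} :
    M.PosSemidef ↔ Mᵀ = M ∧ ∀ v : ι → ℝ, 0 ≤ v ⬝ᵥ M *ᵥ v := by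
  rw [Matrix.posSemidef_iff_dotProduct_mulVec]
  simp [Matrix.IsHermitian, Matrix.conjTranspose_eq_transpose_of_trivial]

omit [DecidableEq ι] in
theorem PosSemidef.transpose_eq {M : Matrix ι ι ℝ} (h : M.PosSemidef) : Mᵀ = M :=
  (posSemidef_real_iff.1 h).1

omit [DecidableEq ι] [DecidableEq κ] in
theorem posSemidef_conj {S : Matrix ι ι ℝ} (hS : S.PosSemidef) (B : Matrix κ ι ℝ) :
    (B * S * Bᵀ).PosSemidef := by
  simpa [Matrix.conjTranspose_eq_transpose_of_trivial] using hS.mul_mul_conjTranspose_same B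

theorem PosSemidef.abs_apply_le_trace {M : Matrix ι ι ℝ} (h : M.PosSemidef) (i j : ι) :
    |M i j| ≤ M.trace := by
  have hd : ∀ i, M i i ≤ M.trace := fun i =>
    Finset.single_le_sum (f := fun i => M i i) (fun k _ => h.diag_nonneg) (Finset.mem_univ i)
  have hq := (posSemidef_real_iff.1 h).2
  have hs : M j i = M i j := congrFun (congrFun (posSemidef_real_iff.1 h).1 i) j
  have h1 := hq (Pi.single i 1 + Pi.single j 1)
  have h2 := hq (Pi.single i 1 - Pi.single j 1)
  simp only [Matrix.mulVec_add, Matrix.mulVec_sub, Matrix.mulVec_single_one, add_dotProduct,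
    sub_dotProduct, dotProduct_add, dotProduct_sub, single_one_dotProduct, Matrix.col_apply] at h1 h2
  rw [abs_le]
  constructor <;> linarith [hd i, hd j]

theorem PosSemidef.le_trace_smul_one {M : Matrix ι ι ℝ} (h : M.PosSemidef) :
    (M.trace • (1 : Matrix ι ι ℝ) - M).PosSemidef := by
  obtain ⟨B, rfl⟩ := exists_eq_conjTranspose_mul_self h
  refine posSemidef_real_iff.2 ⟨?_, fun v => ?_⟩
  · simp [Matrix.transpose_sub, Matrix.transpose_mul,
      Matrix.conjTranspose_eq_transpose_of_trivial]
  · have h1 : v ⬝ᵥ (Bᴴ * B) *ᵥ v = ∑ i, (∑ j, B i j * v j) ^ 2 := by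
      rw [← Matrix.mulVec_mulVec, Matrix.dotProduct_mulVec, Matrix.vecMul_conjTranspose]
      simp [dotProduct, Matrix.mulVec, sq]
    have h2 : (Bᴴ * B).trace = ∑ i, ∑ j, B i j ^ 2 := by
      rw [Matrix.trace_mul_comm]
      simp [Matrix.trace, Matrix.mul_apply, sq]
    rw [Matrix.sub_mulVec, dotProduct_sub, h1, Matrix.smul_mulVec, Matrix.one_mulVec,
      dotProduct_smul, h2, smul_eq_mul, Finset.sum_mul, sub_nonneg]
    refine Finset.sum_le_sum fun i _ => (Finset.sum_mul_sq_le_sq_mul_sq _ _ _).trans ?_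
    simp [dotProduct, sq]

/-- Every positive definite matrix is `L Lᵀ` with `L` invertible. -/
theorem PosDef.exists_sqrt {S : Matrix ι ι ℝ} (hS : S.PosDef) :
    ∃ L : Matrix ι ι ℝ, IsUnit L.det ∧ S = L * Lᵀ := by
  obtain ⟨B, hB⟩ := exists_eq_conjTranspose_mul_self hS.posSemidef
  refine ⟨Bᵀ, ?_, by simpa [Matrix.conjTranspose_eq_transpose_of_trivial] using hB⟩
  have := hS.det_pos
  rw [hB, Matrix.det_mul, Matrix.conjTranspose_eq_transpose_of_trivial] at this
  exact isUnit_iff_ne_zero.2 fun h0 => by simp [h0] at this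

/-- A positive definite matrix is an order unit for the Loewner order. -/
theorem PosDef.exists_smul_sub_posSemidef {S M : Matrix ι ι ℝ} (hS : S.PosDef)
    (hM : M.PosSemidef) : ∃ t : ℝ, 0 ≤ t ∧ (t • S - M).PosSemidef := by
  obtain ⟨L, hL, rfl⟩ := PosDef.exists_sqrt hS
  have hT : (L⁻¹)ᵀ = (Lᵀ)⁻¹ := Matrix.transpose_nonsing_inv L
  have hL' : IsUnit Lᵀ.det := by rwa [Matrix.det_transpose]
  have h1 := posSemidef_conj hM L⁻¹
  refine ⟨_, h1.trace_nonneg, ?_⟩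
  have h2 := posSemidef_conj (PosSemidef.le_trace_smul_one h1) L
  convert h2 using 1
  rw [hT, Matrix.mul_sub, Matrix.sub_mul]
  congr 1
  · simp
  · simp [Matrix.mul_assoc, Matrix.nonsing_inv_mul _ hL', Matrix.mul_nonsing_inv_cancel_left _ _ hL]

/-- A small multiple of any positive semidefinite matrix lies strictly below a given positive
definite one. -/
theorem PosDef.exists_sub_smul_posDef {S M : Matrix ι ι ℝ} (hS : S.PosDef)
    (hM : M.PosSemidef) : ∃ s₀ : ℝ, 0 < s₀ ∧ ∀ s, 0 ≤ s → s ≤ s₀ → (S - s • M).PosDef := by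
  obtain ⟨t, ht, h⟩ := PosDef.exists_smul_sub_posSemidef hS hM
  refine ⟨(t + 1)⁻¹, by positivity, fun s hs hs' => ?_⟩
  have h1 : 0 < 1 - s * t := by
    have : s * (t + 1) ≤ 1 := by
      calc s * (t + 1) ≤ (t + 1)⁻¹ * (t + 1) := by gcongr
        _ = 1 := inv_mul_cancel₀ (by positivity)
    rcases hs.eq_or_lt with rfl | h0
    · simp
    · nlinarith
  have : S - s • M = (1 - s * t) • S + s • (t • S - M) := by
    simp only [smul_sub, sub_smul, one_smul, smul_smul]; abel
  rw [this]
  exact (hS.smul h1).add_posSemidef (h.smul hs)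

theorem trace_mul_nonneg {S M : Matrix ι ι ℝ} (hS : S.PosSemidef) (hM : M.PosSemidef) :
    0 ≤ (S * M).trace := by
  obtain ⟨B, rfl⟩ := exists_eq_conjTranspose_mul_self hS
  rw [Matrix.mul_assoc, Matrix.trace_mul_comm]
  exact (hM.mul_mul_conjTranspose_same B).trace_nonneg

theorem one_le_det_one_add {M : Matrix ι ι ℝ} (hM : M.PosSemidef) : 1 ≤ (1 + M).det := by
  have hH : (1 + M).IsHermitian := (Matrix.PosSemidef.one.add hM).1
  rw [hH.det_eq_prod_eigenvalues]
  have h : ∀ i, 1 ≤ hH.eigenvalues i := fun i => by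
    set v := hH.eigenvectorBasis i
    have hv : (v : ι → ℝ) ⬝ᵥ v = 1 := by
      have := hH.eigenvectorBasis.orthonormal.1 i
      have h2 : ‖v‖ ^ 2 = 1 := by rw [this]; norm_num
      rw [EuclideanSpace.real_norm_sq_eq] at h2
      simpa [dotProduct, sq] using h2
    have h1 : hH.eigenvalues i = (v : ι → ℝ) ⬝ᵥ (1 + M) *ᵥ v := by
      simpa using hH.eigenvalues_eq i
    rw [h1, Matrix.add_mulVec, Matrix.one_mulVec, dotProduct_add, hv]
    linarith [(posSemidef_real_iff.1 hM).2 v]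
  calc (1 : ℝ) = ∏ i : ι, (1 : ℝ) := by simp
    _ ≤ ∏ i, hH.eigenvalues i := Finset.prod_le_prod (by simp) fun i _ => h i
    _ = _ := by simp

theorem det_le_det {Q S : Matrix ι ι ℝ} (hQ : Q.PosSemidef) (h : (S - Q).PosSemidef) :
    Q.det ≤ S.det := by
  have hS : S.PosSemidef := by simpa using hQ.add h
  by_cases h0 : Q.det = 0
  · rw [h0]; exact hS.det_nonneg
  obtain ⟨L, hL, rfl⟩ := PosDef.exists_sqrt (hQ.posDef_iff_det_ne_zero.2 h0)
  have hL' : IsUnit Lᵀ.det := by rwa [Matrix.det_transpose]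
  have h1 := one_le_det_one_add (posSemidef_conj h L⁻¹)
  have h2 : S = L * (1 + L⁻¹ * (S - L * Lᵀ) * L⁻¹ᵀ) * Lᵀ := by
    rw [Matrix.transpose_nonsing_inv]
    simp [Matrix.mul_add, Matrix.add_mul, Matrix.mul_assoc, Matrix.nonsing_inv_mul _ hL',
      Matrix.mul_nonsing_inv_cancel_left _ _ hL]
  calc (L * Lᵀ).det = L.det * Lᵀ.det * 1 := by rw [Matrix.det_mul, mul_one]
    _ ≤ L.det * Lᵀ.det * (1 + L⁻¹ * (S - L * Lᵀ) * L⁻¹ᵀ).det := by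
        refine mul_le_mul_of_nonneg_left h1 ?_
        rw [Matrix.det_transpose]; exact mul_self_nonneg _
    _ = S.det := by conv_rhs => rw [h2]
                    rw [Matrix.det_mul, Matrix.det_mul]; ring

section Schur

variable {P N : Matrix ι ι ℝ}

theorem posSemidef_schur_iff (hN : N.PosDef) (M B : Matrix ι ι ℝ) :
    (Matrix.fromBlocks M B Bᵀ N).PosSemidef ↔ (M - B * N⁻¹ * Bᵀ).PosSemidef := by
  have := hN.isUnit.invertible
  simpa [Matrix.conjTranspose_eq_transpose_of_trivial] using
    Matrix.PosDef.fromBlocks₂₂ M B hN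

/-- The determinant of the block matrix with blocks `P`, `B`, `Bᵀ`, `N`, computed by either Schur
complement. -/
theorem det_schur_mul_det (hP : P.PosDef) (hN : N.PosDef) (B : Matrix ι ι ℝ) :
    (P - B * N⁻¹ * Bᵀ).det * N.det = P.det * (N - Bᵀ * P⁻¹ * B).det := by
  have := hN.isUnit.invertible
  have := hP.isUnit.invertible
  have h1 := Matrix.det_fromBlocks₁₁ P B Bᵀ N
  have h2 := Matrix.det_fromBlocks₂₂ P B Bᵀ N
  rw [Matrix.invOf_eq_nonsing_inv] at h1 h2
  rw [← h1, h2, mul_comm]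

/-- Both Schur complements of a block matrix with positive definite diagonal blocks are positive
definite as soon as one is. -/
theorem posDef_schur (hP : P.PosDef) (hN : N.PosDef) {B : Matrix ι ι ℝ}
    (h : (N - Bᵀ * P⁻¹ * B).PosDef) : (P - B * N⁻¹ * Bᵀ).PosDef := by
  have := hP.isUnit.invertible
  have h1 : (Matrix.fromBlocks P B Bᵀ N).PosSemidef := by
    have := (Matrix.PosDef.fromBlocks₁₁ B N hP)
    rw [Matrix.conjTranspose_eq_transpose_of_trivial] at this
    exact this.2 h.posSemidef
  have h2 := (posSemidef_schur_iff hN _ _).1 h1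
  refine h2.posDef_iff_det_ne_zero.2 fun h0 => ?_
  have h3 := det_schur_mul_det hP hN B
  rw [h0, zero_mul] at h3
  exact (mul_pos hP.det_pos h.det_pos).ne h3

end Schur

end SRD

noncomputable section
namespace SRD

open scoped MatrixOrder

variable {p : ℕ}

/-! ### Prediction and smoothing covariances -/

/-- The covariance `A P Aᵀ + Σw` of the prediction error of `𝐱ₜ₊₁` when `𝐱ₜ` is known up to an
error of covariance `P`. -/
def predCov (A SigmaW P : Matrix (Fin p) (Fin p) ℝ) : Matrix (Fin p) (Fin p) ℝ :=
  A * P * Aᵀ + SigmaW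

/-- The error covariance of `𝐱ₜ` after `𝐱ₜ₊₁` has been revealed, when `𝐱ₜ` was known up to an error
of covariance `P`: the Schur complement of the matrix inequality, and the largest `Q` that is
feasible together with `P`. -/
def smoothCov (A SigmaW P : Matrix (Fin p) (Fin p) ℝ) : Matrix (Fin p) (Fin p) ℝ :=
  P - P * Aᵀ * (predCov A SigmaW P)⁻¹ * (P * Aᵀ)ᵀ

/-- The gain with which `𝐱ₜ₊₁` corrects the estimate of `𝐱ₜ`. -/
def smoothGain (A SigmaW P : Matrix (Fin p) (Fin p) ℝ) : Matrix (Fin p) (Fin p) ℝ :=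
  P * Aᵀ * (predCov A SigmaW P)⁻¹

variable {A SigmaW P Q : Matrix (Fin p) (Fin p) ℝ} {D : ℝ}

theorem posDef_predCov (hW : SigmaW.PosDef) (hP : P.PosSemidef) : (predCov A SigmaW P).PosDef :=
  hW.posSemidef_add (posSemidef_conj hP A)

/-- The matrix inequality of the program says `Q ≼ smoothCov A SigmaW P`. -/
theorem lmi_iff (hW : SigmaW.PosDef) (hP : P.PosSemidef) :
    (Matrix.fromBlocks (P - Q) (P * Aᵀ) (A * P) (A * P * Aᵀ + SigmaW)).PosSemidef ↔
      (smoothCov A SigmaW P - Q).PosSemidef := by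
  have h1 : A * P = (P * Aᵀ)ᵀ := by
    rw [Matrix.transpose_mul, Matrix.transpose_transpose, PosSemidef.transpose_eq hP]
  have h2 : smoothCov A SigmaW P - Q = P - Q - P * Aᵀ * (predCov A SigmaW P)⁻¹ * (P * Aᵀ)ᵀ := by
    rw [smoothCov]; abel
  rw [h2, ← posSemidef_schur_iff (posDef_predCov hW hP), ← h1, predCov]

/-- The Schur complement opposite to `smoothCov` is the noise covariance. -/
theorem predCov_sub_eq (hP : P.PosDef) :
    predCov A SigmaW P - (P * Aᵀ)ᵀ * P⁻¹ * (P * Aᵀ) = SigmaW := by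
  have h : IsUnit P.det := (Matrix.isUnit_iff_isUnit_det _).1 hP.isUnit
  rw [Matrix.transpose_mul, Matrix.transpose_transpose, PosSemidef.transpose_eq hP.posSemidef,
    Matrix.mul_nonsing_inv_cancel_right _ _ h, predCov, Matrix.mul_assoc]
  abel

theorem posDef_smoothCov (hW : SigmaW.PosDef) (hP : P.PosDef) : (smoothCov A SigmaW P).PosDef := by
  refine posDef_schur hP (posDef_predCov hW hP.posSemidef) ?_
  rwa [predCov_sub_eq hP]

theorem det_smoothCov_mul (hW : SigmaW.PosDef) (hP : P.PosDef) :
    (smoothCov A SigmaW P).det * (predCov A SigmaW P).det = P.det * SigmaW.det := by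
  have := det_schur_mul_det hP (posDef_predCov (A := A) hW hP.posSemidef) (P * Aᵀ)
  rwa [predCov_sub_eq hP] at this

/-- The error covariance of the linear estimate of `𝐱ₜ` with gain `smoothGain`. -/
theorem smoothGain_identity (hW : SigmaW.PosDef) (hP : P.PosSemidef) :
    (1 - smoothGain A SigmaW P * A) * P * (1 - smoothGain A SigmaW P * A)ᵀ +
      smoothGain A SigmaW P * SigmaW * (smoothGain A SigmaW P)ᵀ = smoothCov A SigmaW P := by
  have hN := posDef_predCov (A := A) hW hP
  have h : IsUnit (predCov A SigmaW P).det := (Matrix.isUnit_iff_isUnit_det _).1 hN.isUnit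
  have hG : smoothGain A SigmaW P * predCov A SigmaW P = P * Aᵀ := by
    rw [smoothGain, Matrix.nonsing_inv_mul_cancel_right _ _ h]
  have hPt := PosSemidef.transpose_eq hP
  have hS : smoothCov A SigmaW P = P - smoothGain A SigmaW P * (A * P) := by
    rw [smoothCov, smoothGain, Matrix.transpose_mul, Matrix.transpose_transpose, hPt]
  rw [hS]
  set G := smoothGain A SigmaW P
  have h2 : G * (predCov A SigmaW P) * Gᵀ = P * Aᵀ * Gᵀ := by rw [hG]
  rw [predCov] at h2
  rw [Matrix.transpose_sub, Matrix.transpose_mul, Matrix.transpose_one]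
  simp only [Matrix.mul_add, Matrix.add_mul, Matrix.sub_mul, Matrix.mul_sub, Matrix.one_mul,
    Matrix.mul_one, Matrix.mul_assoc] at h2 ⊢
  rw [eq_sub_of_add_eq h2]; abel

/-! ### The log-determinant program -/

/-- The constraints of the program relaxed by `δ`, with `Q` allowed to be singular. -/
def relaxedFeasible (A SigmaW : Matrix (Fin p) (Fin p) ℝ) (D δ : ℝ) :
    Set (Matrix (Fin p) (Fin p) ℝ × Matrix (Fin p) (Fin p) ℝ) :=
  {z | z.2.PosSemidef ∧ (predCov A SigmaW z.1 + δ • (1 : Matrix (Fin p) (Fin p) ℝ) - z.1).PosSemidef ∧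
    z.1.trace ≤ D + δ ∧
    (Matrix.fromBlocks (z.1 - z.2) (z.1 * Aᵀ) (A * z.1) (A * z.1 * Aᵀ + SigmaW)).PosSemidef}

theorem isClosed_setOf_posSemidef {ι : Type*} [Fintype ι] [DecidableEq ι] {X : Type*}
    [TopologicalSpace X] {f : X → Matrix ι ι ℝ} (hf : Continuous f) :
    IsClosed {x | (f x).PosSemidef} := by
  simp only [posSemidef_real_iff, Set.ofPred_and, Set.ofPred_forall]
  refine (isClosed_eq (by fun_prop) hf).inter (isClosed_iInter fun v => ?_)
  exact isClosed_le continuous_const (continuous_const.dotProduct (hf.matrix_mulVec continuous_const))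

theorem relaxedFeasible_mono {δ ε : ℝ} (h : δ ≤ ε) :
    relaxedFeasible A SigmaW D δ ⊆ relaxedFeasible A SigmaW D ε := by
  rintro z ⟨h1, h2, h3, h4⟩
  refine ⟨h1, ?_, by linarith, h4⟩
  have := h2.add (Matrix.PosSemidef.one.smul (sub_nonneg.2 h))
  convert this using 1
  simp only [sub_smul]; abel

theorem posSemidef_sub_of_mem {δ : ℝ} {z : Matrix (Fin p) (Fin p) ℝ × Matrix (Fin p) (Fin p) ℝ}
    (hz : z ∈ relaxedFeasible A SigmaW D δ) : (z.1 - z.2).PosSemidef := by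
  have := hz.2.2.2.submatrix Sum.inl
  exact this

theorem isCompact_relaxedFeasible (δ : ℝ) : IsCompact (relaxedFeasible A SigmaW D δ) := by
  have hcl : IsClosed (relaxedFeasible A SigmaW D δ) := by
    simp only [relaxedFeasible, Set.ofPred_and]
    refine (isClosed_setOf_posSemidef continuous_snd).inter
      ((isClosed_setOf_posSemidef ?_).inter ((isClosed_le ?_ continuous_const).inter
        (isClosed_setOf_posSemidef ?_)))
    · unfold predCov; fun_prop
    · exact continuous_fst.matrix_trace
    · exact Continuous.matrix_fromBlocks (by fun_prop) (by fun_prop) (by fun_prop) (by fun_prop)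
  have hK : IsCompact (Set.univ.pi fun _ : Fin p => Set.univ.pi fun _ : Fin p =>
      Set.Icc (-(D + δ)) (D + δ)) :=
    isCompact_univ_pi fun _ => isCompact_univ_pi fun _ => isCompact_Icc
  refine (hK.prod hK).of_isClosed_subset hcl
    fun (z : Matrix (Fin p) (Fin p) ℝ × Matrix (Fin p) (Fin p) ℝ) hz => ?_
  have h0 := posSemidef_sub_of_mem hz
  have hQ := hz.1
  have hP : z.1.PosSemidef := by simpa using h0.add hQ
  have ht : z.2.trace ≤ z.1.trace := by
    have := h0.trace_nonneg
    rw [Matrix.trace_sub] at this; linarith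
  have hD := hz.2.2.1
  exact ⟨fun i _ j _ => abs_le.1 ((PosSemidef.abs_apply_le_trace hP i j).trans hD),
    fun i _ j _ => abs_le.1 ((PosSemidef.abs_apply_le_trace hQ i j).trans (ht.trans hD))⟩

/-- Small multiples of the identity satisfy the constraints on `P`. -/
theorem exists_sdpFeasible (hW : SigmaW.PosDef) (hD : 0 < D) :
    ∃ P Q, SDPFeasible A SigmaW D P Q := by
  obtain ⟨s, hs, h⟩ := PosDef.exists_sub_smul_posDef hW (Matrix.PosSemidef.one)
  set c : ℝ := min s (D / (p + 1))
  have hc : 0 < c := lt_min hs (by positivity)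
  have hP : (c • (1 : Matrix (Fin p) (Fin p) ℝ)).PosDef := Matrix.PosDef.one.smul hc
  refine ⟨c • 1, smoothCov A SigmaW (c • 1), hP, posDef_smoothCov hW hP, ?_, ?_,
    (lmi_iff hW hP.posSemidef).2 (by simpa using Matrix.PosSemidef.zero)⟩
  · rw [add_sub_assoc]
    exact (posSemidef_conj hP.posSemidef A).add (h c hc.le (min_le_left _ _)).posSemidef
  · rw [Matrix.trace_smul, Matrix.trace_one, Fintype.card_fin, smul_eq_mul]
    calc c * p ≤ D / (p + 1) * (p + 1) := by
          gcongr
          · exact min_le_right _ _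
          · linarith
      _ = D := by field_simp

/-- The program has a maximizer of `det Q`, and the maximal determinant is stable under
relaxation of the constraints. -/
theorem exists_maximizer (hW : SigmaW.PosDef) (hD : 0 < D) :
    ∃ P Q, SDPFeasible A SigmaW D P Q ∧
      (∀ P' Q', SDPFeasible A SigmaW D P' Q' → Q'.det ≤ Q.det) ∧
      ∀ η > 0, ∃ δ > 0, ∀ z ∈ relaxedFeasible A SigmaW D δ, z.2.det < Q.det + η := by
  have hmem : ∀ P Q, SDPFeasible A SigmaW D P Q → (P, Q) ∈ relaxedFeasible A SigmaW D 0 :=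
    fun P Q h => ⟨h.posDef_Q.posSemidef, by simpa [predCov] using h.le_prediction,
      by simpa using h.trace_le, h.lmi⟩
  obtain ⟨P₀, Q₀, h₀⟩ := exists_sdpFeasible (A := A) hW hD
  have hdet : Continuous fun z : Matrix (Fin p) (Fin p) ℝ × Matrix (Fin p) (Fin p) ℝ => z.2.det :=
    continuous_snd.matrix_det
  obtain ⟨z, hz, hmax⟩ := (isCompact_relaxedFeasible (A := A) (SigmaW := SigmaW) (D := D) 0).exists_isMaxOn
    ⟨_, hmem _ _ h₀⟩ hdet.continuousOn
  have hQ : z.2.PosDef := hz.1.posDef_iff_det_ne_zero.2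
    (h₀.posDef_Q.det_pos.trans_le (hmax (hmem _ _ h₀))).ne'
  have hP : z.1.PosDef := by simpa using hQ.posSemidef_add (posSemidef_sub_of_mem hz)
  refine ⟨z.1, z.2, ⟨hP, hQ, by simpa [predCov] using hz.2.1, by simpa using hz.2.2.1, hz.2.2.2⟩,
    fun P' Q' h => hmax (hmem _ _ h), fun η hη => ?_⟩
  by_contra! hcon
  -- Otherwise nested nonempty compact sets would yield a feasible pair of too large a determinant.
  let t : ℕ → Set (Matrix (Fin p) (Fin p) ℝ × Matrix (Fin p) (Fin p) ℝ) := fun k =>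
    relaxedFeasible A SigmaW D (1 / ((k : ℝ) + 1)) ∩ {y | z.2.det + η ≤ y.2.det}
  have hcl : IsClosed {y : Matrix (Fin p) (Fin p) ℝ × Matrix (Fin p) (Fin p) ℝ |
      z.2.det + η ≤ y.2.det} := isClosed_le continuous_const hdet
  have ht : ∀ k, IsCompact (t k) := fun k => (isCompact_relaxedFeasible _).inter_right hcl
  obtain ⟨y, hy⟩ := IsCompact.nonempty_iInter_of_sequence_nonempty_isCompact_isClosed t
    (fun k => Set.inter_subset_inter_left _ (relaxedFeasible_mono
      (one_div_le_one_div_of_le (by positivity) (by push_cast; linarith))))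
    (fun k => hcon _ (by positivity)) (ht 0) (fun k => (ht k).isClosed)
  rw [Set.mem_iInter] at hy
  have hlim : Tendsto (fun k : ℕ => 1 / ((k : ℝ) + 1)) atTop (𝓝 0) :=
    tendsto_one_div_add_atTop_nhds_zero_nat
  have hy0 : y ∈ relaxedFeasible A SigmaW D 0 := by
    refine ⟨(hy 0).1.1, ?_, ?_, (hy 0).1.2.2.2⟩
    · have hc : IsClosed {δ : ℝ | (predCov A SigmaW y.1 + δ • (1 : Matrix (Fin p) (Fin p) ℝ) -
          y.1).PosSemidef} := isClosed_setOf_posSemidef (by fun_prop)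
      exact hc.mem_of_tendsto hlim (Eventually.of_forall fun k => (hy k).1.2.1)
    · exact ge_of_tendsto (tendsto_const_nhds.add hlim)
        (Eventually.of_forall fun k => (hy k).1.2.2.1)
  have h1 : y.2.det ≤ z.2.det := hmax hy0
  have h2 : z.2.det + η ≤ y.2.det := (hy 0).2
  linarith

end SRD
end

noncomputable section
namespace SRD

open InformationTheory

/-! ### Kullback–Leibler divergence -/

section KL

variable {α β : Type*} [MeasurableSpace α] [MeasurableSpace β]

/-- The Donsker–Varadhan lower bound, for test functions with `∫ eᵍ dν ≤ 1`. -/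
theorem ofReal_integral_le_klDiv {μ ν : Measure α} [IsProbabilityMeasure μ]
    [IsProbabilityMeasure ν] {g : α → ℝ} (hgm : Measurable g) (hg : Integrable g μ)
    (h : ∫⁻ z, ENNReal.ofReal (Real.exp (g z)) ∂ν ≤ 1) :
    ENNReal.ofReal (∫ z, g z ∂μ) ≤ klDiv μ ν := by
  by_cases htop : klDiv μ ν = ∞
  · simp [htop]
  obtain ⟨hac, hint⟩ := klDiv_ne_top_iff.1 htop
  have hexp : Integrable (fun z => Real.exp (g z)) ν := by
    refine ⟨by fun_prop, ?_⟩
    rw [hasFiniteIntegral_iff_ofReal (Eventually.of_forall fun z => (Real.exp_pos _).le)]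
    exact h.trans_lt ENNReal.one_lt_top
  have hle : ∫ z, Real.exp (g z) ∂ν ≤ 1 := by
    rw [integral_eq_lintegral_of_nonneg_ae (Eventually.of_forall fun z => (Real.exp_pos _).le)
      (by fun_prop)]
    exact ENNReal.toReal_le_of_le_ofReal zero_le_one (by simpa using h)
  have hlog : Real.log (∫ z, Real.exp (g z) ∂ν) ≤ 0 :=
    Real.log_nonpos (integral_exp_pos hexp).le hle
  have : IsProbabilityMeasure (ν.tilted g) := isProbabilityMeasure_tilted hexp
  have h1 := integral_llr_add_sub_measure_univ_nonneg
    (hac.trans (absolutelyContinuous_tilted hexp)) (integrable_llr_tilted_right hac hg hint hexp)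
  rw [integral_llr_tilted_right hac hg hexp hint] at h1
  simp only [probReal_univ, add_sub_cancel_right] at h1
  rw [klDiv_of_ac_of_integrable hac hint]
  refine ENNReal.ofReal_le_ofReal ?_
  simp only [probReal_univ, add_sub_cancel_right]
  linarith

theorem klDiv_withDensity_exp {ν : Measure α} [IsProbabilityMeasure ν] {g : α → ℝ}
    (hgm : Measurable g)
    (hJ : IsProbabilityMeasure (ν.withDensity fun z => ENNReal.ofReal (Real.exp (g z))))
    (hg : Integrable g (ν.withDensity fun z => ENNReal.ofReal (Real.exp (g z)))) :
    klDiv (ν.withDensity fun z => ENNReal.ofReal (Real.exp (g z))) ν =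
      ENNReal.ofReal (∫ z, g z ∂(ν.withDensity fun z => ENNReal.ofReal (Real.exp (g z)))) := by
  have hac := withDensity_absolutelyContinuous ν (fun z => ENNReal.ofReal (Real.exp (g z)))
  have hllr : llr (ν.withDensity fun z => ENNReal.ofReal (Real.exp (g z))) ν
      =ᵐ[ν.withDensity fun z => ENNReal.ofReal (Real.exp (g z))] g := by
    filter_upwards [hac.ae_le (Measure.rnDeriv_withDensity ν
      (f := fun z => ENNReal.ofReal (Real.exp (g z))) (by fun_prop))] with z hz
    rw [llr, hz, ENNReal.toReal_ofReal (Real.exp_pos _).le, Real.log_exp]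
  rw [klDiv_of_ac_of_integrable hac ((integrable_congr hllr).2 hg), integral_congr_ae hllr]
  simp

/-- Among product measures with the first marginal of `J`, the product of the marginals of `J` is
closest to `J`. -/
theorem klDiv_prod_marginals_le [StandardBorelSpace α] [Nonempty α] (J : Measure (α × β))
    [IsProbabilityMeasure J] (R : Measure β) [IsProbabilityMeasure R] :
    klDiv J (J.fst.prod J.snd) ≤ klDiv J (J.fst.prod R) := by
  set J' : Measure (β × α) := J.map Prod.swap with hJ'
  have : IsProbabilityMeasure J' := Measure.isProbabilityMeasure_map (by fun_prop)
  have hback : J = J'.map Prod.swap := by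
    rw [hJ', Measure.map_map measurable_swap measurable_swap]; simp
  have hfst : J'.fst = J.snd := by rw [hJ', Measure.fst_map_swap]
  have h0 : klDiv J (J.fst.prod J.snd) ≤ klDiv J' (J.snd.prod J.fst) := by
    have := klDiv_map_le J' (J.snd.prod J.fst) measurable_swap
    rwa [← hback, Measure.prod_swap] at this
  have h1 : klDiv J' (R.prod J.fst) ≤ klDiv J (J.fst.prod R) := by
    have := klDiv_map_le J (J.fst.prod R) measurable_swap
    rwa [Measure.prod_swap] at this
  refine h0.trans (le_trans ?_ h1)
  have h2 := klDiv_compProd_eq_add J'.fst R J'.condKernel (Kernel.const β J.fst)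
  rw [J'.disintegrate, Measure.compProd_const, Measure.compProd_const, hfst] at h2
  rw [h2]
  exact le_add_self

end KL

/-! ### Gaussian densities -/

variable {p : ℕ}

/-- The logarithm of the Lebesgue density of the centered Gaussian law with covariance `S`. -/
def logGauss (S : Matrix (Fin p) (Fin p) ℝ) (v : EuclideanSpace ℝ (Fin p)) : ℝ :=
  -(1 / 2) * (v.ofLp ⬝ᵥ S⁻¹ *ᵥ v.ofLp) - 1 / 2 * Real.log S.det - p / 2 * Real.log (2 * Real.pi)

@[fun_prop]
theorem continuous_logGauss (S : Matrix (Fin p) (Fin p) ℝ) : Continuous (logGauss S) := by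
  unfold logGauss
  have h : Continuous fun v : EuclideanSpace ℝ (Fin p) => v.ofLp := by fun_prop
  have : Continuous fun v : EuclideanSpace ℝ (Fin p) => v.ofLp ⬝ᵥ S⁻¹ *ᵥ v.ofLp :=
    h.dotProduct (continuous_const.matrix_mulVec h)
  fun_prop

@[fun_prop]
theorem measurable_logGauss (S : Matrix (Fin p) (Fin p) ℝ) : Measurable (logGauss S) :=
  (continuous_logGauss S).measurable

theorem logGauss_one (v : EuclideanSpace ℝ (Fin p)) :
    logGauss 1 v = -(1 / 2) * ‖v‖ ^ 2 - p / 2 * Real.log (2 * Real.pi) := by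
  rw [EuclideanSpace.real_norm_sq_eq]
  simp [logGauss, dotProduct, sq]

theorem exp_logGauss_one (v : EuclideanSpace ℝ (Fin p)) :
    Real.exp (logGauss 1 v) = (2 * Real.pi) ^ (-(p / 2 : ℝ)) * Real.exp (-(1 / 2) * ‖v‖ ^ 2) := by
  rw [logGauss_one, Real.exp_sub, Real.rpow_neg (by positivity),
    Real.rpow_def_of_pos (by positivity)]
  field_simp

theorem integrable_exp_neg_half_norm_sq :
    Integrable fun v : EuclideanSpace ℝ (Fin p) => Real.exp (-(1 / 2) * ‖v‖ ^ 2) := by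
  by_contra h
  have h1 := GaussianFourier.integral_rexp_neg_mul_sq_norm (V := EuclideanSpace ℝ (Fin p))
    (b := 1 / 2) (by norm_num)
  rw [integral_undef h] at h1
  exact absurd h1.symm (by positivity)

theorem stdGaussian_eq_withDensity :
    stdGaussian (EuclideanSpace ℝ (Fin p)) =
      volume.withDensity fun v => ENNReal.ofReal (Real.exp (logGauss 1 v)) := by
  have hint : Integrable fun v : EuclideanSpace ℝ (Fin p) => Real.exp (logGauss 1 v) := by
    simp_rw [exp_logGauss_one]
    exact integrable_exp_neg_half_norm_sq.const_mul _
  have : IsFiniteMeasure ((volume : Measure (EuclideanSpace ℝ (Fin p))).withDensity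
      fun v => ENNReal.ofReal (Real.exp (logGauss 1 v))) :=
    isFiniteMeasure_withDensity_ofReal hint.2
  refine Measure.ext_of_charFun (funext fun t => ?_)
  rw [charFun_stdGaussian, charFun_apply, integral_withDensity_eq_integral_toReal_smul
    (by fun_prop) (Eventually.of_forall fun _ => ENNReal.ofReal_lt_top)]
  have h1 : ∀ v : EuclideanSpace ℝ (Fin p),
      (ENNReal.ofReal (Real.exp (logGauss 1 v))).toReal • Complex.exp (inner ℝ v t * Complex.I) =
      ((2 * Real.pi) ^ (-(p / 2 : ℝ)) : ℝ) *
        Complex.exp (-(1 / 2 : ℂ) * ‖v‖ ^ 2 + Complex.I * inner ℝ t v) := by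
    intro v
    rw [ENNReal.toReal_ofReal (Real.exp_pos _).le, exp_logGauss_one, Complex.exp_add,
      Complex.real_smul, real_inner_comm]
    push_cast
    ring_nf
  simp_rw [h1]
  rw [integral_const_mul, GaussianFourier.integral_cexp_neg_mul_sq_norm_add (by norm_num)]
  have h2 : ((Real.pi : ℂ) / (1 / 2)) ^ ((Module.finrank ℝ (EuclideanSpace ℝ (Fin p)) : ℂ) / 2) =
      (((2 * Real.pi) ^ (p / 2 : ℝ) : ℝ) : ℂ) := by
    rw [Complex.ofReal_cpow (by positivity)]
    simp only [finrank_euclideanSpace, Fintype.card_fin]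
    push_cast
    congr 1
    ring
  rw [h2, ← mul_assoc, ← Complex.ofReal_mul, ← Real.rpow_add (by positivity)]
  simp only [neg_add_cancel, Real.rpow_zero, Complex.ofReal_one, one_mul, Complex.I_sq]
  congr 1
  ring

open scoped MatrixOrder in
theorem multivariateGaussian_eq_withDensity {S : Matrix (Fin p) (Fin p) ℝ} (hS : S.PosDef) :
    multivariateGaussian 0 S =
      volume.withDensity fun v => ENNReal.ofReal (Real.exp (logGauss S v)) := by
  set C := CFC.sqrt S with hC
  have hCC : C * C = S := CFC.sqrt_mul_sqrt_self S hS.posSemidef.nonneg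
  have hCt : Cᵀ = C := PosSemidef.transpose_eq
    (Matrix.nonneg_iff_posSemidef.1 (CFC.sqrt_nonneg S))
  have hdet : C.det ^ 2 = S.det := by rw [← hCC, Matrix.det_mul, sq]
  have hdet0 : C.det ≠ 0 := fun h => hS.det_pos.ne' (by rw [← hdet, h]; simp)
  have hCu : IsUnit C.det := isUnit_iff_ne_zero.2 hdet0
  set f := Matrix.toEuclideanCLM (𝕜 := ℝ) C
  have hfdet : LinearMap.det (f : EuclideanSpace ℝ (Fin p) →ₗ[ℝ] EuclideanSpace ℝ (Fin p)) =
      C.det := by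
    rw [Matrix.coe_toEuclideanCLM_eq_toEuclideanLin]
    exact LinearMap.det_toLpLin _ _
  have hmap := Measure.map_linearMap_addHaar_eq_smul_addHaar
    (volume : Measure (EuclideanSpace ℝ (Fin p)))
    (f := (f : EuclideanSpace ℝ (Fin p) →ₗ[ℝ] EuclideanSpace ℝ (Fin p))) (by rwa [hfdet])
  rw [hfdet] at hmap
  have hγ : ∀ v, ENNReal.ofReal (Real.exp (logGauss 1 v)) =
      ENNReal.ofReal |C.det| * ENNReal.ofReal (Real.exp (logGauss S (f v))) := by
    intro v
    rw [← ENNReal.ofReal_mul (abs_nonneg _)]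
    congr 1
    have h1 : (f v).ofLp ⬝ᵥ S⁻¹ *ᵥ (f v).ofLp = v.ofLp ⬝ᵥ v.ofLp := by
      rw [Matrix.ofLp_toEuclideanCLM, ← hCC, Matrix.mul_inv_rev, Matrix.mulVec_mulVec,
        Matrix.mul_assoc, Matrix.nonsing_inv_mul _ hCu, Matrix.mul_one, Matrix.dotProduct_mulVec,
        Matrix.vecMul_mulVec, ← Matrix.dotProduct_mulVec]
      rw [hCt, Matrix.mul_nonsing_inv _ hCu, Matrix.one_mulVec]
    have h2 : |C.det| = Real.exp (1 / 2 * Real.log S.det) := by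
      rw [← hdet, Real.log_pow, ← Real.log_abs]
      rw [show (1 / 2 * ((2 : ℕ) * Real.log |C.det|)) = Real.log |C.det| by push_cast; ring,
        Real.exp_log (abs_pos.2 hdet0)]
    rw [h2, ← Real.exp_add]
    congr 1
    simp only [logGauss, h1]
    simp
    ring
  refine Measure.ext_of_lintegral _ fun g hg => ?_
  have hfm : Measurable f := f.continuous.measurable
  rw [multivariateGaussian, lintegral_map hg (by fun_prop), stdGaussian_eq_withDensity,
    lintegral_withDensity_eq_lintegral_mul _ (by fun_prop) (by fun_prop),
    lintegral_withDensity_eq_lintegral_mul _ (by fun_prop) hg]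
  simp only [Pi.mul_apply, zero_add, hγ]
  have h3 := lintegral_map (μ := (volume : Measure (EuclideanSpace ℝ (Fin p))))
    (f := fun v => ENNReal.ofReal (Real.exp (logGauss S v)) * g v) (g := f) (by fun_prop) hfm
  have h4 : Measure.map f (volume : Measure (EuclideanSpace ℝ (Fin p))) =
      ENNReal.ofReal |C.det⁻¹| • volume := hmap
  rw [h4, lintegral_smul_measure] at h3
  simp only [mul_assoc]
  rw [lintegral_const_mul _ (by fun_prop), ← h3, smul_eq_mul, ← mul_assoc,
    ← ENNReal.ofReal_mul (abs_nonneg _), ← abs_mul, mul_inv_cancel₀ hdet0]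
  simp

theorem lintegral_exp_logGauss {S : Matrix (Fin p) (Fin p) ℝ} (hS : S.PosDef) :
    ∫⁻ v, ENNReal.ofReal (Real.exp (logGauss S v)) = 1 := by
  have h : multivariateGaussian 0 S Set.univ = 1 := measure_univ
  rwa [multivariateGaussian_eq_withDensity hS, withDensity_apply _ .univ, setLIntegral_univ] at h

theorem memLp_eval_multivariateGaussian (S : Matrix (Fin p) (Fin p) ℝ) (i : Fin p) :
    MemLp (fun v : EuclideanSpace ℝ (Fin p) => v i) 2 (multivariateGaussian 0 S) :=
  (EuclideanSpace.proj (𝕜 := ℝ) i).comp_memLp' IsGaussian.memLp_two_id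

theorem integral_eval_multivariateGaussian (S : Matrix (Fin p) (Fin p) ℝ) (i : Fin p) :
    ∫ v, v i ∂(multivariateGaussian (0 : EuclideanSpace ℝ (Fin p)) S) = 0 := by
  have h := (EuclideanSpace.proj (𝕜 := ℝ) i).integral_comp_comm
    (IsGaussian.integrable_id (μ := multivariateGaussian (0 : EuclideanSpace ℝ (Fin p)) S))
  simp only [id_eq, integral_id_multivariateGaussian, map_zero] at h
  exact h

theorem integral_mul_multivariateGaussian {S : Matrix (Fin p) (Fin p) ℝ} (hS : S.PosSemidef)
    (i j : Fin p) :
    ∫ v, v i * v j ∂(multivariateGaussian (0 : EuclideanSpace ℝ (Fin p)) S) = S i j := by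
  rw [← covariance_eval_multivariateGaussian (μ := 0) hS i j, covariance_eq_sub
    (memLp_eval_multivariateGaussian S i) (memLp_eval_multivariateGaussian S j),
    integral_eval_multivariateGaussian]
  simp

end SRD
end

noncomputable section
namespace SRD

/-! ### Second moments of random vectors -/

variable {p : ℕ} {Ω : Type*} [MeasurableSpace Ω]

/-- The matrix `𝔼 e fᵀ` of mixed second moments of two random vectors. -/
def crossMoment (μ : Measure Ω) (e f : Ω → EuclideanSpace ℝ (Fin p)) :
    Matrix (Fin p) (Fin p) ℝ :=
  Matrix.of fun i j => ∫ ω, e ω i * f ω j ∂μ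

variable {μ : Measure Ω} {e f g : Ω → EuclideanSpace ℝ (Fin p)}

theorem memLp_coord (he : MemLp e 2 μ) (i : Fin p) : MemLp (fun ω => e ω i) 2 μ :=
  (EuclideanSpace.proj (𝕜 := ℝ) i).comp_memLp' he

theorem memLp_of_coord (he : ∀ i, MemLp (fun ω => e ω i) 2 μ) : MemLp e 2 μ := by
  have h : e = fun ω => ∑ i, e ω i • EuclideanSpace.basisFun (Fin p) ℝ i := by
    funext ω
    have := (EuclideanSpace.basisFun (Fin p) ℝ).sum_repr (e ω)
    simpa using this.symm
  rw [h]
  refine memLp_finsetSum _ fun i _ => ?_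
  exact ((ContinuousLinearMap.id ℝ ℝ).smulRight
    (EuclideanSpace.basisFun (Fin p) ℝ i)).comp_memLp' (he i)

theorem memLp_linear (A : Matrix (Fin p) (Fin p) ℝ) (he : MemLp e 2 μ) :
    MemLp (fun ω => Matrix.toEuclideanCLM (𝕜 := ℝ) A (e ω)) 2 μ :=
  (Matrix.toEuclideanCLM (𝕜 := ℝ) A).comp_memLp' he

theorem integrable_coord_mul (he : MemLp e 2 μ) (hf : MemLp f 2 μ) (i j : Fin p) :
    Integrable (fun ω => e ω i * f ω j) μ :=
  (memLp_coord he i).integrable_mul (memLp_coord hf j)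

theorem transpose_crossMoment : (crossMoment μ e f)ᵀ = crossMoment μ f e := by
  ext i j; simp [crossMoment, mul_comm]

theorem crossMoment_add_left (he : MemLp e 2 μ) (hf : MemLp f 2 μ) (hg : MemLp g 2 μ) :
    crossMoment μ (fun ω => e ω + f ω) g = crossMoment μ e g + crossMoment μ f g := by
  ext i j
  simp only [crossMoment, Matrix.of_apply, Matrix.add_apply, PiLp.add_apply, add_mul]
  exact integral_add (integrable_coord_mul he hg i j) (integrable_coord_mul hf hg i j)

theorem crossMoment_sub_left (he : MemLp e 2 μ) (hf : MemLp f 2 μ) (hg : MemLp g 2 μ) :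
    crossMoment μ (fun ω => e ω - f ω) g = crossMoment μ e g - crossMoment μ f g := by
  ext i j
  simp only [crossMoment, Matrix.of_apply, Matrix.sub_apply, PiLp.sub_apply, sub_mul]
  exact integral_sub (integrable_coord_mul he hg i j) (integrable_coord_mul hf hg i j)

theorem crossMoment_linear_left (A : Matrix (Fin p) (Fin p) ℝ) (he : MemLp e 2 μ)
    (hf : MemLp f 2 μ) :
    crossMoment μ (fun ω => Matrix.toEuclideanCLM (𝕜 := ℝ) A (e ω)) f = A * crossMoment μ e f := by
  ext i j
  simp only [crossMoment, Matrix.of_apply, Matrix.mul_apply, Matrix.ofLp_toEuclideanCLM,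
    Matrix.mulVec, dotProduct, Finset.sum_mul, mul_assoc]
  rw [integral_finsetSum _ fun k _ => (integrable_coord_mul he hf k j).const_mul _]
  simp_rw [integral_const_mul]

theorem crossMoment_add_right (he : MemLp e 2 μ) (hf : MemLp f 2 μ) (hg : MemLp g 2 μ) :
    crossMoment μ g (fun ω => e ω + f ω) = crossMoment μ g e + crossMoment μ g f := by
  rw [← transpose_crossMoment, crossMoment_add_left he hf hg, Matrix.transpose_add,
    transpose_crossMoment, transpose_crossMoment]

theorem crossMoment_sub_right (he : MemLp e 2 μ) (hf : MemLp f 2 μ) (hg : MemLp g 2 μ) :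
    crossMoment μ g (fun ω => e ω - f ω) = crossMoment μ g e - crossMoment μ g f := by
  rw [← transpose_crossMoment, crossMoment_sub_left he hf hg, Matrix.transpose_sub,
    transpose_crossMoment, transpose_crossMoment]

theorem crossMoment_linear_right (A : Matrix (Fin p) (Fin p) ℝ) (he : MemLp e 2 μ)
    (hf : MemLp f 2 μ) :
    crossMoment μ f (fun ω => Matrix.toEuclideanCLM (𝕜 := ℝ) A (e ω)) = crossMoment μ f e * Aᵀ := by
  rw [← transpose_crossMoment, crossMoment_linear_left A he hf, Matrix.transpose_mul,
    transpose_crossMoment]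

/-- Second moments of `A e + B f` for uncorrelated `e` and `f`. -/
theorem crossMoment_linear_add_linear (A B : Matrix (Fin p) (Fin p) ℝ) (he : MemLp e 2 μ)
    (hf : MemLp f 2 μ) (h : crossMoment μ e f = 0) :
    crossMoment μ
      (fun ω => Matrix.toEuclideanCLM (𝕜 := ℝ) A (e ω) + Matrix.toEuclideanCLM (𝕜 := ℝ) B (f ω))
      (fun ω => Matrix.toEuclideanCLM (𝕜 := ℝ) A (e ω) + Matrix.toEuclideanCLM (𝕜 := ℝ) B (f ω)) =
      A * crossMoment μ e e * Aᵀ + B * crossMoment μ f f * Bᵀ := by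
  have hA := memLp_linear A he
  have hB := memLp_linear B hf
  have hAB : MemLp (fun ω => Matrix.toEuclideanCLM (𝕜 := ℝ) A (e ω) +
      Matrix.toEuclideanCLM (𝕜 := ℝ) B (f ω)) 2 μ := hA.add hB
  have h' : crossMoment μ f e = 0 := by rw [← transpose_crossMoment, h, Matrix.transpose_zero]
  rw [crossMoment_add_left hA hB hAB, crossMoment_add_right hA hB hA,
    crossMoment_add_right hA hB hB, crossMoment_linear_left _ he hA,
    crossMoment_linear_left _ he hB, crossMoment_linear_left _ hf hA,
    crossMoment_linear_left _ hf hB, crossMoment_linear_right _ he he,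
    crossMoment_linear_right _ he hf, crossMoment_linear_right _ hf he,
    crossMoment_linear_right _ hf hf, h, h']
  simp [Matrix.mul_assoc]

theorem integral_quadratic (S : Matrix (Fin p) (Fin p) ℝ) (he : MemLp e 2 μ) :
    ∫ ω, (e ω).ofLp ⬝ᵥ S *ᵥ (e ω).ofLp ∂μ = (S * crossMoment μ e e).trace := by
  simp only [dotProduct, Matrix.mulVec, Matrix.trace, Matrix.diag, Matrix.mul_apply,
    Finset.mul_sum, crossMoment, Matrix.of_apply]
  have hi : ∀ i j, Integrable (fun ω => e ω i * (S i j * e ω j)) μ := fun i j => by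
    simpa only [mul_left_comm] using (integrable_coord_mul he he i j).const_mul (S i j)
  rw [integral_finsetSum _ fun i _ => integrable_finsetSum _ fun j _ => hi i j]
  refine Finset.sum_congr rfl fun i _ => ?_
  rw [integral_finsetSum _ fun j _ => hi i j]
  refine Finset.sum_congr rfl fun j _ => ?_
  rw [← integral_const_mul]
  congr 1; ext ω; ring

theorem integrable_quadratic (S : Matrix (Fin p) (Fin p) ℝ) (he : MemLp e 2 μ) :
    Integrable (fun ω => (e ω).ofLp ⬝ᵥ S *ᵥ (e ω).ofLp) μ := by
  simp only [dotProduct, Matrix.mulVec, Finset.mul_sum]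
  refine integrable_finsetSum _ fun i _ => integrable_finsetSum _ fun j _ => ?_
  simpa only [mul_left_comm] using (integrable_coord_mul he he i j).const_mul (S i j)

theorem trace_crossMoment (he : MemLp e 2 μ) :
    (crossMoment μ e e).trace = ∫ ω, ‖e ω‖ ^ 2 ∂μ := by
  have := integral_quadratic (1 : Matrix (Fin p) (Fin p) ℝ) he
  rw [Matrix.one_mul] at this
  rw [← this]
  congr 1; ext ω
  rw [EuclideanSpace.real_norm_sq_eq, Matrix.one_mulVec]
  simp [dotProduct, sq]

theorem posSemidef_crossMoment (he : MemLp e 2 μ) : (crossMoment μ e e).PosSemidef := by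
  refine posSemidef_real_iff.2 ⟨transpose_crossMoment, fun v => ?_⟩
  have h := integral_quadratic (Matrix.vecMulVec v v) he
  have h1 : (Matrix.vecMulVec v v * crossMoment μ e e).trace =
      v ⬝ᵥ crossMoment μ e e *ᵥ v := by
    rw [Matrix.trace_mul_comm, Matrix.mul_vecMulVec, Matrix.trace_vecMulVec, dotProduct_comm]
  rw [← h1, ← h]
  refine integral_nonneg fun ω => ?_
  simp only [Matrix.vecMulVec_mulVec, Pi.zero_apply]
  simp only [dotProduct_smul, op_smul_eq_smul, smul_eq_mul]
  rw [dotProduct_comm v]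
  exact mul_self_nonneg _

theorem integrable_logGauss [IsFiniteMeasure μ] (S : Matrix (Fin p) (Fin p) ℝ)
    (he : MemLp e 2 μ) : Integrable (fun ω => logGauss S (e ω)) μ :=
  ((((integrable_quadratic S⁻¹ he).const_mul _).sub (integrable_const _)).sub
    (integrable_const _))

theorem integral_logGauss [IsProbabilityMeasure μ] (S : Matrix (Fin p) (Fin p) ℝ)
    (he : MemLp e 2 μ) :
    ∫ ω, logGauss S (e ω) ∂μ = -(1 / 2) * (S⁻¹ * crossMoment μ e e).trace -
      1 / 2 * Real.log S.det - p / 2 * Real.log (2 * Real.pi) := by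
  simp only [logGauss, sub_sub]
  rw [integral_sub ((integrable_quadratic S⁻¹ he).const_mul _) (integrable_const _),
    integral_const_mul, integral_quadratic _ he]
  simp

theorem trace_inv_mul_self {S : Matrix (Fin p) (Fin p) ℝ} (hS : S.PosDef) :
    (S⁻¹ * S).trace = p := by
  rw [Matrix.nonsing_inv_mul _ ((Matrix.isUnit_iff_isUnit_det _).1 hS.isUnit)]
  simp

theorem crossMoment_eq_zero_of_indepFun (h : IndepFun e f μ) (he : MemLp e 2 μ)
    (hf : MemLp f 2 μ) (h0 : ∀ i, ∫ ω, e ω i ∂μ = 0) : crossMoment μ e f = 0 := by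
  ext i j
  have hc : IndepFun (fun ω => e ω i) (fun ω => f ω j) μ :=
    h.comp (φ := fun v : EuclideanSpace ℝ (Fin p) => v i)
      (ψ := fun v : EuclideanSpace ℝ (Fin p) => v j) (by fun_prop) (by fun_prop)
  have := hc.integral_fun_mul_eq_mul_integral (memLp_coord he i).aestronglyMeasurable
    (memLp_coord hf j).aestronglyMeasurable
  simp only [crossMoment, Matrix.of_apply, Matrix.zero_apply]
  rw [this, h0, zero_mul]

/-! ### Linear least-squares estimation -/

section Projection

variable {Y : Type*}

/-- Orthogonal projection of `X` onto the functions of the observation `φ` that lie in `S`. -/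
theorem exists_orthogonal_estimate (S : Submodule ℝ (Y → ℝ)) [FiniteDimensional ℝ S]
    (φ : Ω → Y) (hS : ∀ f ∈ S, MemLp (f ∘ φ) 2 μ) {X : Ω → ℝ} (hX : MemLp X 2 μ) :
    ∃ m ∈ S, ∀ f ∈ S, ∫ ω, (X ω - m (φ ω)) * f (φ ω) ∂μ = 0 := by
  let T : S →ₗ[ℝ] Lp ℝ 2 μ :=
    { toFun := fun f => (hS f f.2).toLp _
      map_add' := fun f g => rfl
      map_smul' := fun c f => rfl }
  let K := LinearMap.range T
  obtain ⟨m, hm⟩ : (K.starProjection (hX.toLp X)) ∈ K := Submodule.starProjection_apply_mem _ _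
  refine ⟨m, m.2, fun f hf => ?_⟩
  have h := K.starProjection_inner_eq_zero (hX.toLp X) (T ⟨f, hf⟩) ⟨_, rfl⟩
  rw [← hm, L2.inner_def] at h
  rw [← h]
  refine integral_congr_ae ?_
  filter_upwards [Lp.coeFn_sub (hX.toLp X) (T m), hX.coeFn_toLp, (hS m m.2).coeFn_toLp,
    (hS f hf).coeFn_toLp] with ω h1 h2 h3 h4
  have h3' : T m ω = (m : Y → ℝ) (φ ω) := h3
  have h4' : T ⟨f, hf⟩ ω = f (φ ω) := h4
  rw [h1, h4', Pi.sub_apply, h2, h3']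
  simp [mul_comm]

/-- The linear least-squares estimate of a random vector by observations from a finite-dimensional
space: its error covariance is minimal in the Loewner order. -/
theorem exists_least_squares (S : Submodule ℝ (Y → ℝ)) [FiniteDimensional ℝ S]
    (φ : Ω → Y) (hS : ∀ f ∈ S, MemLp (f ∘ φ) 2 μ) {X : Ω → EuclideanSpace ℝ (Fin p)}
    (hX : MemLp X 2 μ) :
    ∃ m : Y → EuclideanSpace ℝ (Fin p), (∀ i, (fun y => m y i) ∈ S) ∧
      ∀ z : Y → EuclideanSpace ℝ (Fin p), (∀ i, (fun y => z y i) ∈ S) →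
        (crossMoment μ (fun ω => X ω - z (φ ω)) (fun ω => X ω - z (φ ω)) -
          crossMoment μ (fun ω => X ω - m (φ ω)) (fun ω => X ω - m (φ ω))).PosSemidef := by
  choose m hm horth using fun i => exists_orthogonal_estimate S φ hS (memLp_coord hX i)
  refine ⟨fun y => WithLp.toLp 2 fun i => m i y, hm, fun z hz => ?_⟩
  set M : Y → EuclideanSpace ℝ (Fin p) := fun y => WithLp.toLp 2 fun i => m i y with hM
  have hMz : ∀ i, (fun y => M y i - z y i) ∈ S := fun i => S.sub_mem (hm i) (hz i)
  have hML : MemLp (fun ω => M (φ ω)) 2 μ := memLp_of_coord fun i => hS _ (hm i)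
  have hzL : MemLp (fun ω => z (φ ω)) 2 μ := memLp_of_coord fun i => hS _ (hz i)
  have hE : MemLp (fun ω => X ω - M (φ ω)) 2 μ := hX.sub hML
  have hF : MemLp (fun ω => M (φ ω) - z (φ ω)) 2 μ := hML.sub hzL
  have h0 : crossMoment μ (fun ω => X ω - M (φ ω)) (fun ω => M (φ ω) - z (φ ω)) = 0 := by
    ext i j; exact horth i _ (hMz j)
  have h1 := crossMoment_linear_add_linear 1 1 hE hF h0
  simp only [map_one, one_apply_eq_self, sub_add_sub_cancel,
    Matrix.one_mul, Matrix.transpose_one, Matrix.mul_one] at h1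
  rw [h1, add_sub_cancel_left]
  exact posSemidef_crossMoment hF

end Projection

end SRD
end

noncomputable section
namespace SRD

/-! ### Finite paths -/

section Paths

variable {E : Type*} [Zero E]

/-- The `t`-th entry of a path of length `n`, with the junk value `0` for `n ≤ t`. -/
def coord {n : ℕ} (z : Fin n → E) (t : ℕ) : E := if h : t < n then z ⟨t, h⟩ else 0

theorem coord_of_lt {n t : ℕ} (z : Fin n → E) (h : t < n) : coord z t = z ⟨t, h⟩ := dif_pos h

@[simp]
theorem coord_val {n : ℕ} (z : Fin n → E) (i : Fin n) : coord z i = z i := by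
  rw [coord_of_lt z i.2]

theorem coord_init {n t : ℕ} (z : Fin (n + 1) → E) (h : t < n) :
    coord (Fin.init z : Fin n → E) t = coord z t := by
  rw [coord_of_lt _ h, coord_of_lt _ (h.trans (Nat.lt_succ_self n))]; rfl

theorem coord_snoc_of_lt {n t : ℕ} (z : Fin n → E) (v : E) (h : t < n) :
    coord (Fin.snoc z v : Fin (n + 1) → E) t = coord z t := by
  rw [← coord_init _ h, Fin.init_snoc]

@[simp]
theorem coord_snoc_self {n : ℕ} (z : Fin n → E) (v : E) :
    coord (Fin.snoc z v : Fin (n + 1) → E) n = v := by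
  rw [coord_of_lt _ (Nat.lt_succ_self n)]
  exact Fin.snoc_last (α := fun _ => E) v z

@[fun_prop]
theorem measurable_coord [MeasurableSpace E] {n : ℕ} (t : ℕ) :
    Measurable fun z : Fin n → E => coord z t := by
  by_cases h : t < n
  · simp only [coord_of_lt _ h]; exact measurable_pi_apply _
  · simp only [coord, h, dite_false]; exact measurable_const

end Paths

/-! ### The source -/

section Source

variable {p : ℕ} {A Sigma0 SigmaW : Matrix (Fin p) (Fin p) ℝ} {Ω : Type*} [MeasurableSpace Ω]
  {μ : Measure Ω} {x w : ℕ → Ω → EuclideanSpace ℝ (Fin p)}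

namespace IsGaussMarkovSource

variable (hx : IsGaussMarkovSource A Sigma0 SigmaW μ x w)
include hx

theorem measurable (t : ℕ) : Measurable (x t) := by
  induction t with
  | zero => exact hx.measurable_init
  | succ t ih =>
    have h : x (t + 1) = fun ω => Matrix.toEuclideanCLM (𝕜 := ℝ) A (x t ω) + w t ω :=
      funext (hx.step t)
    rw [h]
    have := hx.measurable_noise t
    fun_prop

theorem measurable_path (n : ℕ) : Measurable fun ω (i : Fin n) => x i ω :=
  measurable_pi_lambda _ fun i => hx.measurable i

theorem noise_eq (t : ℕ) (ω : Ω) :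
    w t ω = x (t + 1) ω - Matrix.toEuclideanCLM (𝕜 := ℝ) A (x t ω) := by
  rw [hx.step]; abel

/-- The noise at time `n` is independent of the initial state and the earlier noise. -/
theorem indepFun_init_noise [IsProbabilityMeasure μ] (n : ℕ) :
    IndepFun (fun ω => (x 0 ω, fun i : Finset.range n => w i ω)) (w n) μ := by
  have hwm := hx.measurable_noise
  have hX : Measurable (x 0) := hx.measurable_init
  have hY : Measurable fun ω (i : Finset.range n) => w i ω := measurable_pi_lambda _ fun i => hwm i
  have hZ := hwm n
  have h1 : IndepFun (x 0) (fun ω => ((fun i : Finset.range n => w i ω), w n ω)) μ :=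
    hx.indep_init.comp (φ := id)
      (ψ := fun v : ℕ → EuclideanSpace ℝ (Fin p) => ((fun i : Finset.range n => v i), v n))
      measurable_id (by fun_prop)
  have h2 : IndepFun (fun ω (i : Finset.range n) => w i ω) (w n) μ := by
    have := hx.white.indepFun_finset (Finset.range n) {n} (by simp) hwm
    exact this.comp (φ := id)
      (ψ := fun v : (({n} : Finset ℕ) → EuclideanSpace ℝ (Fin p)) => v ⟨n, by simp⟩)
      measurable_id (measurable_pi_apply _)
  have h3 : IndepFun (x 0) (fun ω (i : Finset.range n) => w i ω) μ :=
    h1.comp measurable_id measurable_fst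
  rw [indepFun_iff_map_prod_eq_prod_map_map (by fun_prop) (by fun_prop)] at h1 h2 h3 ⊢
  rw [h3]
  have h4 := Measure.prodAssoc_prod (μ := μ.map (x 0))
    (ν := μ.map fun ω (i : Finset.range n) => w i ω) (τ := μ.map (w n))
  rw [← h2, ← h1] at h4
  have h5 := congrArg (Measure.map MeasurableEquiv.prodAssoc.symm) h4
  rw [Measure.map_map (by fun_prop) (by fun_prop), Measure.map_map (by fun_prop) (by fun_prop)] at h5
  simpa [Function.comp_def, MeasurableEquiv.prodAssoc] using h5.symm

/-- The noise at time `n` is independent of the states up to time `n`. -/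
theorem indepFun_path_noise [IsProbabilityMeasure μ] (n : ℕ) :
    IndepFun (fun ω (i : Fin (n + 1)) => x i ω) (w n) μ := by
  have hF : ∀ t ≤ n, ∃ F : EuclideanSpace ℝ (Fin p) ×
      (Finset.range n → EuclideanSpace ℝ (Fin p)) → EuclideanSpace ℝ (Fin p),
      Measurable F ∧ ∀ ω, x t ω = F (x 0 ω, fun i : Finset.range n => w i ω) := by
    intro t
    induction t with
    | zero => exact fun _ => ⟨Prod.fst, measurable_fst, fun ω => rfl⟩
    | succ t ih =>
      intro ht
      obtain ⟨F, hF, hFx⟩ := ih (by omega)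
      refine ⟨fun q => Matrix.toEuclideanCLM (𝕜 := ℝ) A (F q) +
        q.2 ⟨t, Finset.mem_range.2 ht⟩, by fun_prop, fun ω => ?_⟩
      rw [hx.step, hFx]
  choose F hFm hFx using fun i : Fin (n + 1) => hF i (by omega)
  have h := (hx.indepFun_init_noise n).comp (φ := fun q i => F i q) (ψ := id)
    (measurable_pi_lambda _ hFm) measurable_id
  have hpath : (fun q i => F i q) ∘ (fun ω => (x 0 ω, fun i : Finset.range n => w i ω)) =
      fun ω (i : Fin (n + 1)) => x i ω := by
    ext1 ω; ext1 i; exact (hFx i ω).symm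
  rwa [hpath, Function.id_comp] at h

theorem memLp_noise (t : ℕ) : MemLp (w t) 2 μ := by
  have h : MemLp id 2 (μ.map (w t)) := by
    rw [(hx.law_noise t).map_eq]; exact IsGaussian.memLp_two_id
  exact h.comp_of_map (hx.measurable_noise t).aemeasurable

theorem memLp_state (t : ℕ) : MemLp (x t) 2 μ := by
  induction t with
  | zero =>
    have h : MemLp id 2 (μ.map (x 0)) := by
      rw [hx.law_init.map_eq]; exact IsGaussian.memLp_two_id
    exact h.comp_of_map hx.measurable_init.aemeasurable
  | succ t ih =>
    have h : x (t + 1) = fun ω => Matrix.toEuclideanCLM (𝕜 := ℝ) A (x t ω) + w t ω :=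
      funext (hx.step t)
    rw [h]
    exact (memLp_linear A ih).add (hx.memLp_noise t)

end IsGaussMarkovSource

theorem crossMoment_of_hasLaw {e : Ω → EuclideanSpace ℝ (Fin p)}
    {S : Matrix (Fin p) (Fin p) ℝ} (he : HasLaw e (multivariateGaussian 0 S) μ)
    (hS : S.PosSemidef) : crossMoment μ e e = S := by
  ext i j
  rw [← integral_mul_multivariateGaussian hS i j, ← he.map_eq,
    integral_map he.aemeasurable (by fun_prop)]
  rfl

theorem integral_of_hasLaw {e : Ω → EuclideanSpace ℝ (Fin p)}
    {S : Matrix (Fin p) (Fin p) ℝ} (he : HasLaw e (multivariateGaussian 0 S) μ) (i : Fin p) :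
    ∫ ω, e ω i ∂μ = 0 := by
  rw [← integral_eval_multivariateGaussian S i, ← he.map_eq,
    integral_map he.aemeasurable (by fun_prop)]

end Source

/-! ### Causal policies -/

theorem measure_preimage_eq_lintegral {α β : Type*} [MeasurableSpace α] [MeasurableSpace β]
    {μ : Measure α} {g : α → β} (hg : Measurable g) {C : Set β} (hC : MeasurableSet C) :
    μ (g ⁻¹' C) = ∫⁻ z, C.indicator (1 : β → ℝ≥0∞) (g z) ∂μ := by
  rw [← Measure.map_apply hg hC, ← lintegral_indicator_one hC,
    lintegral_map (measurable_one.indicator hC) hg]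

namespace CausalPolicy

section Kernel

variable {E : Type*} [MeasurableSpace E] (π : CausalPolicy E)

theorem lintegral_causalKernel_succ (n : ℕ) (x : Fin (n + 1) → E)
    {f : (Fin (n + 1) → E) → ℝ≥0∞} (hf : Measurable f) :
    ∫⁻ y, f y ∂(π.causalKernel (n + 1) x) =
      ∫⁻ y, ∫⁻ v, f (Fin.snoc y v) ∂(π.kernel n (x, y)) ∂(π.causalKernel n (Fin.init x)) := by
  have := π.isMarkov n
  rw [causalKernel, Kernel.lintegral_map _ (measurable_finSnoc n) _ hf,
    Kernel.lintegral_compProd _ _ _ (f := fun yz => f (Fin.snoc yz.1 yz.2))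
      (hf.comp (measurable_finSnoc n))]
  rfl

theorem lintegral_causalKernel_init (n : ℕ) (x : Fin (n + 1) → E)
    {f : (Fin n → E) → ℝ≥0∞} (hf : Measurable f) :
    ∫⁻ y, f (Fin.init y) ∂(π.causalKernel (n + 1) x) =
      ∫⁻ y, f y ∂(π.causalKernel n (Fin.init x)) := by
  have := π.isMarkov n
  rw [lintegral_causalKernel_succ _ _ _ (f := fun y => f (Fin.init y))
    (hf.comp (measurable_finInit n))]
  simp [Fin.init_snoc]

/-- By causality, the conditional law of `yₛ` depends on `x₀, …, xₛ` only. -/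
theorem exists_lintegral_coord [Zero E] (s : ℕ) {h : E → ℝ≥0∞} (hh : Measurable h) (n : ℕ)
    (hs : s < n) :
    ∃ H : (Fin (s + 1) → E) → ℝ≥0∞, Measurable H ∧ ∀ x : Fin n → E,
      ∫⁻ y, h (coord y s) ∂(π.causalKernel n x) = H fun i => coord x i := by
  induction n, hs using Nat.le_induction with
  | base =>
    refine ⟨fun x => ∫⁻ y, h (coord y s) ∂(π.causalKernel (s + 1) x), ?_, fun x => ?_⟩
    · exact Measurable.lintegral_kernel (by fun_prop)
    · simp
  | succ n hn ih =>
    obtain ⟨H, hH, hx⟩ := ih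
    refine ⟨H, hH, fun x => ?_⟩
    have h1 : ∀ y : Fin (n + 1) → E, coord y s = coord (Fin.init y : Fin n → E) s := fun y =>
      (coord_init y hn).symm
    simp_rw [h1]
    rw [lintegral_causalKernel_init π n x (f := fun y => h (coord y s)) (by fun_prop), hx]
    congr 1
    ext i
    exact coord_init x (by omega)

end Kernel

section JointLaw

variable {p : ℕ} {A Sigma0 SigmaW : Matrix (Fin p) (Fin p) ℝ} {Ω : Type*} [MeasurableSpace Ω]
  {μ : Measure Ω} [IsProbabilityMeasure μ] {x w : ℕ → Ω → EuclideanSpace ℝ (Fin p)}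
  (hx : IsGaussMarkovSource A Sigma0 SigmaW μ x w)
  (π : CausalPolicy (EuclideanSpace ℝ (Fin p))) (n : ℕ)
include hx

theorem isProbabilityMeasure_sourceLaw : IsProbabilityMeasure (sourceLaw μ x n) :=
  Measure.isProbabilityMeasure_map (hx.measurable_path (n + 1)).aemeasurable

theorem isProbabilityMeasure_jointLaw : IsProbabilityMeasure (π.jointLaw μ x n) := by
  have := isProbabilityMeasure_sourceLaw hx n
  unfold jointLaw; infer_instance

theorem fst_jointLaw : (π.jointLaw μ x n).fst = sourceLaw μ x n := by
  have := isProbabilityMeasure_sourceLaw hx n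
  rw [jointLaw, Measure.fst_compProd]

theorem lintegral_jointLaw
    {f : (Fin (n + 1) → EuclideanSpace ℝ (Fin p)) × (Fin (n + 1) → EuclideanSpace ℝ (Fin p)) → ℝ≥0∞}
    (hf : Measurable f) :
    ∫⁻ z, f z ∂(π.jointLaw μ x n) =
      ∫⁻ ω, ∫⁻ y, f (fun i => x i ω, y) ∂(π.causalKernel (n + 1) fun i => x i ω) ∂μ := by
  have := isProbabilityMeasure_sourceLaw hx n
  rw [jointLaw, Measure.lintegral_compProd hf, sourceLaw, lintegral_map
    (Measurable.lintegral_kernel_prod_right' hf) (hx.measurable_path (n + 1))]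

/-- Under the joint law, the states up to time `n` are distributed as under `μ`. -/
theorem map_fst_jointLaw {F : Type*} [MeasurableSpace F]
    {f : (Fin (n + 1) → EuclideanSpace ℝ (Fin p)) → F} (hf : Measurable f) :
    (π.jointLaw μ x n).map (fun z => f z.1) = μ.map (fun ω => f fun i => x i ω) := by
  have h : (π.jointLaw μ x n).map (fun z => f z.1) = ((π.jointLaw μ x n).fst).map f := by
    rw [Measure.fst, Measure.map_map hf measurable_fst]; rfl
  rw [h, fst_jointLaw hx, sourceLaw, Measure.map_map hf (hx.measurable_path (n + 1))]
  rfl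

theorem map_state_jointLaw {t : ℕ} (ht : t ≤ n) :
    (π.jointLaw μ x n).map (fun z => coord z.1 t) = μ.map (x t) := by
  rw [map_fst_jointLaw hx π n (f := fun z => coord z t) (by fun_prop)]
  congr 1; ext1 ω; rw [coord_of_lt _ (Nat.lt_succ_of_le ht)]

theorem map_noise_jointLaw {t : ℕ} (ht : t < n) :
    (π.jointLaw μ x n).map
      (fun z => coord z.1 (t + 1) - Matrix.toEuclideanCLM (𝕜 := ℝ) A (coord z.1 t)) =
      μ.map (w t) := by
  rw [map_fst_jointLaw hx π n
    (f := fun z => coord z (t + 1) - Matrix.toEuclideanCLM (𝕜 := ℝ) A (coord z t)) (by fun_prop)]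
  congr 1; ext1 ω
  rw [coord_of_lt _ (show t < n + 1 by omega), coord_of_lt _ (show t + 1 < n + 1 by omega),
    hx.noise_eq]

theorem hasLaw_noise_jointLaw {t : ℕ} (ht : t < n) :
    HasLaw (fun z => coord z.1 (t + 1) - Matrix.toEuclideanCLM (𝕜 := ℝ) A (coord z.1 t))
      (multivariateGaussian 0 SigmaW) (π.jointLaw μ x n) :=
  ⟨by fun_prop, by rw [map_noise_jointLaw hx π n ht, (hx.law_noise t).map_eq]⟩

theorem memLp_state_jointLaw {t : ℕ} (ht : t ≤ n) :
    MemLp (fun z => coord z.1 t) 2 (π.jointLaw μ x n) := by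
  have h : MemLp id 2 ((π.jointLaw μ x n).map (fun z => coord z.1 t)) := by
    rw [map_state_jointLaw hx π n ht, memLp_map_measure_iff (by fun_prop)
      (hx.measurable t).aemeasurable]
    exact hx.memLp_state t
  exact h.comp_of_map (by fun_prop)

theorem memLp_noise_jointLaw {t : ℕ} (ht : t < n) :
    MemLp (fun z => coord z.1 (t + 1) - Matrix.toEuclideanCLM (𝕜 := ℝ) A (coord z.1 t)) 2
      (π.jointLaw μ x n) :=
  (memLp_state_jointLaw hx π n (t := t + 1) ht).sub
    (memLp_linear A (memLp_state_jointLaw hx π n ht.le))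

theorem indepFun_noise_state {s t : ℕ} (ht : t < n) (hs : s ≤ t) :
    IndepFun (fun z => coord z.1 (t + 1) - Matrix.toEuclideanCLM (𝕜 := ℝ) A (coord z.1 t))
      (fun z => coord z.1 s) (π.jointLaw μ x n) := by
  have := isProbabilityMeasure_jointLaw hx π n
  rw [indepFun_iff_map_prod_eq_prod_map_map (by fun_prop) (by fun_prop),
    map_noise_jointLaw hx π n ht, map_state_jointLaw hx π n (by omega),
    map_fst_jointLaw hx π n (f := fun z => (coord z (t + 1) -
      Matrix.toEuclideanCLM (𝕜 := ℝ) A (coord z t), coord z s)) (by fun_prop)]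
  have h := ((hx.indepFun_path_noise t).comp (φ := fun z => coord z s) (ψ := id)
    (by fun_prop) measurable_id).symm
  have hs' : (fun z => coord z s) ∘ (fun ω (i : Fin (t + 1)) => x i ω) = x s := by
    ext1 ω
    simp only [Function.comp]
    rw [coord_of_lt _ (show s < t + 1 by omega)]
  have h' : IndepFun (w t) (x s) μ := by rwa [hs', Function.id_comp] at h
  rw [indepFun_iff_map_prod_eq_prod_map_map (hx.measurable_noise t).aemeasurable
    (hx.measurable s).aemeasurable] at h'
  rw [← h']
  congr 1; ext1 ω
  rw [coord_of_lt _ (show t < n + 1 by omega), coord_of_lt _ (show t + 1 < n + 1 by omega),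
    coord_of_lt _ (show s < n + 1 by omega), hx.noise_eq]

/-- By causality, the noise is independent of the present and past outputs. -/
theorem indepFun_noise_output {s t : ℕ} (ht : t < n) (hs : s ≤ t) :
    IndepFun (fun z => coord z.1 (t + 1) - Matrix.toEuclideanCLM (𝕜 := ℝ) A (coord z.1 t))
      (fun z => coord z.2 s) (π.jointLaw μ x n) := by
  have := isProbabilityMeasure_jointLaw hx π n
  rw [indepFun_iff_measure_inter_preimage_eq_mul]
  intro B C hB hC
  obtain ⟨H, hH, hHx⟩ := π.exists_lintegral_coord s (h := C.indicator 1)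
    (measurable_one.indicator hC) (n + 1) (by omega)
  have hpath : Measurable fun ω (i : Fin (s + 1)) => x i ω := hx.measurable_path _
  have hw := hx.measurable_noise t
  have hcoord : ∀ ω, (fun i : Fin (s + 1) => coord (fun j : Fin (n + 1) => x j ω) i) =
      fun i : Fin (s + 1) => x i ω := fun ω => by
    ext1 i; rw [coord_of_lt _ (show (i : ℕ) < n + 1 by omega)]
  have hnoise : ∀ ω, coord (fun j : Fin (n + 1) => x j ω) (t + 1) -
      Matrix.toEuclideanCLM (𝕜 := ℝ) A (coord (fun j : Fin (n + 1) => x j ω) t) = w t ω :=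
    fun ω => by
      rw [coord_of_lt _ (show t < n + 1 by omega), coord_of_lt _ (show t + 1 < n + 1 by omega),
        hx.noise_eq]
  have hC' : π.jointLaw μ x n ((fun z => coord z.2 s) ⁻¹' C) =
      ∫⁻ ω, H (fun i => x i ω) ∂μ := by
    rw [measure_preimage_eq_lintegral (by fun_prop) hC, lintegral_jointLaw hx π n
      (f := fun z => C.indicator 1 (coord z.2 s))
      ((measurable_one.indicator hC).comp ((measurable_coord s).comp measurable_snd))]
    simp only [hHx, hcoord]
  have hB' : π.jointLaw μ x n ((fun z => coord z.1 (t + 1) -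
      Matrix.toEuclideanCLM (𝕜 := ℝ) A (coord z.1 t)) ⁻¹' B) =
      ∫⁻ ω, B.indicator 1 (w t ω) ∂μ := by
    rw [← Measure.map_apply (by fun_prop) hB, map_noise_jointLaw hx π n ht, Measure.map_apply hw hB,
      measure_preimage_eq_lintegral hw hB]
  have hBC : π.jointLaw μ x n ((fun z => coord z.1 (t + 1) -
      Matrix.toEuclideanCLM (𝕜 := ℝ) A (coord z.1 t)) ⁻¹' B ∩ (fun z => coord z.2 s) ⁻¹' C) =
      ∫⁻ ω, B.indicator 1 (w t ω) * H (fun i => x i ω) ∂μ := by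
    rw [← Set.mk_preimage_prod, measure_preimage_eq_lintegral (by fun_prop) (hB.prod hC)]
    simp only [Set.indicator_prod_one]
    have hBm : Measurable fun z : (Fin (n + 1) → EuclideanSpace ℝ (Fin p)) ×
        (Fin (n + 1) → EuclideanSpace ℝ (Fin p)) => B.indicator (1 : EuclideanSpace ℝ (Fin p) → ℝ≥0∞)
          (coord z.1 (t + 1) - Matrix.toEuclideanCLM (𝕜 := ℝ) A (coord z.1 t)) :=
      (measurable_one.indicator hB).comp (by fun_prop)
    have hCm : Measurable fun y : Fin (n + 1) → EuclideanSpace ℝ (Fin p) =>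
        C.indicator (1 : EuclideanSpace ℝ (Fin p) → ℝ≥0∞) (coord y s) := (measurable_one.indicator hC).comp (by fun_prop)
    have hBC : Measurable fun z : (Fin (n + 1) → EuclideanSpace ℝ (Fin p)) ×
        (Fin (n + 1) → EuclideanSpace ℝ (Fin p)) => B.indicator (1 : EuclideanSpace ℝ (Fin p) → ℝ≥0∞)
          (coord z.1 (t + 1) - Matrix.toEuclideanCLM (𝕜 := ℝ) A (coord z.1 t)) *
          C.indicator (1 : EuclideanSpace ℝ (Fin p) → ℝ≥0∞) (coord z.2 s) :=
      hBm.mul (hCm.comp measurable_snd)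
    rw [lintegral_jointLaw hx π n hBC]
    refine lintegral_congr fun ω => ?_
    simp only [hnoise]
    rw [lintegral_const_mul _ hCm, hHx, hcoord]
  rw [hBC, hB', hC']
  refine lintegral_mul_eq_lintegral_mul_lintegral_of_indepFun
    (f := fun ω => B.indicator 1 (w t ω)) (g := fun ω => H fun i => x i ω)
    ((measurable_one.indicator hB).comp hw) (hH.comp hpath) ?_
  exact ((hx.indepFun_path_noise t).comp
    (φ := fun z => H fun i : Fin (s + 1) => z ⟨i, by omega⟩)
    (ψ := B.indicator (1 : EuclideanSpace ℝ (Fin p) → ℝ≥0∞))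
    (hH.comp (measurable_pi_lambda _ fun i => measurable_pi_apply _)) (measurable_one.indicator hB)).symm

end JointLaw

end CausalPolicy

end SRD
end

noncomputable section
namespace SRD

variable {p : ℕ} {A Sigma0 SigmaW : Matrix (Fin p) (Fin p) ℝ} {Ω : Type*} [MeasurableSpace Ω]
  {μ : Measure Ω} [IsProbabilityMeasure μ] {x w : ℕ → Ω → EuclideanSpace ℝ (Fin p)}

/-! ### Linear estimation of the state from the output of a policy -/

/-- The linear functions of `y₀, …, yₜ`. -/
def outputSpan (p n t : ℕ) : Submodule ℝ ((Fin n → EuclideanSpace ℝ (Fin p)) → ℝ) :=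
  Submodule.span ℝ (Set.range fun q : Fin (t + 1) × Fin p => fun y => coord y q.1 q.2)

instance (p n t : ℕ) : FiniteDimensional ℝ (outputSpan p n t) :=
  FiniteDimensional.span_of_finite ℝ (Set.finite_range _)

theorem coord_mem_outputSpan {n s t : ℕ} (hs : s ≤ t) (i : Fin p) :
    (fun y : Fin n → EuclideanSpace ℝ (Fin p) => coord y s i) ∈ outputSpan p n t :=
  Submodule.subset_span ⟨(⟨s, by omega⟩, i), rfl⟩

theorem outputSpan_mono {n s t : ℕ} (hs : s ≤ t) : outputSpan p n s ≤ outputSpan p n t := by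
  refine Submodule.span_le.2 ?_
  rintro _ ⟨q, rfl⟩
  exact coord_mem_outputSpan (by omega) _

theorem measurable_of_mem_outputSpan {n t : ℕ}
    {f : (Fin n → EuclideanSpace ℝ (Fin p)) → ℝ} (hf : f ∈ outputSpan p n t) : Measurable f := by
  induction hf using Submodule.span_induction with
  | mem f hf => obtain ⟨q, rfl⟩ := hf; fun_prop
  | zero => exact measurable_const
  | add f g _ _ hf hg => exact hf.add hg
  | smul c f _ hf => exact hf.const_smul c

theorem measurable_of_coord_mem_outputSpan {n t : ℕ}
    {m : (Fin n → EuclideanSpace ℝ (Fin p)) → EuclideanSpace ℝ (Fin p)}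
    (hm : ∀ i, (fun y => m y i) ∈ outputSpan p n t) : Measurable m := by
  have h : m = fun y => WithLp.toLp 2 fun i => m y i := rfl
  rw [h]
  exact (PiLp.continuous_toLp 2 _).measurable.comp
    (measurable_pi_lambda _ fun i => measurable_of_mem_outputSpan (hm i))

theorem linear_mem_outputSpan {n t : ℕ} (B : Matrix (Fin p) (Fin p) ℝ)
    {m : (Fin n → EuclideanSpace ℝ (Fin p)) → EuclideanSpace ℝ (Fin p)}
    (hm : ∀ i, (fun y => m y i) ∈ outputSpan p n t) (i : Fin p) :
    (fun y => Matrix.toEuclideanCLM (𝕜 := ℝ) B (m y) i) ∈ outputSpan p n t := by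
  have h : (fun y => Matrix.toEuclideanCLM (𝕜 := ℝ) B (m y) i) =
      ∑ k, B i k • fun y => m y k := by
    ext y
    simp [Matrix.ofLp_toEuclideanCLM, Matrix.mulVec, dotProduct, Finset.sum_apply]
  rw [h]
  exact Submodule.sum_mem _ fun k _ => Submodule.smul_mem _ _ (hm k)

namespace CausalPolicy

variable (hx : IsGaussMarkovSource A Sigma0 SigmaW μ x w)
  {π : CausalPolicy (EuclideanSpace ℝ (Fin p))} {n : ℕ} {D : ℝ}
include hx

section Distortion

variable (hD : 0 ≤ D) (hπ : π.MeetsDistortion μ x n D)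
include hπ

omit [IsProbabilityMeasure μ] hx in
theorem lintegral_error_le {t : ℕ} (ht : t ≤ n) :
    ∫⁻ z, ‖coord z.1 t - coord z.2 t‖ₑ ^ 2 ∂(π.jointLaw μ x n) ≤ ENNReal.ofReal D := by
  have h := hπ ⟨t, by omega⟩
  simpa only [coord_of_lt _ (show t < n + 1 by omega)] using h

omit [IsProbabilityMeasure μ] hx in
theorem memLp_error {t : ℕ} (ht : t ≤ n) :
    MemLp (fun z => coord z.1 t - coord z.2 t) 2 (π.jointLaw μ x n) := by
  refine ⟨by fun_prop, ?_⟩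
  rw [eLpNorm_lt_top_iff_lintegral_rpow_enorm_lt_top two_ne_zero ENNReal.ofNat_ne_top]
  simpa using (lintegral_error_le hπ ht).trans_lt ENNReal.ofReal_lt_top

theorem memLp_output (s : ℕ) : MemLp (fun z => coord z.2 s) 2 (π.jointLaw μ x n) := by
  have := isProbabilityMeasure_jointLaw hx π n
  by_cases hs : s ≤ n
  · have h := (memLp_state_jointLaw hx π n hs).sub (memLp_error hπ hs)
    have h' : (fun z : (Fin (n + 1) → EuclideanSpace ℝ (Fin p)) ×
        (Fin (n + 1) → EuclideanSpace ℝ (Fin p)) => coord z.2 s) =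
        (fun z => coord z.1 s) - fun z => coord z.1 s - coord z.2 s := by
      ext1 z; simp
    rwa [h']
  · have h : (fun z : (Fin (n + 1) → EuclideanSpace ℝ (Fin p)) ×
        (Fin (n + 1) → EuclideanSpace ℝ (Fin p)) => coord z.2 s) = fun _ => 0 := by
      ext1 z; rw [coord, dif_neg (by omega)]
    rw [h]; exact memLp_const 0

include hD in
omit [IsProbabilityMeasure μ] hx in
theorem trace_error_le {t : ℕ} (ht : t ≤ n) :
    (crossMoment (π.jointLaw μ x n) (fun z => coord z.1 t - coord z.2 t)
      (fun z => coord z.1 t - coord z.2 t)).trace ≤ D := by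
  have h := memLp_error hπ ht
  rw [trace_crossMoment h, integral_eq_lintegral_of_nonneg_ae
    (Eventually.of_forall fun z => by positivity) (by fun_prop)]
  refine ENNReal.toReal_le_of_le_ofReal hD ?_
  refine le_trans (le_of_eq ?_) (lintegral_error_le hπ ht)
  refine lintegral_congr fun z => ?_
  rw [ENNReal.ofReal_pow (norm_nonneg _), ofReal_norm]

theorem memLp_of_mem_outputSpan {t : ℕ} {f : (Fin (n + 1) → EuclideanSpace ℝ (Fin p)) → ℝ}
    (hf : f ∈ outputSpan p (n + 1) t) : MemLp (f ∘ Prod.snd) 2 (π.jointLaw μ x n) := by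
  induction hf using Submodule.span_induction with
  | mem f hf => obtain ⟨q, rfl⟩ := hf; exact memLp_coord (memLp_output hx hπ q.1) q.2
  | zero => exact MemLp.zero
  | add f g _ _ hf hg => exact hf.add hg
  | smul c f _ hf => exact hf.const_smul c

/-- The noise is uncorrelated with linear functions of the present and past outputs. -/
theorem integral_noise_mul_eq_zero {t : ℕ} (ht : t < n) (i : Fin p)
    {f : (Fin (n + 1) → EuclideanSpace ℝ (Fin p)) → ℝ} (hf : f ∈ outputSpan p (n + 1) t) :
    ∫ z, (coord z.1 (t + 1) - Matrix.toEuclideanCLM (𝕜 := ℝ) A (coord z.1 t)) i * f z.2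
      ∂(π.jointLaw μ x n) = 0 := by
  have hw := memLp_noise_jointLaw hx π n ht
  induction hf using Submodule.span_induction with
  | mem f hf =>
    obtain ⟨q, rfl⟩ := hf
    have h := crossMoment_eq_zero_of_indepFun
      (indepFun_noise_output hx π n (s := q.1) ht (by omega)) hw (memLp_output hx hπ q.1)
      (integral_of_hasLaw (hasLaw_noise_jointLaw hx π n ht))
    exact congrFun (congrFun h i) q.2
  | zero => simp
  | add f g hf hg hf0 hg0 =>
    have h1 := (memLp_coord hw i).integrable_mul (memLp_of_mem_outputSpan hx hπ hf)
    have h2 := (memLp_coord hw i).integrable_mul (memLp_of_mem_outputSpan hx hπ hg)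
    have h3 := integral_add h1 h2
    simp only [Pi.mul_apply, Function.comp] at h3
    simp only [Pi.add_apply, mul_add]
    rw [h3, hf0, hg0, add_zero]
  | smul c f _ hf0 =>
    simp only [Pi.smul_apply, smul_eq_mul, mul_left_comm _ c]
    rw [integral_const_mul, hf0, mul_zero]

include hD in
/-- The linear least-squares estimates `mₜ` of `𝐱ₜ` by `y₀, …, yₜ`: their error covariances meet
the distortion constraint and grow no faster than by prediction. -/
theorem exists_estimates (hW : SigmaW.PosSemidef) :
    ∃ m : ℕ → (Fin (n + 1) → EuclideanSpace ℝ (Fin p)) → EuclideanSpace ℝ (Fin p),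
      (∀ t, Measurable (m t)) ∧
      (∀ t ≤ n, MemLp (fun z => coord z.1 t - m t z.2) 2 (π.jointLaw μ x n)) ∧
      (∀ t ≤ n, (crossMoment (π.jointLaw μ x n) (fun z => coord z.1 t - m t z.2)
        (fun z => coord z.1 t - m t z.2)).trace ≤ D) ∧
      (∀ t < n, (predCov A SigmaW (crossMoment (π.jointLaw μ x n)
          (fun z => coord z.1 t - m t z.2) (fun z => coord z.1 t - m t z.2)) -
        crossMoment (π.jointLaw μ x n) (fun z => coord z.1 (t + 1) - m (t + 1) z.2)
          (fun z => coord z.1 (t + 1) - m (t + 1) z.2)).PosSemidef) ∧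
      (∀ t < n, crossMoment (π.jointLaw μ x n) (fun z => coord z.1 t - m t z.2)
        (fun z => coord z.1 (t + 1) - Matrix.toEuclideanCLM (𝕜 := ℝ) A (coord z.1 t)) = 0) := by
  have hX : ∀ t, MemLp (fun z => coord z.1 t) 2 (π.jointLaw μ x n) := fun t => by
    have := isProbabilityMeasure_jointLaw hx π n
    by_cases ht : t ≤ n
    · exact memLp_state_jointLaw hx π n ht
    · have h : (fun z : (Fin (n + 1) → EuclideanSpace ℝ (Fin p)) ×
          (Fin (n + 1) → EuclideanSpace ℝ (Fin p)) => coord z.1 t) = fun _ => 0 := by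
        ext1 z; rw [coord, dif_neg (by omega)]
      rw [h]; exact memLp_const 0
  choose m hm hopt using fun t => exists_least_squares (outputSpan p (n + 1) t) Prod.snd
    (fun f hf => memLp_of_mem_outputSpan hx hπ hf) (hX t)
  have hmL : ∀ t, MemLp (fun z => m t z.2) 2 (π.jointLaw μ x n) := fun t =>
    memLp_of_coord fun i => memLp_of_mem_outputSpan hx hπ (hm t i)
  have he : ∀ t, MemLp (fun z => coord z.1 t - m t z.2) 2 (π.jointLaw μ x n) := fun t =>
    (hX t).sub (hmL t)
  have horth : ∀ t < n, crossMoment (π.jointLaw μ x n) (fun z => coord z.1 t - m t z.2)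
      (fun z => coord z.1 (t + 1) - Matrix.toEuclideanCLM (𝕜 := ℝ) A (coord z.1 t)) = 0 := by
    intro t ht
    have hw := memLp_noise_jointLaw hx π n ht
    rw [← transpose_crossMoment, crossMoment_sub_right (hX t) (hmL t) hw,
      crossMoment_eq_zero_of_indepFun (indepFun_noise_state hx π n ht le_rfl) hw (hX t)
        (integral_of_hasLaw (hasLaw_noise_jointLaw hx π n ht))]
    have h0 : crossMoment (π.jointLaw μ x n)
        (fun z => coord z.1 (t + 1) - Matrix.toEuclideanCLM (𝕜 := ℝ) A (coord z.1 t))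
        (fun z => m t z.2) = 0 := by
      ext i j; exact integral_noise_mul_eq_zero hx hπ ht i (hm t j)
    rw [h0]; simp
  refine ⟨m, fun t => measurable_of_coord_mem_outputSpan (hm t), fun t _ => he t,
    fun t ht => ?_, fun t ht => ?_, horth⟩
  · have h := (hopt t (fun y => coord y t) fun i => coord_mem_outputSpan le_rfl i).trace_nonneg
    rw [Matrix.trace_sub] at h
    linarith [trace_error_le hD hπ ht]
  · -- `A mₜ` is an admissible estimate of the next state, with error covariance `A Mₜ Aᵀ + Σw`.
    have h := hopt (t + 1) (fun y => Matrix.toEuclideanCLM (𝕜 := ℝ) A (m t y))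
      fun i => outputSpan_mono t.le_succ (linear_mem_outputSpan A (hm t) i)
    have h1 := crossMoment_linear_add_linear A 1 (he t) (memLp_noise_jointLaw hx π n ht)
      (horth t ht)
    rw [crossMoment_of_hasLaw (hasLaw_noise_jointLaw hx π n ht) hW] at h1
    have h2 : (fun z : (Fin (n + 1) → EuclideanSpace ℝ (Fin p)) ×
        (Fin (n + 1) → EuclideanSpace ℝ (Fin p)) =>
        Matrix.toEuclideanCLM (𝕜 := ℝ) A (coord z.1 t - m t z.2) +
          Matrix.toEuclideanCLM (𝕜 := ℝ) 1
            (coord z.1 (t + 1) - Matrix.toEuclideanCLM (𝕜 := ℝ) A (coord z.1 t))) =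
        fun z => coord z.1 (t + 1) - Matrix.toEuclideanCLM (𝕜 := ℝ) A (m t z.2) := by
      ext1 z
      rw [map_sub, map_one, one_apply_eq_self]; abel
    rw [h2, Matrix.one_mul, Matrix.transpose_one, Matrix.mul_one] at h1
    rw [h1] at h
    exact h

end Distortion

end CausalPolicy

end SRD
end

noncomputable section
namespace SRD

variable {p : ℕ} {A Sigma0 SigmaW : Matrix (Fin p) (Fin p) ℝ} {Ω : Type*} [MeasurableSpace Ω]
  {μ : Measure Ω} [IsProbabilityMeasure μ] {x w : ℕ → Ω → EuclideanSpace ℝ (Fin p)}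

/-! ### The lower bound on the mutual information -/

theorem lintegral_exp_sub_logGauss_mul {S : Matrix (Fin p) (Fin p) ℝ} (hS : S.PosDef)
    {a : EuclideanSpace ℝ (Fin p) → ℝ} (ha : Measurable a)
    {φ : EuclideanSpace ℝ (Fin p) → ℝ≥0∞} (hφ : Measurable φ) :
    ∫⁻ v, ENNReal.ofReal (Real.exp (a v - logGauss S v)) * φ v ∂(multivariateGaussian 0 S) =
      ∫⁻ v, ENNReal.ofReal (Real.exp (a v)) * φ v := by
  rw [multivariateGaussian_eq_withDensity hS, lintegral_withDensity_eq_lintegral_mul _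
    (by fun_prop) (by fun_prop)]
  refine lintegral_congr fun v => ?_
  rw [Pi.mul_apply, ← mul_assoc, ← ENNReal.ofReal_mul (Real.exp_pos _).le, ← Real.exp_add]
  congr 3
  ring

/-- Reweighting the source by the likelihood ratio of a backward Markov chain with transition
densities `exp (a t · 𝐱ₜ₊₁)` turns the law of `𝐱ₙ` into Lebesgue measure. -/
theorem IsGaussMarkovSource.lintegral_backward_ratio
    (hx : IsGaussMarkovSource A Sigma0 SigmaW μ x w) (h0 : Sigma0.PosDef) (hW : SigmaW.PosDef)
    {a : ℕ → EuclideanSpace ℝ (Fin p) → EuclideanSpace ℝ (Fin p) → ℝ}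
    (ham : ∀ t, Measurable fun q : EuclideanSpace ℝ (Fin p) × EuclideanSpace ℝ (Fin p) =>
      a t q.1 q.2)
    (ha : ∀ t v, ∫⁻ u, ENNReal.ofReal (Real.exp (a t u v)) = 1) (n : ℕ)
    {φ : EuclideanSpace ℝ (Fin p) → ℝ≥0∞} (hφ : Measurable φ) :
    ∫⁻ ω, ENNReal.ofReal (Real.exp (∑ t ∈ Finset.range n,
        (a t (x t ω) (x (t + 1) ω) - logGauss SigmaW (w t ω)) - logGauss Sigma0 (x 0 ω))) *
      φ (x n ω) ∂μ = ∫⁻ v, φ v := by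
  induction n generalizing φ with
  | zero =>
    have h := lintegral_map (μ := μ) (f := fun v =>
      ENNReal.ofReal (Real.exp (0 - logGauss Sigma0 v)) * φ v) (by fun_prop) hx.measurable_init
    simp only [Finset.range_zero, Finset.sum_empty]
    rw [← h, hx.law_init.map_eq, lintegral_exp_sub_logGauss_mul h0 measurable_const hφ]
    simp
  | succ n ih =>
    have hwm := hx.measurable_noise
    -- The weight is a function of the past path, times a function of the present state and noise.
    let Z : (Fin (n + 1) → EuclideanSpace ℝ (Fin p)) → ℝ≥0∞ := fun z =>
      ENNReal.ofReal (Real.exp (∑ t ∈ Finset.range n, (a t (coord z t) (coord z (t + 1)) -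
        logGauss SigmaW (coord z (t + 1) - Matrix.toEuclideanCLM (𝕜 := ℝ) A (coord z t))) -
        logGauss Sigma0 (coord z 0)))
    have hZm : Measurable Z := by
      refine (Real.measurable_exp.comp ((Finset.measurable_sum _ fun t _ => ?_).sub
        (by fun_prop))).ennreal_ofReal
      exact ((ham t).comp (f := fun z : Fin (n + 1) → EuclideanSpace ℝ (Fin p) =>
        (coord z t, coord z (t + 1))) (by fun_prop)).sub (by fun_prop)
    have hZ : ∀ ω, Z (fun i => x i ω) = ENNReal.ofReal (Real.exp (∑ t ∈ Finset.range n,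
        (a t (x t ω) (x (t + 1) ω) - logGauss SigmaW (w t ω)) - logGauss Sigma0 (x 0 ω))) := by
      intro ω
      simp only [Z]
      congr 3
      refine Finset.sum_congr rfl fun t ht => ?_
      have ht' := Finset.mem_range.1 ht
      rw [coord_of_lt _ (show t < n + 1 by omega), coord_of_lt _ (show t + 1 < n + 1 by omega),
        hx.noise_eq]
    let F : EuclideanSpace ℝ (Fin p) → EuclideanSpace ℝ (Fin p) → ℝ≥0∞ := fun u v =>
      ENNReal.ofReal (Real.exp (a n u (Matrix.toEuclideanCLM (𝕜 := ℝ) A u + v) -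
        logGauss SigmaW v)) * φ (Matrix.toEuclideanCLM (𝕜 := ℝ) A u + v)
    have hFm : Measurable fun q : EuclideanSpace ℝ (Fin p) × EuclideanSpace ℝ (Fin p) =>
        F q.1 q.2 := by
      refine (Real.measurable_exp.comp (((ham n).comp
        (f := fun q : EuclideanSpace ℝ (Fin p) × EuclideanSpace ℝ (Fin p) =>
          (q.1, Matrix.toEuclideanCLM (𝕜 := ℝ) A q.1 + q.2)) (by fun_prop)).sub
        (by fun_prop))).ennreal_ofReal.mul (hφ.comp (by fun_prop))
    have hlhs : ∀ ω, ENNReal.ofReal (Real.exp (∑ t ∈ Finset.range (n + 1),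
        (a t (x t ω) (x (t + 1) ω) - logGauss SigmaW (w t ω)) - logGauss Sigma0 (x 0 ω))) *
        φ (x (n + 1) ω) = Z (fun i => x i ω) * F (x n ω) (w n ω) := by
      intro ω
      rw [hZ]
      simp only [F]
      rw [← hx.step, ← mul_assoc, ← ENNReal.ofReal_mul (Real.exp_pos _).le, ← Real.exp_add,
        Finset.sum_range_succ]
      congr 3
      ring
    simp_rw [hlhs]
    have hpath := hx.measurable_path (n + 1)
    have hind := (indepFun_iff_map_prod_eq_prod_map_map hpath.aemeasurable
      (hwm n).aemeasurable).1 (hx.indepFun_path_noise n)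
    have hG : Measurable fun q : (Fin (n + 1) → EuclideanSpace ℝ (Fin p)) ×
        EuclideanSpace ℝ (Fin p) => Z q.1 * F (coord q.1 n) q.2 :=
      (hZm.comp measurable_fst).mul (hFm.comp (f := fun q : (Fin (n + 1) →
        EuclideanSpace ℝ (Fin p)) × EuclideanSpace ℝ (Fin p) => (coord q.1 n, q.2)) (by fun_prop))
    have hcn : ∀ ω, coord (fun i : Fin (n + 1) => x i ω) n = x n ω := fun ω =>
      coord_of_lt _ (Nat.lt_succ_self n)
    have h1 := lintegral_map (μ := μ) hG (hpath.prodMk (hwm n))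
    simp only [hcn] at h1
    rw [← h1, hind]
    have : IsProbabilityMeasure (μ.map fun ω (i : Fin (n + 1)) => x i ω) :=
      Measure.isProbabilityMeasure_map hpath.aemeasurable
    rw [(hx.law_noise n).map_eq, lintegral_prod _ hG.aemeasurable, lintegral_map
      hG.lintegral_prod_right' hpath]
    simp only [hcn]
    -- integrating out the noise leaves a function of the present state
    let ψ : EuclideanSpace ℝ (Fin p) → ℝ≥0∞ := fun u =>
      ∫⁻ v, ENNReal.ofReal (Real.exp (a n u v)) * φ v
    have hψm' : Measurable fun q : EuclideanSpace ℝ (Fin p) × EuclideanSpace ℝ (Fin p) =>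
        ENNReal.ofReal (Real.exp (a n q.1 q.2)) * φ q.2 :=
      (Real.measurable_exp.comp (ham n)).ennreal_ofReal.mul (hφ.comp measurable_snd)
    have hψm : Measurable ψ := hψm'.lintegral_prod_right'
    have hψ : ∀ u, ∫⁻ v, F u v ∂(multivariateGaussian 0 SigmaW) = ψ u := by
      intro u
      have hA : Measurable fun v => a n u (Matrix.toEuclideanCLM (𝕜 := ℝ) A u + v) :=
        (ham n).comp (f := fun v => (u, Matrix.toEuclideanCLM (𝕜 := ℝ) A u + v)) (by fun_prop)
      simp only [F]
      rw [lintegral_exp_sub_logGauss_mul hW hA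
        (φ := fun v => φ (Matrix.toEuclideanCLM (𝕜 := ℝ) A u + v))
        (hφ.comp (measurable_const_add _))]
      exact lintegral_add_left_eq_self (fun v => ENNReal.ofReal (Real.exp (a n u v)) * φ v) _
    have h2 : ∀ ω, ∫⁻ v, Z (fun i => x i ω) * F (x n ω) v ∂(multivariateGaussian 0 SigmaW) =
        ENNReal.ofReal (Real.exp (∑ t ∈ Finset.range n,
          (a t (x t ω) (x (t + 1) ω) - logGauss SigmaW (w t ω)) - logGauss Sigma0 (x 0 ω))) *
        ψ (x n ω) := fun ω => by
      have hFu : Measurable fun v => F (x n ω) v := hFm.comp measurable_prodMk_left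
      rw [lintegral_const_mul _ hFu, hψ, hZ]
    simp_rw [h2]
    rw [ih hψm, lintegral_lintegral_swap hψm'.aemeasurable]
    refine lintegral_congr fun v => ?_
    have hav : Measurable fun u => a n u v := (ham n).comp measurable_prodMk_right
    rw [lintegral_mul_const _ (by fun_prop), ha, one_mul]

namespace CausalPolicy

variable (hx : IsGaussMarkovSource A Sigma0 SigmaW μ x w)
  {π : CausalPolicy (EuclideanSpace ℝ (Fin p))} {n : ℕ} {D : ℝ}
include hx

/-- The Donsker–Varadhan bound for the log-likelihood ratio between a backward Gaussian model of the
source given the output and the source itself. In the backward model `𝐱ₙ` is Gaussian around the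
output `yₙ`, and `𝐱ₜ` given `𝐱ₜ₊₁` is Gaussian around `mₜ + G (𝐱ₜ₊₁ - A mₜ)` with covariance `Q`. -/
theorem ofReal_integral_backward_le_mutualInfo (h0 : Sigma0.PosDef) (hW : SigmaW.PosDef)
    {Q G : Matrix (Fin p) (Fin p) ℝ} (hQ : Q.PosDef)
    {m : ℕ → (Fin (n + 1) → EuclideanSpace ℝ (Fin p)) → EuclideanSpace ℝ (Fin p)}
    (hm : ∀ t, Measurable (m t))
    {g : (Fin (n + 1) → EuclideanSpace ℝ (Fin p)) × (Fin (n + 1) → EuclideanSpace ℝ (Fin p)) → ℝ}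
    (hgdef : g = fun z => logGauss 1 (coord z.1 n - coord z.2 n) +
      (∑ t ∈ Finset.range n, (logGauss Q (coord z.1 t - m t z.2 - Matrix.toEuclideanCLM (𝕜 := ℝ) G
        (coord z.1 (t + 1) - Matrix.toEuclideanCLM (𝕜 := ℝ) A (m t z.2))) -
        logGauss SigmaW (coord z.1 (t + 1) - Matrix.toEuclideanCLM (𝕜 := ℝ) A (coord z.1 t))) -
      logGauss Sigma0 (coord z.1 0)))
    (hg : Integrable g (π.jointLaw μ x n)) :
    ENNReal.ofReal (∫ z, g z ∂(π.jointLaw μ x n)) ≤ π.mutualInfo μ x n := by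
  have := isProbabilityMeasure_jointLaw hx π n
  have hgm : Measurable g := by
    rw [hgdef]; fun_prop
  refine ofReal_integral_le_klDiv hgm hg ?_
  rw [lintegral_prod_symm _ (by fun_prop)]
  have h1 : ∀ y, ∫⁻ z, ENNReal.ofReal (Real.exp (g (z, y))) ∂(π.jointLaw μ x n).fst = 1 := by
    intro y
    rw [fst_jointLaw hx, sourceLaw, lintegral_map (by fun_prop) (hx.measurable_path (n + 1))]
    have h2 := hx.lintegral_backward_ratio h0 hW
      (a := fun t u v => logGauss Q (u - m t y - Matrix.toEuclideanCLM (𝕜 := ℝ) G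
        (v - Matrix.toEuclideanCLM (𝕜 := ℝ) A (m t y))))
      (by intro t; fun_prop) (fun t v => by
        simp only [sub_sub]
        rw [lintegral_sub_right_eq_self (fun u => ENNReal.ofReal (Real.exp (logGauss Q u)))]
        exact lintegral_exp_logGauss hQ) n
      (φ := fun v => ENNReal.ofReal (Real.exp (logGauss 1 (v - coord y n)))) (by fun_prop)
    rw [lintegral_sub_right_eq_self (fun u => ENNReal.ofReal (Real.exp (logGauss 1 u))),
      lintegral_exp_logGauss Matrix.PosDef.one] at h2
    rw [← h2]
    refine lintegral_congr fun ω => ?_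
    rw [← ENNReal.ofReal_mul (Real.exp_pos _).le, ← Real.exp_add, hgdef]
    have hc : ∀ t ≤ n, coord (fun i : Fin (n + 1) => x i ω) t = x t ω := fun t ht =>
      coord_of_lt _ (Nat.lt_succ_of_le ht)
    simp only [hc n le_rfl, hc 0 (Nat.zero_le _)]
    rw [add_comm (logGauss 1 _)]
    congr 4
    refine Finset.sum_congr rfl fun t ht => ?_
    have ht' := Finset.mem_range.1 ht
    rw [hc t ht'.le, hc (t + 1) ht', hx.noise_eq]
  simp [h1]

/-- The averaged error covariance of the estimates of the state is nearly feasible, and the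
mutual information is at least the value of the program there, up to a constant. -/
theorem exists_relaxedFeasible_le_mutualInfo (h0 : Sigma0.PosDef) (hW : SigmaW.PosDef)
    (hD : 0 ≤ D) (hn : 0 < n) (hπ : π.MeetsDistortion μ x n D) :
    ∃ z ∈ relaxedFeasible A SigmaW D ((D + 1 + p) / n), 0 < z.2.det ∧
      ENNReal.ofReal ((p - D + Real.log Sigma0.det) / 2 +
        n * (-(1 / 2) * Real.log z.2.det + 1 / 2 * Real.log SigmaW.det)) ≤
        π.mutualInfo μ x n := by
  have := isProbabilityMeasure_jointLaw hx π n
  have hn' : (0 : ℝ) < n := by exact_mod_cast hn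
  obtain ⟨m, hm, he, htr, hpred, horth⟩ := exists_estimates hx hD hπ hW.posSemidef
  set J := π.jointLaw μ x n with hJ
  set M : ℕ → Matrix (Fin p) (Fin p) ℝ := fun t => crossMoment J
    (fun z => coord z.1 t - m t z.2) (fun z => coord z.1 t - m t z.2) with hM
  have hMpsd : ∀ t ≤ n, (M t).PosSemidef := fun t ht => posSemidef_crossMoment (he t ht)
  set c : ℝ := (n : ℝ)⁻¹ with hc
  have hcpos : 0 < c := by positivity
  -- The summand `1` makes `P` positive definite, and hence `smoothCov A SigmaW P` as well.
  set P : Matrix (Fin p) (Fin p) ℝ := c • ((∑ t ∈ Finset.range n, M t) + 1) with hPdef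
  have hsum : (∑ t ∈ Finset.range n, M t).PosSemidef :=
    Matrix.posSemidef_sum _ fun t ht => hMpsd t (Finset.mem_range.1 ht).le
  have hP : P.PosDef := (Matrix.PosDef.one.posSemidef_add hsum).smul hcpos
  have hQ : (smoothCov A SigmaW P).PosDef := posDef_smoothCov hW hP
  refine ⟨(P, smoothCov A SigmaW P), ⟨hQ.posSemidef, ?_, ?_, (lmi_iff hW hP.posSemidef).2
    (by simpa using Matrix.PosSemidef.zero)⟩, hQ.det_pos, ?_⟩
  · -- Summing the one-step inequalities leaves boundary terms that `D + 1 + p` dominates.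
    have h1 : (∑ t ∈ Finset.range n, (predCov A SigmaW (M t) - M (t + 1))).PosSemidef :=
      Matrix.posSemidef_sum _ fun t ht => hpred t (Finset.mem_range.1 ht)
    have h2 : ((D - (M 0).trace) • (1 : Matrix (Fin p) (Fin p) ℝ)).PosSemidef :=
      Matrix.PosSemidef.one.smul (sub_nonneg.2 (htr 0 (Nat.zero_le _)))
    have h3 := PosSemidef.le_trace_smul_one (hMpsd 0 (Nat.zero_le _))
    have h4 : (A * 1 * Aᵀ).PosSemidef := posSemidef_conj Matrix.PosSemidef.one A
    have h5 : ((p : ℝ) • (1 : Matrix (Fin p) (Fin p) ℝ)).PosSemidef :=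
      Matrix.PosSemidef.one.smul p.cast_nonneg
    have h6 := ((((h1.add (hMpsd n le_rfl)).add (h2.add h3)).add h4).add h5).smul hcpos.le
    convert h6 using 1
    have hs : ∑ t ∈ Finset.range n, M (t + 1) = ∑ t ∈ Finset.range n, M t + M n - M 0 := by
      rw [← Finset.sum_range_succ, Finset.sum_range_succ']; abel
    have hs2 : ∑ t ∈ Finset.range n, predCov A SigmaW (M t) =
        A * (∑ t ∈ Finset.range n, M t) * Aᵀ + (n : ℝ) • SigmaW := by
      simp only [predCov, Finset.sum_add_distrib, Finset.mul_sum, Finset.sum_mul,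
        Finset.sum_const, Finset.card_range]
      rw [Nat.cast_smul_eq_nsmul]
    have hcW : SigmaW = c • ((n : ℝ) • SigmaW) := by
      rw [smul_smul, hc, inv_mul_cancel₀ hn'.ne', one_smul]
    have hd : (D + 1 + p) / n = c * (D + 1 + p) := by rw [hc]; field_simp
    rw [Finset.sum_sub_distrib, hs, hs2]
    simp only [predCov, hPdef, hd]
    conv_lhs => rw [hcW]
    simp only [Matrix.mul_smul, Matrix.smul_mul, Matrix.mul_add, Matrix.add_mul, ← smul_smul,
      ← smul_add, ← smul_sub]
    congr 1
    simp only [sub_smul, add_smul, one_smul]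
    abel
  · have h1 : (∑ t ∈ Finset.range n, M t).trace ≤ n * D := by
      rw [Matrix.trace_sum]
      calc ∑ t ∈ Finset.range n, (M t).trace ≤ ∑ t ∈ Finset.range n, D :=
            Finset.sum_le_sum fun t ht => htr t (Finset.mem_range.1 ht).le
        _ = n * D := by simp
    simp only [hPdef, Matrix.trace_smul, Matrix.trace_add, Matrix.trace_one, Fintype.card_fin,
      smul_eq_mul]
    calc c * ((∑ t ∈ Finset.range n, M t).trace + p) ≤ c * (n * D + p) := by gcongr
      _ = D + p / n := by rw [hc]; field_simp
      _ ≤ D + (D + 1 + p) / n := by gcongr; linarith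
  · set Q := smoothCov A SigmaW P
    set G := smoothGain A SigmaW P
    have hst : ∀ t ≤ n, MemLp (fun z => coord z.1 t) 2 J := fun t ht =>
      memLp_state_jointLaw hx π n ht
    have hwL : ∀ t < n, MemLp (fun z => coord z.1 (t + 1) -
        Matrix.toEuclideanCLM (𝕜 := ℝ) A (coord z.1 t)) 2 J := fun t ht =>
      memLp_noise_jointLaw hx π n ht
    -- The residual of the backward estimate is linear in the estimation error and the noise.
    have hres : ∀ t, (fun z : (Fin (n + 1) → EuclideanSpace ℝ (Fin p)) ×
        (Fin (n + 1) → EuclideanSpace ℝ (Fin p)) =>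
        coord z.1 t - m t z.2 - Matrix.toEuclideanCLM (𝕜 := ℝ) G
          (coord z.1 (t + 1) - Matrix.toEuclideanCLM (𝕜 := ℝ) A (m t z.2))) =
        fun z => Matrix.toEuclideanCLM (𝕜 := ℝ) (1 - G * A) (coord z.1 t - m t z.2) +
          Matrix.toEuclideanCLM (𝕜 := ℝ) (-G) (coord z.1 (t + 1) -
            Matrix.toEuclideanCLM (𝕜 := ℝ) A (coord z.1 t)) := by
      intro t
      ext1 z
      simp only [map_sub, map_one, map_mul, map_neg, sub_apply,
        one_apply_eq_self, mul_apply_eq_comp, neg_apply]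
      abel
    have hrL : ∀ t < n, MemLp (fun z => coord z.1 t - m t z.2 -
        Matrix.toEuclideanCLM (𝕜 := ℝ) G
          (coord z.1 (t + 1) - Matrix.toEuclideanCLM (𝕜 := ℝ) A (m t z.2))) 2 J := fun t ht => by
      rw [hres t]
      exact (memLp_linear _ (he t ht.le)).add (memLp_linear _ (hwL t ht))
    have hrM : ∀ t < n, crossMoment J (fun z => coord z.1 t - m t z.2 -
        Matrix.toEuclideanCLM (𝕜 := ℝ) G
          (coord z.1 (t + 1) - Matrix.toEuclideanCLM (𝕜 := ℝ) A (m t z.2)))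
        (fun z => coord z.1 t - m t z.2 - Matrix.toEuclideanCLM (𝕜 := ℝ) G
          (coord z.1 (t + 1) - Matrix.toEuclideanCLM (𝕜 := ℝ) A (m t z.2))) =
        (1 - G * A) * M t * (1 - G * A)ᵀ + G * SigmaW * Gᵀ := fun t ht => by
      rw [hres t, crossMoment_linear_add_linear _ _ (he t ht.le) (hwL t ht) (horth t ht),
        crossMoment_of_hasLaw (hasLaw_noise_jointLaw hx π n ht) hW.posSemidef]
      simp [hM]
    have hxn := memLp_error hπ (le_refl n)
    have hI1 := integrable_logGauss 1 hxn
    have hI2 := fun t ht => integrable_logGauss Q (hrL t ht)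
    have hI3 := fun t ht => integrable_logGauss SigmaW (hwL t ht)
    have hI4 := integrable_logGauss Sigma0 (hst 0 (Nat.zero_le _))
    have hI23 := integrable_finsetSum (Finset.range n) fun t ht =>
      (hI2 t (Finset.mem_range.1 ht)).sub (hI3 t (Finset.mem_range.1 ht))
    refine le_trans (ENNReal.ofReal_le_ofReal ?_)
      (ofReal_integral_backward_le_mutualInfo hx h0 hW hQ (G := G) hm rfl
        (hI1.add (hI23.sub hI4)))
    have hval : ∫ z, (logGauss 1 (coord z.1 n - coord z.2 n) +
      (∑ t ∈ Finset.range n, (logGauss Q (coord z.1 t - m t z.2 - Matrix.toEuclideanCLM (𝕜 := ℝ) G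
        (coord z.1 (t + 1) - Matrix.toEuclideanCLM (𝕜 := ℝ) A (m t z.2))) -
        logGauss SigmaW (coord z.1 (t + 1) - Matrix.toEuclideanCLM (𝕜 := ℝ) A (coord z.1 t))) -
      logGauss Sigma0 (coord z.1 0))) ∂J =
      ∫ z, logGauss 1 (coord z.1 n - coord z.2 n) ∂J +
      (∑ t ∈ Finset.range n, (∫ z, logGauss Q (coord z.1 t - m t z.2 -
        Matrix.toEuclideanCLM (𝕜 := ℝ) G
        (coord z.1 (t + 1) - Matrix.toEuclideanCLM (𝕜 := ℝ) A (m t z.2))) ∂J -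
        ∫ z, logGauss SigmaW (coord z.1 (t + 1) -
          Matrix.toEuclideanCLM (𝕜 := ℝ) A (coord z.1 t)) ∂J) -
      ∫ z, logGauss Sigma0 (coord z.1 0) ∂J) := by
      have e1 := integral_add hI1 (hI23.sub hI4)
      have e2 := integral_sub hI23 hI4
      have e3 := integral_finsetSum (Finset.range n) fun t ht =>
        (hI2 t (Finset.mem_range.1 ht)).sub (hI3 t (Finset.mem_range.1 ht))
      simp only [Pi.sub_apply] at e1 e2 e3
      rw [e1, e2, e3]
      congr 2
      exact Finset.sum_congr rfl fun t ht =>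
        integral_sub (hI2 t (Finset.mem_range.1 ht)) (hI3 t (Finset.mem_range.1 ht))
    rw [hval, integral_logGauss _ hxn, integral_logGauss _ (hst 0 (Nat.zero_le _))]
    have hS0 : crossMoment J (fun z => coord z.1 0) (fun z => coord z.1 0) = Sigma0 :=
      crossMoment_of_hasLaw ⟨by fun_prop, by
        rw [map_state_jointLaw hx π n (Nat.zero_le _), hx.law_init.map_eq]⟩ h0.posSemidef
    rw [hS0, trace_inv_mul_self h0]
    have hterm : ∀ t ∈ Finset.range n, (∫ z, logGauss Q (coord z.1 t - m t z.2 -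
        Matrix.toEuclideanCLM (𝕜 := ℝ) G
        (coord z.1 (t + 1) - Matrix.toEuclideanCLM (𝕜 := ℝ) A (m t z.2))) ∂J -
        ∫ z, logGauss SigmaW (coord z.1 (t + 1) -
          Matrix.toEuclideanCLM (𝕜 := ℝ) A (coord z.1 t)) ∂J) =
        -(1 / 2) * (Q⁻¹ * ((1 - G * A) * M t * (1 - G * A)ᵀ + G * SigmaW * Gᵀ)).trace +
          (1 / 2 * p - 1 / 2 * Real.log Q.det + 1 / 2 * Real.log SigmaW.det) := by
      intro t ht
      have ht' := Finset.mem_range.1 ht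
      rw [integral_logGauss _ (hrL t ht'), integral_logGauss _ (hwL t ht'), hrM t ht',
        crossMoment_of_hasLaw (hasLaw_noise_jointLaw hx π n ht') hW.posSemidef,
        trace_inv_mul_self hW]
      ring
    rw [Finset.sum_congr rfl hterm, Finset.sum_add_distrib, ← Finset.mul_sum, Finset.sum_const,
      Finset.card_range, nsmul_eq_mul]
    -- The averaged residual covariance is at most `Q`, since the average of the `M t` is below `P`.
    have htrace : ∑ t ∈ Finset.range n,
        (Q⁻¹ * ((1 - G * A) * M t * (1 - G * A)ᵀ + G * SigmaW * Gᵀ)).trace ≤ (n : ℝ) * p := by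
      rw [← Matrix.trace_sum, ← Finset.mul_sum, Finset.sum_add_distrib, ← Finset.sum_mul,
        ← Finset.mul_sum, Finset.sum_const, Finset.card_range]
      have hid : (1 - G * A) * P * (1 - G * A)ᵀ + G * SigmaW * Gᵀ = Q :=
        smoothGain_identity hW hP.posSemidef
      have hE : (1 - G * A) * (∑ t ∈ Finset.range n, M t) * (1 - G * A)ᵀ + n • (G * SigmaW * Gᵀ) =
          (n : ℝ) • Q - (1 - G * A) * 1 * (1 - G * A)ᵀ := by
        have hnP : (n : ℝ) • P = (∑ t ∈ Finset.range n, M t) + 1 := by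
          rw [hPdef, smul_smul, hc, mul_inv_cancel₀ hn'.ne', one_smul]
        have : (n : ℝ) • Q = (1 - G * A) * ((n : ℝ) • P) * (1 - G * A)ᵀ +
            n • (G * SigmaW * Gᵀ) := by
          rw [← hid, smul_add, Nat.cast_smul_eq_nsmul ℝ n (G * SigmaW * Gᵀ),
            Matrix.mul_smul (1 - G * A) (n : ℝ) P, Matrix.smul_mul (n : ℝ) ((1 - G * A) * P)]
        rw [this, hnP, Matrix.mul_add, Matrix.add_mul]
        abel
      rw [hE, Matrix.mul_sub, Matrix.trace_sub, Matrix.mul_smul, Matrix.trace_smul,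
        trace_inv_mul_self hQ, smul_eq_mul]
      have := trace_mul_nonneg hQ.inv.posSemidef
        (posSemidef_conj (Matrix.PosSemidef.one (n := Fin p) (R := ℝ)) (1 - G * A))
      linarith
    have h1 : ((1 : Matrix (Fin p) (Fin p) ℝ)⁻¹ * crossMoment J
        (fun z => coord z.1 n - coord z.2 n) (fun z => coord z.1 n - coord z.2 n)).trace ≤ D := by
      rw [inv_one, Matrix.one_mul]; exact trace_error_le hD hπ le_rfl
    simp only [Matrix.det_one, Real.log_one]
    set T := ∑ t ∈ Finset.range n,
        (Q⁻¹ * ((1 - G * A) * M t * (1 - G * A)ᵀ + G * SigmaW * Gᵀ)).trace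
    linarith

end CausalPolicy

end SRD
end

noncomputable section
namespace SRD

variable {p : ℕ}

/-! ### Linear Gaussian policies -/

/-- The previous output, with the convention `y₋₁ = 0`. -/
def prev {n : ℕ} (y : Fin n → EuclideanSpace ℝ (Fin p)) : ℕ → EuclideanSpace ℝ (Fin p)
  | 0 => 0
  | t + 1 => coord y t

@[fun_prop]
theorem measurable_prev {n : ℕ} (t : ℕ) :
    Measurable fun y : Fin n → EuclideanSpace ℝ (Fin p) => prev y t := by
  cases t with
  | zero => exact measurable_const
  | succ t => exact measurable_coord t

theorem prev_init {n t : ℕ} (y : Fin (n + 1) → EuclideanSpace ℝ (Fin p)) (ht : t ≤ n) :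
    prev (Fin.init y : Fin n → EuclideanSpace ℝ (Fin p)) t = prev y t := by
  cases t with
  | zero => rfl
  | succ t => exact coord_init y ht

theorem prev_snoc {n t : ℕ} (y : Fin n → EuclideanSpace ℝ (Fin p)) (v : EuclideanSpace ℝ (Fin p))
    (ht : t ≤ n) : prev (Fin.snoc y v : Fin (n + 1) → EuclideanSpace ℝ (Fin p)) t = prev y t := by
  rw [← prev_init _ ht, Fin.init_snoc]

/-- The Gaussian kernel with mean `m` and covariance `S`. -/
def gaussKernel {α : Type*} [MeasurableSpace α] (m : α → EuclideanSpace ℝ (Fin p))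
    (S : Matrix (Fin p) (Fin p) ℝ) : Kernel α (EuclideanSpace ℝ (Fin p)) :=
  (Kernel.id ×ₖ Kernel.const α (multivariateGaussian 0 S)).map fun q => m q.1 + q.2

theorem isMarkovKernel_gaussKernel {α : Type*} [MeasurableSpace α]
    {m : α → EuclideanSpace ℝ (Fin p)} (hm : Measurable m) (S : Matrix (Fin p) (Fin p) ℝ) :
    IsMarkovKernel (gaussKernel m S) :=
  Kernel.IsMarkovKernel.map _ (by fun_prop)

theorem lintegral_gaussKernel {α : Type*} [MeasurableSpace α]
    {m : α → EuclideanSpace ℝ (Fin p)} (hm : Measurable m) (S : Matrix (Fin p) (Fin p) ℝ) (a : α)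
    {f : EuclideanSpace ℝ (Fin p) → ℝ≥0∞} (hf : Measurable f) :
    ∫⁻ v, f v ∂(gaussKernel m S a) = ∫⁻ u, f (m a + u) ∂(multivariateGaussian 0 S) := by
  rw [gaussKernel, Kernel.lintegral_map _ (by fun_prop) _ hf, Kernel.lintegral_prod _ _ _
    (g := fun q : α × EuclideanSpace ℝ (Fin p) => f (m q.1 + q.2)) (by fun_prop)]
  simp only [Kernel.const_apply]
  rw [Kernel.lintegral_id']
  exact Measurable.lintegral_prod_right' (f := fun q : α × EuclideanSpace ℝ (Fin p) =>
    f (m q.1 + q.2)) (by fun_prop)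

theorem lintegral_gaussian_shift {S : Matrix (Fin p) (Fin p) ℝ} (hS : S.PosDef)
    (m : EuclideanSpace ℝ (Fin p)) {f : EuclideanSpace ℝ (Fin p) → ℝ≥0∞} (hf : Measurable f) :
    ∫⁻ u, f (m + u) ∂(multivariateGaussian 0 S) =
      ∫⁻ v, ENNReal.ofReal (Real.exp (logGauss S (v - m))) * f v := by
  rw [multivariateGaussian_eq_withDensity hS, lintegral_withDensity_eq_lintegral_mul _
    (by fun_prop) (by fun_prop), ← lintegral_add_left_eq_self
    (fun v => ENNReal.ofReal (Real.exp (logGauss S (v - m))) * f v) m]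
  simp

/-- The mean `A yₜ₋₁ + K (xₜ - A yₜ₋₁)` of the next output of a linear policy. -/
def linearMean (A K : Matrix (Fin p) (Fin p) ℝ) (a b : EuclideanSpace ℝ (Fin p)) :
    EuclideanSpace ℝ (Fin p) :=
  Matrix.toEuclideanCLM (𝕜 := ℝ) A b +
    Matrix.toEuclideanCLM (𝕜 := ℝ) K (a - Matrix.toEuclideanCLM (𝕜 := ℝ) A b)

@[fun_prop]
theorem measurable_linearMean {α : Type*} [MeasurableSpace α] (A K : Matrix (Fin p) (Fin p) ℝ)
    {a b : α → EuclideanSpace ℝ (Fin p)} (ha : Measurable a) (hb : Measurable b) :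
    Measurable fun z => linearMean A K (a z) (b z) := by
  unfold linearMean; fun_prop

/-- The policy whose output at time `t` is `A yₜ₋₁ + Kₜ (xₜ - A yₜ₋₁)` plus independent Gaussian
noise of covariance `Uₜ`. For `K = 0` the output does not depend on the source. -/
def linearPolicy (A : Matrix (Fin p) (Fin p) ℝ) (K U : ℕ → Matrix (Fin p) (Fin p) ℝ) :
    CausalPolicy (EuclideanSpace ℝ (Fin p)) where
  kernel t := gaussKernel (fun q => linearMean A (K t) (coord q.1 t) (prev q.2 t)) (U t)
  isMarkov t := isMarkovKernel_gaussKernel (by fun_prop) _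

namespace CausalPolicy

variable (A : Matrix (Fin p) (Fin p) ℝ) (K U W : ℕ → Matrix (Fin p) (Fin p) ℝ)

theorem lintegral_linearPolicy_succ (n : ℕ) (x : Fin (n + 1) → EuclideanSpace ℝ (Fin p))
    {f : (Fin (n + 1) → EuclideanSpace ℝ (Fin p)) → ℝ≥0∞} (hf : Measurable f) :
    ∫⁻ y, f y ∂((linearPolicy A K U).causalKernel (n + 1) x) =
      ∫⁻ y, ∫⁻ u, f (Fin.snoc y (linearMean A (K n) (coord x n) (prev y n) + u))
        ∂(multivariateGaussian 0 (U n)) ∂((linearPolicy A K U).causalKernel n (Fin.init x)) := by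
  rw [lintegral_causalKernel_succ _ _ _ hf]
  refine lintegral_congr fun y => ?_
  exact lintegral_gaussKernel (by fun_prop) _ _
    (f := fun v => f (Fin.snoc y v)) (hf.comp ((measurable_finSnoc n).comp measurable_prodMk_left))

/-- The outputs of a policy without gain are independent of the source. -/
theorem causalKernel_zero_gain (n : ℕ) (x x' : Fin n → EuclideanSpace ℝ (Fin p)) :
    (linearPolicy A 0 W).causalKernel n x = (linearPolicy A 0 W).causalKernel n x' := by
  induction n with
  | zero => rw [Subsingleton.elim x x']
  | succ n ih =>
    refine Measure.ext_of_lintegral _ fun f hf => ?_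
    rw [lintegral_linearPolicy_succ _ _ _ _ _ hf, lintegral_linearPolicy_succ _ _ _ _ _ hf,
      ih (Fin.init x) (Fin.init x')]
    simp [linearMean]

/-- The one-step log-likelihood ratio of a linear policy and a policy without gain. -/
def stepRatio (t : ℕ) (a b v : EuclideanSpace ℝ (Fin p)) : ℝ :=
  logGauss (U t) (v - linearMean A (K t) a b) -
    logGauss (W t) (v - Matrix.toEuclideanCLM (𝕜 := ℝ) A b)

@[fun_prop]
theorem measurable_stepRatio {α : Type*} [MeasurableSpace α] (t : ℕ)
    {a b v : α → EuclideanSpace ℝ (Fin p)} (ha : Measurable a) (hb : Measurable b)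
    (hv : Measurable v) : Measurable fun z => stepRatio A K U W t (a z) (b z) (v z) := by
  unfold stepRatio; fun_prop

/-- The log-likelihood ratio of a linear policy and a policy without gain. -/
def pathRatio (n : ℕ) {k l : ℕ} (x : Fin k → EuclideanSpace ℝ (Fin p))
    (y : Fin l → EuclideanSpace ℝ (Fin p)) : ℝ :=
  ∑ t ∈ Finset.range n, stepRatio A K U W t (coord x t) (prev y t) (coord y t)

@[fun_prop]
theorem measurable_pathRatio {α : Type*} [MeasurableSpace α] (n : ℕ) {k l : ℕ}
    {x : α → Fin k → EuclideanSpace ℝ (Fin p)} {y : α → Fin l → EuclideanSpace ℝ (Fin p)}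
    (hx : Measurable x) (hy : Measurable y) :
    Measurable fun z => pathRatio A K U W n (x z) (y z) := by
  unfold pathRatio
  refine Finset.measurable_sum _ fun t _ => measurable_stepRatio A K U W t ?_ ?_ ?_
  · exact (measurable_coord t).comp hx
  · exact (measurable_prev t).comp hy
  · exact (measurable_coord t).comp hy

variable {U W}

/-- Given the source, a linear policy has the density `exp (pathRatio …)` with respect to a policy
without gain. -/
theorem lintegral_causalKernel_eq_pathRatio (hU : ∀ t, (U t).PosDef) (hW : ∀ t, (W t).PosDef)
    (n : ℕ) (x : Fin n → EuclideanSpace ℝ (Fin p))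
    {f : (Fin n → EuclideanSpace ℝ (Fin p)) → ℝ≥0∞} (hf : Measurable f) :
    ∫⁻ y, f y ∂((linearPolicy A K U).causalKernel n x) =
      ∫⁻ y, ENNReal.ofReal (Real.exp (pathRatio A K U W n x y)) * f y
        ∂((linearPolicy A 0 W).causalKernel n x) := by
  induction n with
  | zero => simp [causalKernel, pathRatio]
  | succ n ih =>
    have hsnoc : ∀ y : Fin n → EuclideanSpace ℝ (Fin p), Measurable fun v =>
        (Fin.snoc y v : Fin (n + 1) → EuclideanSpace ℝ (Fin p)) := fun y =>
      (measurable_finSnoc n).comp measurable_prodMk_left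
    have hF : Measurable fun y : Fin n → EuclideanSpace ℝ (Fin p) =>
        ∫⁻ u, f (Fin.snoc y (linearMean A (K n) (coord x n) (prev y n) + u))
          ∂(multivariateGaussian 0 (U n)) := by
      refine Measurable.lintegral_prod_right' (f := fun q : (Fin n → EuclideanSpace ℝ (Fin p)) ×
        EuclideanSpace ℝ (Fin p) =>
        f (Fin.snoc q.1 (linearMean A (K n) (coord x n) (prev q.1 n) + q.2))) ?_
      exact hf.comp ((measurable_finSnoc n).comp (f := fun q : (Fin n → EuclideanSpace ℝ (Fin p)) ×
        EuclideanSpace ℝ (Fin p) => (q.1, linearMean A (K n) (coord x n) (prev q.1 n) + q.2))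
        (by fun_prop))
    rw [lintegral_linearPolicy_succ _ _ _ _ _ hf, ih _ hF, lintegral_linearPolicy_succ _ _ _ _ _
      (f := fun y => ENNReal.ofReal (Real.exp (pathRatio A K U W (n + 1) x y)) * f y)
      (by fun_prop)]
    refine lintegral_congr fun y => ?_
    have hm0 : linearMean A ((0 : ℕ → Matrix (Fin p) (Fin p) ℝ) n) (coord x n) (prev y n) =
        Matrix.toEuclideanCLM (𝕜 := ℝ) A (prev y n) := by simp [linearMean]
    have hm : Measurable fun v => ENNReal.ofReal (Real.exp (logGauss (U n)
        (v - linearMean A (K n) (coord x n) (prev y n)))) * f (Fin.snoc y v) :=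
      Measurable.mul (by fun_prop) (hf.comp (hsnoc y))
    rw [hm0, lintegral_gaussian_shift (hU n) _ (f := fun v => f (Fin.snoc y v))
      (hf.comp (hsnoc y)), lintegral_gaussian_shift (hW n) _ (f := fun v =>
        ENNReal.ofReal (Real.exp (pathRatio A K U W (n + 1) x
          (Fin.snoc y v : Fin (n + 1) → EuclideanSpace ℝ (Fin p)))) * f (Fin.snoc y v))
      ((Measurable.ennreal_ofReal (Real.measurable_exp.comp (measurable_pathRatio A K U W _
        measurable_const (hsnoc y)))).mul (hf.comp (hsnoc y))),
      ← lintegral_const_mul _ hm]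
    refine lintegral_congr fun v => ?_
    have hr : pathRatio A K U W (n + 1) x (Fin.snoc y v : Fin (n + 1) → EuclideanSpace ℝ (Fin p)) =
        pathRatio A K U W n (Fin.init x : Fin n → EuclideanSpace ℝ (Fin p)) y +
          stepRatio A K U W n (coord x n) (prev y n) v := by
      rw [pathRatio, Finset.sum_range_succ, coord_snoc_self, prev_snoc _ _ le_rfl]
      congr 1
      refine Finset.sum_congr rfl fun t ht => ?_
      have ht' := Finset.mem_range.1 ht
      rw [coord_snoc_of_lt _ _ ht', prev_snoc _ _ ht'.le, coord_init _ ht']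
    rw [hr, ← mul_assoc, ← mul_assoc, ← ENNReal.ofReal_mul (Real.exp_pos _).le,
      ← ENNReal.ofReal_mul (Real.exp_pos _).le, ← Real.exp_add, ← Real.exp_add, stepRatio]
    congr 3
    ring

end CausalPolicy

end SRD
end

noncomputable section
namespace SRD

variable {p : ℕ}

/-! ### Gains realizing prescribed error covariances -/

/-- The gain of a linear policy that reduces the error covariance from `N` to `P`: if the output is
`K e + u` for an error `e` of covariance `N` and independent noise `u` of covariance `testCov P N`,
then `e - (K e + u)` has covariance `P`, and it is uncorrelated with the output. -/
def gain (P N : Matrix (Fin p) (Fin p) ℝ) : Matrix (Fin p) (Fin p) ℝ := 1 - P * N⁻¹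

/-- The covariance of the noise that goes with `gain P N`. -/
def testCov (P N : Matrix (Fin p) (Fin p) ℝ) : Matrix (Fin p) (Fin p) ℝ := P - P * N⁻¹ * P

section GainIdentities

variable {P N : Matrix (Fin p) (Fin p) ℝ} (hP : P.PosDef) (hN : N.PosDef)
include hP hN

theorem posDef_testCov (h : (N - P).PosDef) : (testCov P N).PosDef := by
  have hPt := SRD.PosSemidef.transpose_eq hP.posSemidef
  have := posDef_schur (B := P) hP hN (by
    rwa [hPt, Matrix.mul_nonsing_inv _ ((Matrix.isUnit_iff_isUnit_det _).1 hP.isUnit),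
      Matrix.one_mul])
  rwa [hPt] at this

theorem det_testCov_mul : (testCov P N).det * N.det = P.det * (N - P).det := by
  have hPt := SRD.PosSemidef.transpose_eq hP.posSemidef
  have := det_schur_mul_det hP hN P
  rwa [hPt, Matrix.mul_nonsing_inv _ ((Matrix.isUnit_iff_isUnit_det _).1 hP.isUnit),
      Matrix.one_mul] at this

/-- The covariance of the error that remains after the output is `P`. -/
theorem one_sub_gain_conj_add : (1 - gain P N) * N * (1 - gain P N)ᵀ + testCov P N = P := by
  have hPt := SRD.PosSemidef.transpose_eq hP.posSemidef
  have hNt := SRD.PosSemidef.transpose_eq hN.posSemidef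
  have hu := (Matrix.isUnit_iff_isUnit_det _).1 hN.isUnit
  rw [gain, testCov, sub_sub_cancel, Matrix.transpose_mul, Matrix.transpose_nonsing_inv, hPt, hNt,
    Matrix.nonsing_inv_mul_cancel_right _ _ hu, ← Matrix.mul_assoc]
  abel

/-- The covariance of the output is `N - P`. -/
theorem gain_conj_add : gain P N * N * (gain P N)ᵀ + testCov P N = N - P := by
  have hPt := SRD.PosSemidef.transpose_eq hP.posSemidef
  have hNt := SRD.PosSemidef.transpose_eq hN.posSemidef
  have hu := (Matrix.isUnit_iff_isUnit_det _).1 hN.isUnit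
  rw [gain, testCov, Matrix.transpose_sub, Matrix.transpose_one, Matrix.transpose_mul,
    Matrix.transpose_nonsing_inv, hPt, hNt, Matrix.sub_mul, Matrix.one_mul,
    Matrix.nonsing_inv_mul_cancel_right _ _ hu, Matrix.mul_sub, Matrix.mul_one, Matrix.sub_mul,
    Matrix.mul_nonsing_inv_cancel_left _ _ hu, ← Matrix.mul_assoc]
  abel

end GainIdentities

/-! ### Innovations of a linear policy -/

/-- The prediction error `xₜ - A yₜ₋₁`. -/
def predError (A : Matrix (Fin p) (Fin p) ℝ) {k l : ℕ} (t : ℕ)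
    (z : (Fin k → EuclideanSpace ℝ (Fin p)) × (Fin l → EuclideanSpace ℝ (Fin p))) :
    EuclideanSpace ℝ (Fin p) :=
  coord z.1 t - Matrix.toEuclideanCLM (𝕜 := ℝ) A (prev z.2 t)

/-- The noise `yₜ - A yₜ₋₁ - Kₜ (xₜ - A yₜ₋₁)` added by a linear policy. -/
def policyNoise (A : Matrix (Fin p) (Fin p) ℝ) (K : ℕ → Matrix (Fin p) (Fin p) ℝ) {k l : ℕ} (t : ℕ)
    (z : (Fin k → EuclideanSpace ℝ (Fin p)) × (Fin l → EuclideanSpace ℝ (Fin p))) :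
    EuclideanSpace ℝ (Fin p) :=
  coord z.2 t - linearMean A (K t) (coord z.1 t) (prev z.2 t)

section Innovations

variable (A : Matrix (Fin p) (Fin p) ℝ) (K U W : ℕ → Matrix (Fin p) (Fin p) ℝ)

@[fun_prop]
theorem measurable_predError {k l : ℕ} (t : ℕ) : Measurable fun z :
    (Fin k → EuclideanSpace ℝ (Fin p)) × (Fin l → EuclideanSpace ℝ (Fin p)) =>
      predError A t z := by
  unfold predError; fun_prop

@[fun_prop]
theorem measurable_policyNoise {k l : ℕ} (t : ℕ) : Measurable fun z :
    (Fin k → EuclideanSpace ℝ (Fin p)) × (Fin l → EuclideanSpace ℝ (Fin p)) =>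
      policyNoise A K t z := by
  unfold policyNoise; fun_prop

theorem coord_sub_linear_prev {k l : ℕ} (t : ℕ)
    (z : (Fin k → EuclideanSpace ℝ (Fin p)) × (Fin l → EuclideanSpace ℝ (Fin p))) :
    coord z.2 t - Matrix.toEuclideanCLM (𝕜 := ℝ) A (prev z.2 t) =
      Matrix.toEuclideanCLM (𝕜 := ℝ) (K t) (predError A t z) +
        Matrix.toEuclideanCLM (𝕜 := ℝ) 1 (policyNoise A K t z) := by
  simp only [predError, policyNoise, linearMean, map_one, one_apply_eq_self]
  abel

theorem coord_sub_coord {k l : ℕ} (t : ℕ)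
    (z : (Fin k → EuclideanSpace ℝ (Fin p)) × (Fin l → EuclideanSpace ℝ (Fin p))) :
    coord z.1 t - coord z.2 t =
      Matrix.toEuclideanCLM (𝕜 := ℝ) (1 - K t) (predError A t z) +
        Matrix.toEuclideanCLM (𝕜 := ℝ) (-1) (policyNoise A K t z) := by
  simp only [predError, policyNoise, linearMean, map_one, map_sub, map_neg,
    one_apply_eq_self, sub_apply, neg_apply]
  abel

namespace CausalPolicy

/-- Given the source, the noise that the policy adds at time `t` is independent of the previous
output. -/
theorem lintegral_prev_policyNoise {t n : ℕ} (ht : t < n) (x : Fin n → EuclideanSpace ℝ (Fin p))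
    {F : EuclideanSpace ℝ (Fin p) × EuclideanSpace ℝ (Fin p) → ℝ≥0∞} (hF : Measurable F) :
    ∫⁻ y, F (prev y t, policyNoise A K t (x, y)) ∂((linearPolicy A K U).causalKernel n x) =
      ∫⁻ y, ∫⁻ u, F (prev y t, u) ∂(multivariateGaussian 0 (U t))
        ∂((linearPolicy A K U).causalKernel n x) := by
  have hFm : ∀ k, Measurable fun y : Fin k → EuclideanSpace ℝ (Fin p) =>
      ∫⁻ u, F (prev y t, u) ∂(multivariateGaussian 0 (U t)) := fun k =>
    Measurable.lintegral_prod_right' (f := fun q : (Fin k → EuclideanSpace ℝ (Fin p)) ×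
      EuclideanSpace ℝ (Fin p) => F (prev q.1 t, q.2)) (by fun_prop)
  induction n, ht using Nat.le_induction with
  | base =>
    rw [lintegral_linearPolicy_succ _ _ _ _ _
      (f := fun y => F (prev y t, policyNoise A K t (x, y))) (by fun_prop),
      lintegral_linearPolicy_succ _ _ _ _ _ (hFm _)]
    refine lintegral_congr fun y => ?_
    simp [policyNoise, prev_snoc]
  | succ n hn ih =>
    have h1 : ∀ y : Fin (n + 1) → EuclideanSpace ℝ (Fin p),
        F (prev y t, policyNoise A K t (x, y)) = F (prev (Fin.init y : Fin n → _) t,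
          policyNoise A K t ((Fin.init x : Fin n → _), (Fin.init y : Fin n → _))) := fun y => by
      simp only [policyNoise]
      rw [prev_init _ (by omega), coord_init _ (by omega), coord_init _ (by omega)]
    have h2 : ∀ y : Fin (n + 1) → EuclideanSpace ℝ (Fin p),
        prev y t = prev (Fin.init y : Fin n → _) t := fun y => by
      rw [prev_init _ (by omega)]
    simp_rw [h1]
    rw [lintegral_causalKernel_init _ _ _ (f := fun y : Fin n → EuclideanSpace ℝ (Fin p) =>
      F (prev y t, policyNoise A K t ((Fin.init x : Fin n → _), y))) (by fun_prop), ih]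
    simp_rw [h2]
    rw [lintegral_causalKernel_init _ _ _ (hFm n)]

variable {A Sigma0 SigmaW : Matrix (Fin p) (Fin p) ℝ} {K U} {Ω : Type*} [MeasurableSpace Ω]
  {μ : Measure Ω} [IsProbabilityMeasure μ] {x w : ℕ → Ω → EuclideanSpace ℝ (Fin p)}
  (hx : IsGaussMarkovSource A Sigma0 SigmaW μ x w)
include hx

/-- The noise added by a linear policy is independent of the prediction error. -/
theorem map_predError_policyNoise {t n : ℕ} (ht : t ≤ n) :
    ((linearPolicy A K U).jointLaw μ x n).map (fun z => (predError A t z, policyNoise A K t z)) =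
      (((linearPolicy A K U).jointLaw μ x n).map (predError A t)).prod
        (multivariateGaussian 0 (U t)) := by
  have := isProbabilityMeasure_jointLaw hx (linearPolicy A K U) n
  refine Measure.ext_of_lintegral _ fun f hf => ?_
  have hfm : Measurable fun a => ∫⁻ u, f (a, u) ∂(multivariateGaussian 0 (U t)) :=
    hf.lintegral_prod_right'
  rw [lintegral_map hf (by fun_prop), lintegral_prod _ hf.aemeasurable,
    lintegral_map hfm (by fun_prop), lintegral_jointLaw hx _ _ (by fun_prop),
    lintegral_jointLaw hx _ _ (f := fun z => ∫⁻ u, f (predError A t z, u)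
      ∂(multivariateGaussian 0 (U t))) (hfm.comp (by fun_prop))]
  refine lintegral_congr fun ω => ?_
  exact lintegral_prev_policyNoise A K U (show t < n + 1 by omega) (fun i => x i ω)
    (F := fun q => f (coord (fun i : Fin (n + 1) => x i ω) t -
      Matrix.toEuclideanCLM (𝕜 := ℝ) A q.1, q.2)) (by fun_prop)

theorem hasLaw_policyNoise {t n : ℕ} (ht : t ≤ n) :
    HasLaw (policyNoise A K t) (multivariateGaussian 0 (U t))
      ((linearPolicy A K U).jointLaw μ x n) := by
  have := isProbabilityMeasure_jointLaw hx (linearPolicy A K U) n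
  have : IsProbabilityMeasure (((linearPolicy A K U).jointLaw μ x n).map (predError A t)) :=
    Measure.isProbabilityMeasure_map (by fun_prop)
  refine ⟨by fun_prop, ?_⟩
  have h := congrArg Measure.snd (map_predError_policyNoise (K := K) (U := U) hx ht)
  rw [Measure.snd_prod, Measure.snd, Measure.map_map measurable_snd (by fun_prop)] at h
  exact h

theorem indepFun_policyNoise_predError {t n : ℕ} (ht : t ≤ n) :
    IndepFun (policyNoise A K t) (predError A t) ((linearPolicy A K U).jointLaw μ x n) := by
  have := isProbabilityMeasure_jointLaw hx (linearPolicy A K U) n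
  refine IndepFun.symm ?_
  rw [indepFun_iff_map_prod_eq_prod_map_map (by fun_prop) (by fun_prop),
    map_predError_policyNoise hx ht, (hasLaw_policyNoise hx ht).map_eq]

theorem memLp_policyNoise {t n : ℕ} (ht : t ≤ n) :
    MemLp (policyNoise A K t) 2 ((linearPolicy A K U).jointLaw μ x n) := by
  have h : MemLp id 2 (((linearPolicy A K U).jointLaw μ x n).map (policyNoise A K t)) := by
    rw [(hasLaw_policyNoise hx ht).map_eq]; exact IsGaussian.memLp_two_id
  exact h.comp_of_map (by fun_prop)

end CausalPolicy

end Innovations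

end SRD
end

noncomputable section
namespace SRD

variable {p : ℕ}

/-! ### Achievable error covariances and rates -/

/-- The prediction error covariances that go with the error covariances `Pₜ`. -/
def priorCov (A Sigma0 SigmaW : Matrix (Fin p) (Fin p) ℝ) (P : ℕ → Matrix (Fin p) (Fin p) ℝ) :
    ℕ → Matrix (Fin p) (Fin p) ℝ
  | 0 => Sigma0
  | t + 1 => predCov A SigmaW (P t)

/-- The linear policy designed to have error covariance `Pₜ` at each time `t`. -/
def trackingPolicy (A Sigma0 SigmaW : Matrix (Fin p) (Fin p) ℝ)
    (P : ℕ → Matrix (Fin p) (Fin p) ℝ) : CausalPolicy (EuclideanSpace ℝ (Fin p)) :=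
  linearPolicy A (fun t => gain (P t) (priorCov A Sigma0 SigmaW P t))
    (fun t => testCov (P t) (priorCov A Sigma0 SigmaW P t))

namespace CausalPolicy

variable {A Sigma0 SigmaW : Matrix (Fin p) (Fin p) ℝ} {Ω : Type*} [MeasurableSpace Ω]
  {μ : Measure Ω} [IsProbabilityMeasure μ] {x w : ℕ → Ω → EuclideanSpace ℝ (Fin p)}
  {P : ℕ → Matrix (Fin p) (Fin p) ℝ}
  (hP : ∀ t, (P t).PosDef) (hNP : ∀ t, (priorCov A Sigma0 SigmaW P t - P t).PosDef)

include hP hNP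

theorem posDef_priorCov (t : ℕ) : (priorCov A Sigma0 SigmaW P t).PosDef := by
  simpa using (hNP t).add (hP t)

variable (hx : IsGaussMarkovSource A Sigma0 SigmaW μ x w)
include hx

theorem crossMoment_policyNoise {t n : ℕ} (ht : t ≤ n) :
    crossMoment ((trackingPolicy A Sigma0 SigmaW P).jointLaw μ x n)
      (policyNoise A (fun t => gain (P t) (priorCov A Sigma0 SigmaW P t)) t)
      (policyNoise A (fun t => gain (P t) (priorCov A Sigma0 SigmaW P t)) t) =
      testCov (P t) (priorCov A Sigma0 SigmaW P t) := by
  have h := hasLaw_policyNoise (K := fun t => gain (P t) (priorCov A Sigma0 SigmaW P t))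
    (U := fun t => testCov (P t) (priorCov A Sigma0 SigmaW P t)) hx ht
  have hS := (posDef_testCov (hP t) (posDef_priorCov hP hNP t) (hNP t)).posSemidef
  rw [trackingPolicy]
  exact crossMoment_of_hasLaw h hS

omit hP hNP in
theorem crossMoment_predError_policyNoise {t n : ℕ} (ht : t ≤ n)
    (he : MemLp (predError A t) 2 ((trackingPolicy A Sigma0 SigmaW P).jointLaw μ x n)) :
    crossMoment ((trackingPolicy A Sigma0 SigmaW P).jointLaw μ x n) (predError A t)
      (policyNoise A (fun t => gain (P t) (priorCov A Sigma0 SigmaW P t)) t) = 0 := by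
  rw [← transpose_crossMoment]
  have h := hasLaw_policyNoise (K := fun t => gain (P t) (priorCov A Sigma0 SigmaW P t))
    (U := fun t => testCov (P t) (priorCov A Sigma0 SigmaW P t)) hx ht
  have h0 := crossMoment_eq_zero_of_indepFun (indepFun_policyNoise_predError hx ht)
    (memLp_policyNoise hx ht) he (integral_of_hasLaw h)
  rw [trackingPolicy, h0, Matrix.transpose_zero]

/-- One step of the policy: a prediction error dominated by `priorCov` leaves an error dominated by
`Pₜ`. -/
theorem error_of_predError {t n : ℕ} (ht : t ≤ n)
    (he : MemLp (predError A t) 2 ((trackingPolicy A Sigma0 SigmaW P).jointLaw μ x n))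
    (hM : (priorCov A Sigma0 SigmaW P t - crossMoment ((trackingPolicy A Sigma0 SigmaW P).jointLaw
      μ x n) (predError A t) (predError A t)).PosSemidef) :
    MemLp (fun z => coord z.1 t - coord z.2 t) 2
        ((trackingPolicy A Sigma0 SigmaW P).jointLaw μ x n) ∧
      (P t - crossMoment ((trackingPolicy A Sigma0 SigmaW P).jointLaw μ x n)
        (fun z => coord z.1 t - coord z.2 t) (fun z => coord z.1 t - coord z.2 t)).PosSemidef := by
  have hu := memLp_policyNoise (K := fun t => gain (P t) (priorCov A Sigma0 SigmaW P t))
    (U := fun t => testCov (P t) (priorCov A Sigma0 SigmaW P t)) hx ht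
  simp only [coord_sub_coord A (fun t => gain (P t) (priorCov A Sigma0 SigmaW P t))]
  refine ⟨(memLp_linear _ he).add (memLp_linear _ hu), ?_⟩
  rw [crossMoment_linear_add_linear _ _ he hu (crossMoment_predError_policyNoise hx ht he),
    crossMoment_policyNoise hP hNP hx ht]
  nth_rw 1 [← one_sub_gain_conj_add (hP t) (posDef_priorCov hP hNP t)]
  convert posSemidef_conj hM (1 - gain (P t) (priorCov A Sigma0 SigmaW P t)) using 1
  rw [Matrix.mul_sub (1 - _), Matrix.sub_mul (_ * _)]
  simp only [neg_mul, Matrix.one_mul, Matrix.transpose_neg, Matrix.transpose_one, mul_neg,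
    Matrix.mul_one, neg_neg]
  abel

/-- Along the tracking policy, the prediction errors are dominated by `priorCov`. -/
theorem predError_bound (hW : SigmaW.PosDef) {t n : ℕ} (ht : t ≤ n) :
    MemLp (predError A t) 2 ((trackingPolicy A Sigma0 SigmaW P).jointLaw μ x n) ∧
      (priorCov A Sigma0 SigmaW P t - crossMoment ((trackingPolicy A Sigma0 SigmaW P).jointLaw
        μ x n) (predError A t) (predError A t)).PosSemidef := by
  set π := trackingPolicy A Sigma0 SigmaW P
  have := isProbabilityMeasure_jointLaw hx π n
  induction t with
  | zero =>
    have h : (predError A 0 : (Fin (n + 1) → EuclideanSpace ℝ (Fin p)) ×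
        (Fin (n + 1) → EuclideanSpace ℝ (Fin p)) → _) = fun z => coord z.1 0 := by
      ext1 z; simp [predError, prev]
    have hl : HasLaw (fun z => coord z.1 0) (multivariateGaussian 0 Sigma0) (π.jointLaw μ x n) :=
      ⟨by fun_prop, by rw [map_state_jointLaw hx π n (Nat.zero_le n), hx.law_init.map_eq]⟩
    have hS : Sigma0.PosDef := posDef_priorCov hP hNP 0
    rw [h, crossMoment_of_hasLaw hl hS.posSemidef]
    refine ⟨memLp_state_jointLaw hx π n (Nat.zero_le n), ?_⟩
    rw [priorCov, sub_self]
    exact Matrix.PosSemidef.zero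
  | succ t ih =>
    obtain ⟨he, hM⟩ := ih (by omega)
    obtain ⟨he', hM'⟩ := error_of_predError hP hNP hx (show t ≤ n by omega) he hM
    have hw := hasLaw_noise_jointLaw hx π n (show t < n by omega)
    have hwL := memLp_noise_jointLaw hx π n (show t < n by omega)
    have hxL := memLp_state_jointLaw hx π n (show t ≤ n by omega)
    have hyL : MemLp (fun z => coord z.2 t) 2 (π.jointLaw μ x n) := by
      have := hxL.sub he'
      refine this.ae_eq (Eventually.of_forall fun z => ?_)
      simp
    have hxw := crossMoment_eq_zero_of_indepFun (indepFun_noise_state hx π n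
      (show t < n by omega) le_rfl) hwL hxL (integral_of_hasLaw hw)
    have hyw := crossMoment_eq_zero_of_indepFun (indepFun_noise_output hx π n
      (show t < n by omega) le_rfl) hwL hyL (integral_of_hasLaw hw)
    have hew := crossMoment_sub_right hxL hyL hwL
    rw [hxw, hyw, sub_zero, ← transpose_crossMoment, Matrix.transpose_eq_zero] at hew
    have h : (predError A (t + 1) : (Fin (n + 1) → EuclideanSpace ℝ (Fin p)) ×
        (Fin (n + 1) → EuclideanSpace ℝ (Fin p)) → _) = fun z =>
        Matrix.toEuclideanCLM (𝕜 := ℝ) A (coord z.1 t - coord z.2 t) +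
        Matrix.toEuclideanCLM (𝕜 := ℝ) 1
          (coord z.1 (t + 1) - Matrix.toEuclideanCLM (𝕜 := ℝ) A (coord z.1 t)) := by
      ext1 z; simp only [predError, prev, map_one, map_sub, one_apply_eq_self]; abel
    rw [h]
    refine ⟨(memLp_linear _ he').add (memLp_linear _ hwL), ?_⟩
    rw [crossMoment_linear_add_linear _ _ he' hwL hew, crossMoment_of_hasLaw hw hW.posSemidef, priorCov,
      predCov]
    convert posSemidef_conj hM' A using 1
    simp [Matrix.mul_sub, Matrix.sub_mul]

theorem meetsDistortion_trackingPolicy (hW : SigmaW.PosDef) {D : ℝ} (hD : ∀ t, (P t).trace ≤ D) (n : ℕ) :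
    (trackingPolicy A Sigma0 SigmaW P).MeetsDistortion μ x n D := by
  intro i
  have ht : (i : ℕ) ≤ n := Nat.lt_succ_iff.1 i.2
  obtain ⟨he, hM⟩ := predError_bound hP hNP hx hW ht
  obtain ⟨he', hM'⟩ := error_of_predError hP hNP hx ht he hM
  simp only [coord_val] at he' hM'
  have h1 : ∫⁻ z, ‖z.1 i - z.2 i‖ₑ ^ 2 ∂((trackingPolicy A Sigma0 SigmaW P).jointLaw μ x n) =
      ENNReal.ofReal (∫ z, ‖z.1 i - z.2 i‖ ^ 2
        ∂((trackingPolicy A Sigma0 SigmaW P).jointLaw μ x n)) := by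
    have := isProbabilityMeasure_jointLaw hx (trackingPolicy A Sigma0 SigmaW P) n
    rw [ofReal_integral_eq_lintegral_ofReal (he'.integrable_norm_pow (by norm_num))
      (Eventually.of_forall fun z => by positivity)]
    refine lintegral_congr fun z => ?_
    rw [ENNReal.ofReal_pow (norm_nonneg _), ofReal_norm]
  rw [h1, ← trace_crossMoment he']
  refine ENNReal.ofReal_le_ofReal (le_trans ?_ (hD i))
  have := hM'.trace_nonneg
  rw [Matrix.trace_sub] at this
  linarith

omit hP hNP in
/-- The joint law of a linear policy has a density with respect to the product of the source law and
the output law of a policy without gain. -/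
theorem jointLaw_linearPolicy_eq_withDensity {K U W : ℕ → Matrix (Fin p) (Fin p) ℝ}
    (hU : ∀ t, (U t).PosDef) (hV : ∀ t, (W t).PosDef) (n : ℕ) :
    (linearPolicy A K U).jointLaw μ x n =
      (((linearPolicy A K U).jointLaw μ x n).fst.prod
        ((linearPolicy A 0 W).causalKernel (n + 1) 0)).withDensity fun z =>
          ENNReal.ofReal (Real.exp (pathRatio A K U W (n + 1) z.1 z.2)) := by
  refine Measure.ext_of_lintegral _ fun f hf => ?_
  have hm : Measurable fun z : (Fin (n + 1) → EuclideanSpace ℝ (Fin p)) ×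
      (Fin (n + 1) → EuclideanSpace ℝ (Fin p)) =>
      ENNReal.ofReal (Real.exp (pathRatio A K U W (n + 1) z.1 z.2)) :=
    (Real.measurable_exp.comp (measurable_pathRatio A K U W _ measurable_fst
      measurable_snd)).ennreal_ofReal
  rw [lintegral_withDensity_eq_lintegral_mul _ hm hf, lintegral_prod _ (hm.mul hf).aemeasurable,
    fst_jointLaw hx, sourceLaw, lintegral_map (hm.mul hf).lintegral_prod_right'
      (hx.measurable_path (n + 1)), lintegral_jointLaw hx _ _ hf]
  refine lintegral_congr fun ω => ?_
  rw [lintegral_causalKernel_eq_pathRatio A K hU hV (n + 1) (fun i => x i ω)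
    (f := fun y => f (fun i => x i ω, y)) (hf.comp measurable_prodMk_left),
    causalKernel_zero_gain A W (n + 1) (fun i => x i ω) 0]
  rfl

/-- The step ratio is the log-likelihood ratio of the policy noise and of `yₜ - A yₜ₋₁`; the latter
has a covariance of at most `priorCov - Pₜ`. -/
theorem integral_stepRatio_le (hW : SigmaW.PosDef) {t n : ℕ} (ht : t ≤ n) :
    Integrable (fun z => stepRatio A (fun t => gain (P t) (priorCov A Sigma0 SigmaW P t))
      (fun t => testCov (P t) (priorCov A Sigma0 SigmaW P t))
      (fun t => priorCov A Sigma0 SigmaW P t - P t) t (coord z.1 t) (prev z.2 t) (coord z.2 t))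
      ((trackingPolicy A Sigma0 SigmaW P).jointLaw μ x n) ∧
    ∫ z, stepRatio A (fun t => gain (P t) (priorCov A Sigma0 SigmaW P t))
      (fun t => testCov (P t) (priorCov A Sigma0 SigmaW P t))
      (fun t => priorCov A Sigma0 SigmaW P t - P t) t (coord z.1 t) (prev z.2 t) (coord z.2 t)
      ∂((trackingPolicy A Sigma0 SigmaW P).jointLaw μ x n) ≤
      1 / 2 * (Real.log (priorCov A Sigma0 SigmaW P t).det - Real.log (P t).det) := by
  have := isProbabilityMeasure_jointLaw hx (trackingPolicy A Sigma0 SigmaW P) n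
  obtain ⟨he, hM⟩ := predError_bound hP hNP hx hW ht
  have hN := posDef_priorCov hP hNP t
  have hU := posDef_testCov (hP t) hN (hNP t)
  have hu : MemLp (policyNoise A (fun t => gain (P t) (priorCov A Sigma0 SigmaW P t)) t) 2
      ((trackingPolicy A Sigma0 SigmaW P).jointLaw μ x n) := by
    rw [trackingPolicy]; exact memLp_policyNoise hx ht
  have hv : MemLp (fun z => Matrix.toEuclideanCLM (𝕜 := ℝ)
      (gain (P t) (priorCov A Sigma0 SigmaW P t)) (predError A t z) +
      Matrix.toEuclideanCLM (𝕜 := ℝ) 1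
        (policyNoise A (fun t => gain (P t) (priorCov A Sigma0 SigmaW P t)) t z)) 2
      ((trackingPolicy A Sigma0 SigmaW P).jointLaw μ x n) :=
    (memLp_linear _ he).add (memLp_linear 1 hu)
  have hstep : ∀ z : (Fin (n + 1) → EuclideanSpace ℝ (Fin p)) ×
      (Fin (n + 1) → EuclideanSpace ℝ (Fin p)),
      stepRatio A (fun t => gain (P t) (priorCov A Sigma0 SigmaW P t))
      (fun t => testCov (P t) (priorCov A Sigma0 SigmaW P t))
      (fun t => priorCov A Sigma0 SigmaW P t - P t) t (coord z.1 t) (prev z.2 t) (coord z.2 t) =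
      logGauss (testCov (P t) (priorCov A Sigma0 SigmaW P t))
        (policyNoise A (fun t => gain (P t) (priorCov A Sigma0 SigmaW P t)) t z) -
      logGauss (priorCov A Sigma0 SigmaW P t - P t)
        (Matrix.toEuclideanCLM (𝕜 := ℝ) (gain (P t) (priorCov A Sigma0 SigmaW P t))
          (predError A t z) + Matrix.toEuclideanCLM (𝕜 := ℝ) 1
          (policyNoise A (fun t => gain (P t) (priorCov A Sigma0 SigmaW P t)) t z)) := fun z => by
    rw [stepRatio, coord_sub_linear_prev A (fun t => gain (P t) (priorCov A Sigma0 SigmaW P t))]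
    rfl
  simp only [hstep]
  have hi1 := integrable_logGauss (testCov (P t) (priorCov A Sigma0 SigmaW P t)) hu
  have hi2 := integrable_logGauss (priorCov A Sigma0 SigmaW P t - P t) hv
  refine ⟨hi1.sub hi2, ?_⟩
  rw [integral_sub hi1 hi2, integral_logGauss _ hu, integral_logGauss _ hv,
    crossMoment_linear_add_linear _ _ he hu (crossMoment_predError_policyNoise hx ht he),
    crossMoment_policyNoise hP hNP hx ht, trace_inv_mul_self hU]
  have htr : ((priorCov A Sigma0 SigmaW P t - P t)⁻¹ *
      (gain (P t) (priorCov A Sigma0 SigmaW P t) *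
        crossMoment ((trackingPolicy A Sigma0 SigmaW P).jointLaw μ x n) (predError A t)
          (predError A t) * (gain (P t) (priorCov A Sigma0 SigmaW P t))ᵀ +
        1 * testCov (P t) (priorCov A Sigma0 SigmaW P t) * 1ᵀ)).trace ≤ (p : ℝ) := by
    have h1 := trace_mul_nonneg (hNP t).inv.posSemidef
      (posSemidef_conj hM (gain (P t) (priorCov A Sigma0 SigmaW P t)))
    have h2 := trace_inv_mul_self (hNP t)
    nth_rw 2 [← gain_conj_add (hP t) hN] at h2
    rw [Matrix.mul_sub (gain _ _), Matrix.sub_mul (gain _ _ * _), Matrix.mul_sub,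
      Matrix.trace_sub] at h1
    rw [Matrix.mul_add, Matrix.trace_add] at h2
    rw [Matrix.one_mul, Matrix.transpose_one, Matrix.mul_one, Matrix.mul_add, Matrix.trace_add]
    linarith
  have hdet : Real.log (testCov (P t) (priorCov A Sigma0 SigmaW P t)).det +
      Real.log (priorCov A Sigma0 SigmaW P t).det =
      Real.log (P t).det + Real.log (priorCov A Sigma0 SigmaW P t - P t).det := by
    rw [← Real.log_mul hU.det_pos.ne' hN.det_pos.ne', ← Real.log_mul (hP t).det_pos.ne'
      (hNP t).det_pos.ne', det_testCov_mul (hP t) hN]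
  linarith

/-- Replacing the output law by that of a policy without gain bounds the mutual information by the
mean of the log-likelihood ratio. -/
theorem mutualInfo_trackingPolicy_le (hW : SigmaW.PosDef) (n : ℕ) :
    (trackingPolicy A Sigma0 SigmaW P).mutualInfo μ x n ≤
      ENNReal.ofReal (∑ t ∈ Finset.range (n + 1), 1 / 2 *
        (Real.log (priorCov A Sigma0 SigmaW P t).det - Real.log (P t).det)) := by
  have hJp := isProbabilityMeasure_jointLaw hx (trackingPolicy A Sigma0 SigmaW P) n
  have hU : ∀ t, (testCov (P t) (priorCov A Sigma0 SigmaW P t)).PosDef := fun t =>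
    posDef_testCov (hP t) (posDef_priorCov hP hNP t) (hNP t)
  refine (klDiv_prod_marginals_le _ ((linearPolicy A 0 fun t =>
    priorCov A Sigma0 SigmaW P t - P t).causalKernel (n + 1) 0)).trans ?_
  have hJ := jointLaw_linearPolicy_eq_withDensity hx
    (K := fun t => gain (P t) (priorCov A Sigma0 SigmaW P t)) hU hNP n
  rw [← trackingPolicy] at hJ
  set J := (trackingPolicy A Sigma0 SigmaW P).jointLaw μ x n with hJd
  set ν := J.fst.prod ((linearPolicy A 0 fun t =>
    priorCov A Sigma0 SigmaW P t - P t).causalKernel (n + 1) 0)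
  set g := fun z : (Fin (n + 1) → EuclideanSpace ℝ (Fin p)) ×
    (Fin (n + 1) → EuclideanSpace ℝ (Fin p)) => pathRatio A
    (fun t => gain (P t) (priorCov A Sigma0 SigmaW P t))
    (fun t => testCov (P t) (priorCov A Sigma0 SigmaW P t))
    (fun t => priorCov A Sigma0 SigmaW P t - P t) (n + 1) z.1 z.2
  have hgm : Measurable g := measurable_pathRatio _ _ _ _ _ measurable_fst measurable_snd
  have hst := fun t (ht : t ∈ Finset.range (n + 1)) =>
    integral_stepRatio_le hP hNP hx hW (Nat.lt_succ_iff.1 (Finset.mem_range.1 ht))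
  have hgi : Integrable g J := integrable_finsetSum _ fun t ht => (hst t ht).1
  have hkl := klDiv_withDensity_exp (ν := ν) hgm (hJ ▸ hJp) (hJ ▸ hgi)
  rw [← hJ] at hkl
  rw [hkl]
  refine ENNReal.ofReal_le_ofReal ?_
  simp only [g, pathRatio]
  rw [integral_finsetSum _ fun t ht => (hst t ht).1]
  exact Finset.sum_le_sum fun t ht => (hst t ht).2

end CausalPolicy

end SRD
end

noncomputable section
namespace SRD

/-! ### Asymptotic rates -/

section Limits

variable {p : ℕ} {A Sigma0 SigmaW : Matrix (Fin p) (Fin p) ℝ} {Ω : Type*} [MeasurableSpace Ω]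
  {μ : Measure Ω} [IsProbabilityMeasure μ] {x w : ℕ → Ω → EuclideanSpace ℝ (Fin p)}
  (hx : IsGaussMarkovSource A Sigma0 SigmaW μ x w) (h0 : Sigma0.PosDef) (hW : SigmaW.PosDef)

theorem predCov_smul_sub {c s : ℝ} (P : Matrix (Fin p) (Fin p) ℝ) :
    predCov A SigmaW (c • P) - (c + s * (1 - c)) • P =
      c • (predCov A SigmaW P - P) + (1 - c) • (SigmaW - s • P) := by
  simp only [predCov, Matrix.mul_smul, Matrix.smul_mul]
  module

include h0 hW

/-- A positive definite `P ≼ A P Aᵀ + Σw` is the limit of error covariances that a Gaussian policy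
can follow from the start: take `Pₜ = (1 - (1 - s)ᵗ⁺¹) P` for a small step `s`. -/
theorem exists_errorCov {P : Matrix (Fin p) (Fin p) ℝ} (hP : P.PosDef)
    (hle : (predCov A SigmaW P - P).PosSemidef) :
    ∃ c : ℕ → ℝ, (∀ t, 0 < c t ∧ c t ≤ 1) ∧ Tendsto c atTop (𝓝 1) ∧
      ∀ t, (priorCov A Sigma0 SigmaW (fun t => c t • P) t - c t • P).PosDef := by
  obtain ⟨s₁, hs₁, h₁⟩ := PosDef.exists_sub_smul_posDef h0 hP.posSemidef
  obtain ⟨s₂, hs₂, h₂⟩ := PosDef.exists_sub_smul_posDef hW hP.posSemidef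
  set s := min (min s₁ s₂) (1 / 2) with hs
  have hs0 : 0 < s := by positivity
  have hs1 : s ≤ 1 / 2 := min_le_right _ _
  have h₁' := h₁ s hs0.le ((min_le_left _ _).trans (min_le_left _ _))
  have h₂' := h₂ s hs0.le ((min_le_left _ _).trans (min_le_right _ _))
  have hpow : ∀ t : ℕ, 0 < (1 - s) ^ (t + 1) := fun t => pow_pos (by linarith) _
  refine ⟨fun t => 1 - (1 - s) ^ (t + 1), fun t => ⟨?_, ?_⟩, ?_, fun t => ?_⟩
  · have := pow_lt_one₀ (show 0 ≤ 1 - s by linarith) (by linarith) (Nat.succ_ne_zero t)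
    simpa using this
  · have := hpow t; linarith
  · have := (tendsto_pow_atTop_nhds_zero_of_lt_one (show 0 ≤ 1 - s by linarith)
      (by linarith)).comp (tendsto_add_atTop_nat 1)
    simpa using tendsto_const_nhds.sub this
  · cases t with
    | zero => simpa [priorCov] using h₁'
    | succ t =>
      have hc : 1 - (1 - s) ^ (t + 1 + 1) =
          (1 - (1 - s) ^ (t + 1)) + s * (1 - (1 - (1 - s) ^ (t + 1))) := by ring
      simp only [priorCov]
      rw [hc, predCov_smul_sub]
      refine Matrix.PosDef.posSemidef_add (hle.smul ?_) (h₂'.smul ?_)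
      · have := pow_le_one₀ (n := t + 1) (show 0 ≤ 1 - s by linarith) (by linarith)
        linarith
      · simpa using hpow t

include hx

/-- Achievability: every feasible `P` is the limit of the error covariances of a policy that meets
the distortion constraint at all times. -/
theorem exists_policy_rate_le {D : ℝ} {P : Matrix (Fin p) (Fin p) ℝ} (hP : P.PosDef)
    (hle : (predCov A SigmaW P - P).PosSemidef) (hD : P.trace ≤ D) :
    ∃ π : CausalPolicy (EuclideanSpace ℝ (Fin p)), (∀ n, π.MeetsDistortion μ x n D) ∧
      ∃ u : ℕ → ℝ, Tendsto u atTop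
          (𝓝 (1 / 2 * (Real.log (predCov A SigmaW P).det - Real.log P.det))) ∧
        ∀ n, π.rate μ x n ≤ ENNReal.ofReal (u n) := by
  obtain ⟨c, hc, hlim, hNP⟩ := exists_errorCov (A := A) h0 hW hP hle
  have hPt : ∀ t, (c t • P).PosDef := fun t => hP.smul (hc t).1
  set a : ℕ → ℝ := fun t => 1 / 2 * (Real.log (priorCov A Sigma0 SigmaW (fun t => c t • P) t).det -
    Real.log (c t • P).det) with ha
  refine ⟨trackingPolicy A Sigma0 SigmaW fun t => c t • P, fun n =>
    CausalPolicy.meetsDistortion_trackingPolicy hPt hNP hx hW (fun t => ?_) n,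
    fun n => ((n + 1 : ℕ) : ℝ)⁻¹ * ∑ t ∈ Finset.range (n + 1), a t, ?_, fun n => ?_⟩
  · rw [Matrix.trace_smul, smul_eq_mul]
    have := hP.posSemidef.trace_nonneg
    nlinarith [(hc t).2, this]
  · refine Tendsto.comp (Tendsto.cesaro ?_) (tendsto_add_atTop_nat 1)
    have hPlim : Tendsto (fun t => c t • P) atTop (𝓝 P) := by
      simpa using hlim.smul_const P
    have hdet : ∀ M : Matrix (Fin p) (Fin p) ℝ, ContinuousAt Matrix.det M := fun M =>
      (Continuous.matrix_det continuous_id).continuousAt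
    have hpred : Continuous (predCov A SigmaW) := by
      unfold predCov; fun_prop
    have hN := posDef_predCov (A := A) hW hP.posSemidef
    have h1 : Tendsto (fun t => Real.log (c t • P).det) atTop (𝓝 (Real.log P.det)) :=
      (((Real.continuousAt_log hP.det_pos.ne').tendsto).comp (hdet P).tendsto).comp hPlim
    have h2 : Tendsto (fun t => Real.log (priorCov A Sigma0 SigmaW (fun t => c t • P) t).det) atTop
        (𝓝 (Real.log (predCov A SigmaW P).det)) := by
      rw [← tendsto_add_atTop_iff_nat 1]
      exact (((Real.continuousAt_log hN.det_pos.ne').tendsto).comp (hdet _).tendsto).comp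
        ((hpred.tendsto P).comp hPlim)
    exact (h2.sub h1).const_mul _
  · have := CausalPolicy.mutualInfo_trackingPolicy_le hPt hNP hx hW n
    beta_reduce
    rw [CausalPolicy.rate, inv_mul_eq_div, ENNReal.ofReal_div_of_pos (by positivity)]
    have hcast : ENNReal.ofReal ((n + 1 : ℕ) : ℝ) = (n : ℝ≥0∞) + 1 := by
      rw [ENNReal.ofReal_natCast]; push_cast; rfl
    rw [hcast]
    exact ENNReal.div_le_div_right this _

/-- Converse: if `q` exceeds the determinants of all nearly feasible pairs, then no policy has an
asymptotic rate below `½ log det Σw - ½ log q`. -/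
theorem eventually_lt_finiteSRD {D δ q : ℝ} (hD : 0 ≤ D) (hδ : 0 < δ)
    (hq : ∀ z ∈ relaxedFeasible A SigmaW D δ, z.2.det < q) {a : ℝ≥0∞}
    (ha : a < ENNReal.ofReal (1 / 2 * Real.log SigmaW.det - 1 / 2 * Real.log q)) :
    ∀ᶠ n in atTop, a < finiteSRD μ x D n := by
  set L := 1 / 2 * Real.log SigmaW.det - 1 / 2 * Real.log q with hL
  set b := (p - D + Real.log Sigma0.det) / 2 with hb
  have hinv : Tendsto (fun n : ℕ => ((n : ℝ) + 1)⁻¹) atTop (𝓝 0) := by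
    simpa using tendsto_one_div_add_atTop_nhds_zero_nat (𝕜 := ℝ)
  have hlim : Tendsto (fun n : ℕ => (b + n * L) / ((n : ℝ) + 1)) atTop (𝓝 L) := by
    have h : (fun n : ℕ => (b + n * L) / ((n : ℝ) + 1)) =
        fun n : ℕ => L + (b - L) * ((n : ℝ) + 1)⁻¹ := by
      ext n
      have : (n : ℝ) + 1 ≠ 0 := by positivity
      field_simp
      ring
    rw [h]
    simpa using (hinv.const_mul (b - L)).const_add L
  have hev : ∀ᶠ n : ℕ in atTop, (D + 1 + p) / (n : ℝ) ≤ δ :=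
    (tendsto_const_div_atTop_nhds_zero_nat (D + 1 + p)).eventually_le_const hδ
  filter_upwards [(ENNReal.tendsto_ofReal hlim).eventually_const_lt ha, hev,
    eventually_gt_atTop 0] with n hn hnδ hn0
  refine hn.trans_le ?_
  rw [finiteSRD]
  refine le_iInf₂ fun π hπ => ?_
  obtain ⟨z, hz, hz0, hle⟩ := CausalPolicy.exists_relaxedFeasible_le_mutualInfo hx h0 hW hD hn0 hπ
  have hzq := hq z (relaxedFeasible_mono hnδ hz)
  have hlog := Real.log_le_log hz0 hzq.le
  have hcast : ENNReal.ofReal ((n : ℝ) + 1) = (n : ℝ≥0∞) + 1 := by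
    rw [ENNReal.ofReal_add (by positivity) (by positivity), ENNReal.ofReal_natCast,
      ENNReal.ofReal_one]
  rw [CausalPolicy.rate, ENNReal.ofReal_div_of_pos (by positivity), hcast]
  refine ENNReal.div_le_div_right (le_trans (ENNReal.ofReal_le_ofReal ?_) hle) _
  have : (n : ℝ) * L ≤ n * (-(1 / 2) * Real.log z.2.det + 1 / 2 * Real.log SigmaW.det) :=
    mul_le_mul_of_nonneg_left (by rw [hL]; linarith) (by positivity)
  linarith

end Limits

/-- At a maximizer, `Q` is the smoothing covariance of `P`, so that the objective is the rate of
the stationary Gaussian policy with error covariance `P`. -/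
theorem objective_eq_of_maximizer {p : ℕ} {A SigmaW : Matrix (Fin p) (Fin p) ℝ}
    (hW : SigmaW.PosDef) {D : ℝ} {P Q : Matrix (Fin p) (Fin p) ℝ}
    (hPQ : SDPFeasible A SigmaW D P Q)
    (hmax : ∀ P' Q', SDPFeasible A SigmaW D P' Q' → Q'.det ≤ Q.det) :
    -(1 / 2) * Real.log Q.det + 1 / 2 * Real.log SigmaW.det =
      1 / 2 * (Real.log (predCov A SigmaW P).det - Real.log P.det) := by
  have hP := hPQ.posDef_P
  have hS := posDef_smoothCov (A := A) hW hP
  have hN := posDef_predCov (A := A) hW hP.posSemidef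
  have hle : Q.det ≤ (smoothCov A SigmaW P).det :=
    det_le_det hPQ.posDef_Q.posSemidef ((lmi_iff hW hP.posSemidef).1 hPQ.lmi)
  have hge : (smoothCov A SigmaW P).det ≤ Q.det := by
    refine hmax P _ ⟨hP, hS, hPQ.le_prediction, hPQ.trace_le, (lmi_iff hW hP.posSemidef).2 ?_⟩
    rw [sub_self]
    exact Matrix.PosSemidef.zero
  have hdet := congrArg Real.log (det_smoothCov_mul (A := A) hW hP)
  rw [Real.log_mul hS.det_pos.ne' hN.det_pos.ne', Real.log_mul hP.det_pos.ne' hW.det_pos.ne'] at hdet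
  rw [le_antisymm hle hge]
  linarith

end SRD
end

theorem theorem1 {p : ℕ} (A Sigma0 SigmaW : Matrix (Fin p) (Fin p) ℝ)
    (hSigma0 : Sigma0.PosDef) (hSigmaW : SigmaW.PosDef)
    {Ω : Type*} [MeasurableSpace Ω] (μ : Measure Ω) [IsProbabilityMeasure μ]
    (x w : ℕ → Ω → EuclideanSpace ℝ (Fin p))
    (hx : SRD.IsGaussMarkovSource A Sigma0 SigmaW μ x w)
    (D : ℝ) (hD : 0 < D) :
    Tendsto (fun n => SRD.finiteSRD μ x D n) atTop (𝓝 (SRD.interchangedSRD μ x D)) ∧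
      ∃ R : ℝ≥0, SRD.interchangedSRD μ x D = (R : ℝ≥0∞) ∧
        IsLeast (SRD.sdpValues A SigmaW D) (R : ℝ) := by
  obtain ⟨P, Q, hPQ, hmax, hrel⟩ := SRD.exists_maximizer (A := A) hSigmaW hD
  have hP := hPQ.posDef_P
  set R : ℝ := -(1 / 2) * Real.log Q.det + 1 / 2 * Real.log SigmaW.det with hR
  have hobj := SRD.objective_eq_of_maximizer hSigmaW hPQ hmax
  rw [← hR] at hobj
  have hR0 : 0 ≤ R := by
    have := Real.log_le_log hP.det_pos (SRD.det_le_det hP.posSemidef hPQ.le_prediction)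
    rw [hobj]
    unfold SRD.predCov
    linarith
  obtain ⟨π, hπD, u, hu, hπu⟩ :=
    SRD.exists_policy_rate_le hx hSigma0 hSigmaW hP hPQ.le_prediction hPQ.trace_le
  rw [← hobj] at hu
  have hu' := ENNReal.tendsto_ofReal hu
  have hfin : ∀ (π' : SRD.CausalPolicy (EuclideanSpace ℝ (Fin p))),
      (∀ n, π'.MeetsDistortion μ x n D) → ∀ n, SRD.finiteSRD μ x D n ≤ π'.rate μ x n :=
    fun π' h n => iInf₂_le π' (h n)
  have hlow : ∀ a < ENNReal.ofReal R, ∀ᶠ n in atTop, a < SRD.finiteSRD μ x D n := by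
    intro a ha
    have hr : a.toReal < R := (ENNReal.lt_ofReal_iff_toReal_lt ha.ne_top).1 ha
    set r := a.toReal
    -- `q` is chosen so that `½ log det Σw - ½ log q` lies strictly between `r` and `R`.
    set e := Real.exp (Real.log SigmaW.det - 2 * r) with he
    have hQ0 := hPQ.posDef_Q.det_pos
    have hQe : Q.det < e := by
      rw [he, ← Real.log_lt_iff_lt_exp hQ0]
      linarith
    obtain ⟨δ, hδ, hq⟩ := hrel ((e - Q.det) / 2) (by linarith)
    refine SRD.eventually_lt_finiteSRD hx hSigma0 hSigmaW hD.le hδ hq ?_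
    rw [ENNReal.lt_ofReal_iff_toReal_lt ha.ne_top]
    have : Real.log (Q.det + (e - Q.det) / 2) < Real.log SigmaW.det - 2 * r := by
      rw [Real.log_lt_iff_lt_exp (by linarith)]
      linarith
    linarith
  have hfinite : Tendsto (fun n => SRD.finiteSRD μ x D n) atTop (𝓝 (ENNReal.ofReal R)) :=
    tendsto_order.2 ⟨hlow, fun a ha => (hu'.eventually_lt_const ha).mono fun n hn =>
      ((hfin π hπD n).trans (hπu n)).trans_lt hn⟩
  have hrate : Tendsto (fun n => π.rate μ x n) atTop (𝓝 (ENNReal.ofReal R)) :=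
    tendsto_of_tendsto_of_tendsto_of_le_of_le hfinite hu' (hfin π hπD) hπu
  have hint : SRD.interchangedSRD μ x D = ENNReal.ofReal R := by
    refine le_antisymm (iInf₂_le_of_le π hπD (iInf₂_le (ENNReal.ofReal R) hrate)) ?_
    exact le_iInf₂ fun π' hπ' => le_iInf₂ fun r hr =>
      le_of_tendsto_of_tendsto' hfinite hr (hfin π' hπ')
  rw [hint]
  refine ⟨hfinite, ⟨R, hR0⟩, ENNReal.ofReal_eq_coe_nnreal hR0, ⟨P, Q, hPQ, rfl⟩, ?_⟩
  rintro v ⟨P', Q', h', rfl⟩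
  have := Real.log_le_log h'.posDef_Q.det_pos (hmax P' Q' h')
  change R ≤ _
  linarith
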